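/- Throughout, ideals of a $C^*$-algebra are closed and two-sided, and "the ideal generated by" a set is the smallest such ideal containing it. Let $A$ be a (not necessarily unital) $C^*$-algebra. For positive $a,b\in A$ write $a\precsim b$ if for every $\varepsilon>0$ there is $x\in A$ with $\|x^*bx-a\|<\varepsilon$. $A$ is *purely infinite* if it has no character (nonzero multiplicative linear functional) and, for all positive $a,b\in A$, $a$ belongs to the ideal $\overline{AbA}$ generated by $b$ if and only if $a\precsim b$. $A$ has *property (IP)* if for all ideals $I\not\subseteq J$ of $A$ there is a projection in $I\setminus J$. $\mathrm{Prim}(A)$ is the set of primitive ideals (kernels of irreducible representations) of $A$ with the Jacobson topology: $J\in\overline{\mathcal M}$ if and only if $\bigcap_{I\in\mathcal M}I\subseteq J$; compactness of subsets of $\mathrm{Prim}(A)$ means the Heine–Borel covering property (no Hausdorff condition). Projections $p,q$ are equivalent, $p\sim q$, if $p=v^*v$ and $q=vv^*$ for some $v$ in the algebra. A projection is *infinite* if it is equivalent to a proper subprojection of itself, and $p$ is *properly infinite* if there are projections $p_1,p_2\le p$ with $p_1p_2=0$ and $p_1\sim p_2\sim p$. A *hereditary* sub-$C^*$-algebra $B\subseteq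 A$ is a closed $*$-subalgebra such that $0\le a\le b$, $a\in A$, $b\in B$ imply $a\in B$. **Proposition.** If $A$ is separable, the following four conditions are equivalent: (i) $A$ is purely infinite and $\mathrm{Prim}(A)$ has a basis for its topology consisting of compact-open sets; (ii) $A$ is purely infinite and has property (IP); (iii) every nonzero hereditary sub-$C^*$-algebra $B$ of $A$ is generated, as an ideal of $B$, by its properly infinite projections; (iv) every nonzero hereditary sub-$C^*$-algebra of every quotient of $A$ contains an infinite projection. Moreover, the implications (ii) $\Rightarrow$ (i), (ii) $\Leftrightarrow$ (iii) and (iii) $\Leftrightarrow$ (iv) hold for every $C^*$-algebra $A$, separable or not. -/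

import Mathlib

universe u

namespace CStarPI

section Projections

variable {R : Type*} [NonUnitalRing R] [StarRing R]

/-- Murray-von Neumann equivalence `p ∼ q`. -/
def MvNEquiv (p q : R) : Prop :=
  ∃ v : R, star v * v = p ∧ v * star v = q

/-- `q` is a subprojection of the projection `p`. For projections, `q ≤ p` means `p * q = q`. -/
def IsSubprojection (q p : R) : Prop :=
  IsStarProjection q ∧ p * q = q

/-- An infinite projection: it is equivalent to a proper subprojection of itself. -/
def IsInfiniteProjection (p : R) : Prop :=
  IsStarProjection p ∧ ∃ q : R, IsSubprojection q p ∧ q ≠ p ∧ MvNEquiv p q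

/-- A properly infinite projection: it has two mutually orthogonal subprojections, both
equivalent to it. -/
def IsProperlyInfiniteProjection (p : R) : Prop :=
  IsStarProjection p ∧ ∃ p₁ p₂ : R, IsSubprojection p₁ p ∧ IsSubprojection p₂ p ∧
    p₁ * p₂ = 0 ∧ MvNEquiv p₁ p ∧ MvNEquiv p₂ p

end Projections

section Ideals

variable {A : Type*} [NonUnitalNormedRing A] [Module ℂ A]

/-- Closed two-sided ideals. -/
def IsClosedIdeal (I : Submodule ℂ A) : Prop :=
  IsClosed (I : Set A) ∧ ∀ x ∈ I, ∀ a : A, a * x ∈ I ∧ x * a ∈ I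

/-- The closed two-sided ideal generated by a set. -/
def closedIdealSpan (S : Set A) : Submodule ℂ A :=
  sInf {I : Submodule ℂ A | IsClosedIdeal I ∧ S ⊆ I}

/-- The ideal property (IP): projections separate closed ideals. -/
def HasIdealProperty (A : Type*) [NonUnitalNormedRing A] [StarRing A] [Module ℂ A] : Prop :=
  ∀ I J : Submodule ℂ A, IsClosedIdeal I → IsClosedIdeal J → ¬ I ≤ J →
    ∃ p : A, IsStarProjection p ∧ p ∈ I ∧ p ∉ J

end Ideals

section PurelyInfinite

variable {A : Type*} [NonUnitalCStarAlgebra A]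

/-- Cuntz comparison `a ≾ b`, used for positive elements. -/
def CuntzLE (a b : A) : Prop :=
  ∀ ε : ℝ, 0 < ε → ∃ x : A, ‖star x * b * x - a‖ < ε

/-- A C⋆-algebra is purely infinite if it has no characters and if, for positive `a` and `b`,
`a` lies in the closed ideal generated by `b` exactly when `a ≾ b`. -/
def IsPurelyInfinite (A : Type*) [NonUnitalCStarAlgebra A] [PartialOrder A] : Prop :=
  IsEmpty (WeakDual.characterSpace ℂ A) ∧
    ∀ a b : A, 0 ≤ a → 0 ≤ b → (a ∈ closedIdealSpan {b} ↔ CuntzLE a b)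

/-- Hereditary sub-C⋆-algebras: closed ⋆-subalgebras `B` such that `0 ≤ a ≤ b ∈ B` implies
`a ∈ B`. -/
def IsHereditary [PartialOrder A] (B : NonUnitalStarSubalgebra ℂ A) : Prop :=
  IsClosed (B : Set A) ∧ ∀ a b : A, 0 ≤ a → a ≤ b → b ∈ B → a ∈ B

end PurelyInfinite

section Prim

variable {A : Type u} [NonUnitalCStarAlgebra A]

/-- An irreducible representation on a Hilbert space: a nonzero ⋆-homomorphism into the bounded
operators without nontrivial closed invariant subspaces. -/
def IsIrreducible {H : Type*} [NormedAddCommGroup H] [InnerProductSpace ℂ H] [CompleteSpace H]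
    (π : A →⋆ₙₐ[ℂ] (H →L[ℂ] H)) : Prop :=
  π ≠ 0 ∧ ∀ K : Submodule ℂ H, IsClosed (K : Set H) → (∀ a : A, ∀ x ∈ K, π a x ∈ K) →
    K = ⊥ ∨ K = ⊤

/-- Primitive ideals: kernels of irreducible representations. (Every irreducible representation
is unitarily equivalent to one on a Hilbert space in the universe of `A`.) -/
def IsPrimitiveIdeal (I : Submodule ℂ A) : Prop :=
  ∃ (H : Type u) (_ : NormedAddCommGroup H) (_ : InnerProductSpace ℂ H) (_ : CompleteSpace H)
    (π : A →⋆ₙₐ[ℂ] (H →L[ℂ] H)), IsIrreducible π ∧ ∀ a : A, a ∈ I ↔ π a = 0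

/-- The primitive ideal space as a set; its topology is given below. -/
def Prim (A : Type u) [NonUnitalCStarAlgebra A] : Type u :=
  {I : Submodule ℂ A // IsPrimitiveIdeal I}

/-- The primitive ideals containing a given set. -/
def hull (S : Set A) : Set (Prim A) := {P | S ⊆ (P.1 : Set A)}

theorem IsPrimitiveIdeal.mul_mem {P : Submodule ℂ A} (hP : IsPrimitiveIdeal P) {x : A}
    (hx : x ∈ P) (a : A) : a * x ∈ P ∧ x * a ∈ P := by
  obtain ⟨H, _, _, _, π, -, hk⟩ := hP
  rw [hk] at hx
  simp [hk, hx]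

/-- Primitive ideals are prime. -/
theorem IsPrimitiveIdeal.prime {P : Submodule ℂ A} (hP : IsPrimitiveIdeal P) {s t : A}
    (h : ∀ a : A, s * a * t ∈ P) : s ∈ P ∨ t ∈ P := by
  obtain ⟨H, _, _, _, π, ⟨h0, hirr⟩, hk⟩ := hP
  simp only [hk] at h ⊢
  let L : Submodule ℂ H := ⨅ a : A, LinearMap.ker (π a : H →ₗ[ℂ] H)
  have memL : ∀ x, x ∈ L ↔ ∀ a, π a x = 0 := by intro x; simp [L, Submodule.mem_iInf]
  have hL : L = ⊥ := by
    refine (hirr L ?_ ?_).resolve_right ?_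
    · have : (L : Set H) = ⋂ a : A, {x | π a x = 0} := by ext x; simp [memL]
      rw [this]
      exact isClosed_iInter fun a => isClosed_eq (π a).continuous continuous_const
    · intro a x hx
      rw [memL] at hx ⊢
      intro b
      rw [hx a, map_zero]
    · intro hT
      apply h0
      ext a x
      exact (memL x).1 (hT ▸ Submodule.mem_top) a
  let K : Submodule ℂ H := ⨅ a : A, LinearMap.ker (π s * π a : H →L[ℂ] H).toLinearMap
  have memK : ∀ x, x ∈ K ↔ ∀ a, π s (π a x) = 0 := by intro x; simp [K, Submodule.mem_iInf]
  have hKc : IsClosed (K : Set H) := by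
    have : (K : Set H) = ⋂ a : A, {x | π s (π a x) = 0} := by ext x; simp [memK]
    rw [this]
    exact isClosed_iInter fun a =>
      isClosed_eq ((π s).continuous.comp (π a).continuous) continuous_const
  have hKi : ∀ a : A, ∀ x ∈ K, π a x ∈ K := by
    intro b x hx
    rw [memK] at hx ⊢
    intro a
    have := hx (a * b)
    simpa [map_mul] using this
  rcases hirr K hKc hKi with hK | hK
  · right
    ext x
    have : π t x ∈ K := by
      rw [memK]
      intro a
      have := congrArg (fun T : H →L[ℂ] H => T x) (h a)
      simpa [map_mul] using this
    rw [hK] at this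
    simpa using this
  · left
    have hsa : ∀ a, π s * π a = 0 := by
      intro a
      ext x
      exact (memK x).1 (hK ▸ Submodule.mem_top) a
    have hs : star (π s) = 0 := by
      ext x
      have : star (π s) x ∈ L := by
        rw [memL]
        intro a
        have h1 := congrArg star (hsa (star a))
        rw [star_mul, map_star, star_star, star_zero] at h1
        exact congrArg (fun T : H →L[ℂ] H => T x) h1
      rw [hL] at this
      simpa using this
    exact star_eq_zero.1 hs

/-- The Jacobson topology: the closed sets are the hulls. -/
instance instTopologicalSpacePrim : TopologicalSpace (Prim A) :=
  TopologicalSpace.ofClosed {C : Set (Prim A) | ∃ S : Set A, C = hull S}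
    ⟨Set.univ, by
      ext P
      refine ⟨fun h => h.elim, fun h => ?_⟩
      obtain ⟨H, _, _, _, π, ⟨h0, -⟩, hk⟩ := P.2
      exact h0 (by ext1 a; exact (hk a).1 (h (Set.mem_univ a)))⟩
    (by
      intro F hF
      refine ⟨⋃₀ {S : Set A | hull S ∈ F}, ?_⟩
      ext P
      constructor
      · intro h x ⟨S, hS, hx⟩
        exact h _ hS hx
      · intro h C hC
        obtain ⟨S, rfl⟩ := hF hC
        exact fun x hx => h ⟨S, hC, hx⟩)
    (by
      rintro _ ⟨S, rfl⟩ _ ⟨T, rfl⟩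
      refine ⟨{x | ∃ s ∈ S, ∃ t ∈ T, ∃ a : A, x = s * a * t}, ?_⟩
      ext P
      constructor
      · rintro (h | h) _ ⟨s, hs, t, ht, a, rfl⟩
        · exact (P.2.mul_mem (P.2.mul_mem (h hs) a).2 t).2
        · exact (P.2.mul_mem (h ht) (s * a)).1
      · intro h
        by_contra hn
        rw [Set.mem_union, not_or] at hn
        obtain ⟨s, hs, hsP⟩ := Set.not_subset.1 hn.1
        obtain ⟨t, ht, htP⟩ := Set.not_subset.1 hn.2
        rcases P.2.prime fun a => h ⟨s, hs, t, ht, a, rfl⟩ with h' | h'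
        · exact hsP h'
        · exact htP h')

theorem isClosed_iff_hull {C : Set (Prim A)} : IsClosed C ↔ ∃ S : Set A, C = hull S := by
  rw [← isOpen_compl_iff]
  change (∃ S : Set A, Cᶜᶜ = hull S) ↔ _
  rw [compl_compl]

/-- The closure in the Jacobson topology: `J` is in the closure of `M` if and only if `J` contains
the intersection of the members of `M`. -/
theorem mem_closure_iff_inter_le (M : Set (Prim A)) (J : Prim A) :
    J ∈ closure M ↔ (⨅ I ∈ M, I.1) ≤ J.1 := by
  constructor
  · intro h
    have hc : IsClosed (hull ((⨅ I ∈ M, I.1 : Submodule ℂ A) : Set A)) :=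
      isClosed_iff_hull.2 ⟨_, rfl⟩
    exact closure_minimal (fun I hI => (iInf₂_le I hI : (⨅ I ∈ M, I.1) ≤ I.1)) hc h
  · intro h
    obtain ⟨S, hS⟩ := isClosed_iff_hull.1 (isClosed_closure (s := M))
    rw [hS]
    have hle : Submodule.span ℂ S ≤ ⨅ I ∈ M, I.1 :=
      le_iInf₂ fun I hI => Submodule.span_le.2 (by
        have : I ∈ hull S := hS ▸ subset_closure hI
        exact this)
    exact fun x hx => h (hle (Submodule.subset_span hx))

/-- The primitive ideal space has a basis of compact-open sets (compactness without the
Hausdorff property). -/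
def HasCompactOpenBasis (A : Type u) [NonUnitalCStarAlgebra A] : Prop :=
  TopologicalSpace.IsTopologicalBasis {U : Set (Prim A) | IsOpen U ∧ IsCompact U}

end Prim

section Conditions

variable (A : Type u) [NonUnitalCStarAlgebra A] [PartialOrder A]

/-- Every nonzero hereditary sub-C⋆-algebra is generated, as a closed ideal of itself, by its
properly infinite projections. -/
def HereditaryGeneratedByProperlyInfinite : Prop :=
  ∀ B : NonUnitalStarSubalgebra ℂ A, IsHereditary B → B ≠ ⊥ →
    closedIdealSpan {p : B | IsProperlyInfiniteProjection p} = ⊤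

/-- Every nonzero hereditary sub-C⋆-algebra of every quotient contains an infinite projection.
The quotients of `A` are the surjective ⋆-homomorphic images `Q` of `A`; the order on `Q` is
determined by `StarOrderedRing Q`. -/
def QuotientHereditaryContainsInfinite : Prop :=
  ∀ (Q : Type u) [NonUnitalCStarAlgebra Q] [PartialOrder Q] [StarOrderedRing Q]
    (π : A →⋆ₙₐ[ℂ] Q), Function.Surjective π →
    ∀ B : NonUnitalStarSubalgebra ℂ Q, IsHereditary B → B ≠ ⊥ →
      ∃ p : B, IsInfiniteProjection p

end Conditions

end CStarPI

namespace CStarPI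

/-! ### Functional calculus: approximate units and truncations. -/

section FunctionalCalculus

variable {A : Type*} [NonUnitalCStarAlgebra A]

/-! All conditions are routed through one property, `IsSelfAbsorbing`: every positive x satisfies x
⊕ x ≾ x. Here x ⊕ c ≾ b is expressed by Gram data (`PairLE`): there are y, z with y⋆by ≈ x, z⋆bz ≈ c
and y⋆bz ≈ 0. For fixed x the elements c with x ⊕ c⋆c ≾ x form a closed ideal L(x)
(`absorbedIdeal`). If x ∈ L(x), then L(x) contains the whole ideal of x, so everything positive in
that ideal is ≾ x. A character is impossible, since its values on a Gram matrix form a matrix of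
determinant zero. Thus self-absorption implies pure infiniteness.

Conversely, let A be purely infinite. A positive a absorbs the square-zero elements of its ideal
(`IsPurelyInfinite.mem_absorbedIdeal_of_mul_self_eq_zero`). If a ∉ L(a), some irreducible
representation kills L(a) but not a. It kills those square-zero elements, hence is scalar on the
ideal of a, hence on A, and yields a character: a contradiction.

Infinite projections enter through `pairLE_defect`: if p in the hereditary subalgebra of x is
equivalent to q ≤ p, then x absorbs p - q. So (iii) puts generators of that subalgebra into L(x).
Under (iv) one divides by L(x): the image of x absorbs nothing nonzero
(`mem_absorbedIdeal_of_pairLE_mk`), so an infinite projection there is impossible unless x ∈ L(x).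
In the other direction, self-absorption and (IP) give properly infinite projections inside bAb
outside a prescribed ideal (`IsSelfAbsorbing.exists_projection_conj`), whence (iii) and (iv).

Projections themselves come from the Blackadar–Cuntz scaling construction: if (d - β)₊ absorbs (d -
α)₊ with α < β, there is a projection in the ideal of d whose ideal contains (d - β)₊
(`exists_projection_of_cut_mem_absorbedIdeal`). From (i), compactness of an open set of primitive
ideals supplies x for which (x - δ)₊ generates the ideal of that set, and the construction gives
(IP). From (iv), it shows that projections modulo the ideal generated by projections yield nothing
new (`IsSelfAbsorbing.mem_span_projections`), which again gives (IP). Finally (IP) implies a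
compact-open basis because a projection lies in a finitely generated part of any ideal containing
it. -/

theorem cfcₙ_real_mem {B : NonUnitalStarSubalgebra ℂ A} (hB : IsClosed (B : Set A)) {a : A}
    (ha : IsSelfAdjoint a) (haB : a ∈ B) (f : ℝ → ℝ) : cfcₙ f a ∈ B := by
  rw [cfcₙ_real_eq_complex f ha]
  exact NonUnitalStarAlgebra.elemental.le_of_mem hB haB (cfcₙ_mem_elemental (𝕜 := ℂ) _ a)

/-- The contraction `d (d + δ)⁻¹`, which acts as an approximate unit on `d`. -/
noncomputable def approxUnit (d : A) (δ : ℝ) : A := cfcₙ (fun t : ℝ => t / (|t| + δ)) d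

/-- The truncation `(d - α)₊`. -/
noncomputable def cut (d : A) (α : ℝ) : A := cfcₙ (fun t : ℝ => max (t - α) 0) d

theorem isSelfAdjoint_approxUnit (d : A) (δ : ℝ) : IsSelfAdjoint (approxUnit d δ) :=
  cfcₙ_predicate _ d

theorem continuous_approxUnit_fun {δ : ℝ} (hδ : 0 < δ) :
    Continuous (fun t : ℝ => t / (|t| + δ)) :=
  continuous_id.div (by fun_prop) fun t => by positivity

theorem norm_approxUnit_le (d : A) {δ : ℝ} (hδ : 0 < δ) : ‖approxUnit d δ‖ ≤ 1 := by
  refine norm_cfcₙ_le fun t _ => ?_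
  rw [Real.norm_eq_abs, abs_div, abs_of_pos (by positivity : 0 < |t| + δ),
    div_le_one (by positivity)]
  linarith

variable [PartialOrder A] [StarOrderedRing A]

theorem approxUnit_nonneg {d : A} (hd : 0 ≤ d) {δ : ℝ} (hδ : 0 < δ) : 0 ≤ approxUnit d δ :=
  cfcₙ_nonneg fun t ht => by
    have := quasispectrum_nonneg_of_nonneg d hd t ht
    positivity

theorem cut_nonneg (d : A) (α : ℝ) : 0 ≤ cut d α :=
  cfcₙ_nonneg fun _ _ => le_max_right _ _

theorem norm_sub_cut_le {d : A} (hd : 0 ≤ d) {α : ℝ} (hα : 0 ≤ α) : ‖d - cut d α‖ ≤ α := by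
  have h0 : max (0 - α) 0 = 0 := max_eq_right (by linarith)
  have : d - cut d α = cfcₙ (fun t : ℝ => t - max (t - α) 0) d := by
    rw [cfcₙ_sub (fun t : ℝ => t) (fun t => max (t - α) 0) d (by fun_prop) rfl (by fun_prop) h0,
      cfcₙ_id' ℝ d hd.isSelfAdjoint, cut]
  rw [this]
  refine norm_cfcₙ_le fun t ht => ?_
  have := quasispectrum_nonneg_of_nonneg d hd t ht
  rw [Real.norm_eq_abs, abs_le]
  rcases max_cases (t - α) 0 with h | h <;> constructor <;> linarith

/-- Cutting down by `1 - k`, where `k` is selfadjoint, is monotone. -/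
theorem sub_conj_mono {c d : A} (h : c ≤ d) {k : A} (hk : IsSelfAdjoint k) :
    c - k * c - c * k + k * c * k ≤ d - k * d - d * k + k * d * k := by
  obtain ⟨w, hw⟩ := CStarAlgebra.nonneg_iff_eq_star_mul_self.1 (sub_nonneg.2 h)
  have hd : d = c + star w * w := by rw [← hw]; abel
  rw [← sub_nonneg]
  convert star_mul_self_nonneg (w - w * k) using 1
  rw [hd, star_sub, star_mul, hk.star_eq]
  noncomm_ring

/-- With k = `approxUnit d δ`, the C⋆-identity gives the norm of (1 - k)yy⋆(1 - k) ≤ (1 - k)d(1 -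
k), and on the spectrum the latter is δ²t/(t + δ)² ≤ δ. The factors 1 - k are multiplied out since A
need not have a unit. -/
theorem norm_sub_approxUnit_mul_sq_le {d y : A} (h : y * star y ≤ d) {δ : ℝ} (hδ : 0 < δ) :
    ‖y - approxUnit d δ * y‖ ^ 2 ≤ δ := by
  have hd : 0 ≤ d := (mul_star_self_nonneg y).trans h
  set k := approxUnit d δ with hk
  have hks : IsSelfAdjoint k := isSelfAdjoint_approxUnit d δ
  have hc := continuous_approxUnit_fun hδ
  have h1 : ‖y - k * y‖ ^ 2 = ‖y * star y - k * (y * star y) - (y * star y) * k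
      + k * (y * star y) * k‖ := by
    rw [sq, ← CStarRing.norm_self_mul_star, star_sub, star_mul, hks.star_eq]
    congr 1
    noncomm_ring
  have h2 : 0 ≤ y * star y - k * (y * star y) - (y * star y) * k + k * (y * star y) * k := by
    simpa using sub_conj_mono (mul_star_self_nonneg y) hks
  rw [h1]
  refine (CStarAlgebra.norm_le_norm_of_nonneg_of_le h2 (sub_conj_mono h hks)).trans ?_
  let f : ℝ → ℝ := fun t => t / (|t| + δ)
  have hf : f 0 = 0 := by simp [f]
  have h3 : d - k * d - d * k + k * d * k
      = cfcₙ (fun t : ℝ => t - f t * t - t * f t + f t * t * f t) d := by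
    have hfc : Continuous f := hc
    rw [cfcₙ_add (fun t : ℝ => t - f t * t - t * f t) (fun t => f t * t * f t) d
        (by fun_prop) (by simp) (by fun_prop) (by simp [hf]),
      cfcₙ_sub (fun t : ℝ => t - f t * t) (fun t => t * f t) d
        (by fun_prop) (by simp) (by fun_prop) (by simp),
      cfcₙ_sub (fun t : ℝ => t) (fun t => f t * t) d
        (by fun_prop) (by simp) (by fun_prop) (by simp),
      cfcₙ_mul (fun t : ℝ => f t * t) f d (by fun_prop) (by simp) (by fun_prop) hf,
      cfcₙ_mul f (fun t : ℝ => t) d (by fun_prop) hf (by fun_prop) (by simp),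
      cfcₙ_mul (fun t : ℝ => t) f d (by fun_prop) (by simp) (by fun_prop) hf,
      cfcₙ_id' ℝ d hd.isSelfAdjoint]
    rfl
  rw [h3]
  refine norm_cfcₙ_le fun t ht => ?_
  have ht := quasispectrum_nonneg_of_nonneg d hd t ht
  have h4 : t - f t * t - t * f t + f t * t * f t = δ * (δ * t / (t + δ) ^ 2) := by
    simp only [f, abs_of_nonneg ht]
    field_simp
    ring
  rw [h4, Real.norm_eq_abs, abs_of_nonneg (by positivity)]
  have : δ * t / (t + δ) ^ 2 ≤ 1 := by
    rw [div_le_one (by positivity)]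
    nlinarith
  nlinarith

/-- Take g = √t/(t + δ), which is at most 1/√δ because √t√δ ≤ t + δ. The bound does not depend on d;
this gives the uniformity in `exists_norm_le_conj_sub_lt`. -/
theorem exists_conj_eq_approxUnit_sq {d : A} (hd : 0 ≤ d) {δ : ℝ} (hδ : 0 < δ) :
    ∃ g : A, IsSelfAdjoint g ∧ ‖g‖ ≤ (Real.sqrt δ)⁻¹ ∧ g * d * g = approxUnit d δ * approxUnit d δ := by
  let g : ℝ → ℝ := fun t => Real.sqrt |t| / (|t| + δ)
  have hg : Continuous g := (by fun_prop : Continuous fun t : ℝ => Real.sqrt |t|).div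
    (by fun_prop) fun t => by positivity
  have hg0 : g 0 = 0 := by simp [g]
  have hc := continuous_approxUnit_fun hδ
  refine ⟨cfcₙ g d, cfcₙ_predicate _ d, norm_cfcₙ_le fun t ht => ?_, ?_⟩
  · have ht := quasispectrum_nonneg_of_nonneg d hd t ht
    have h1 := Real.sqrt_pos.2 hδ
    rw [Real.norm_eq_abs, abs_of_nonneg (by positivity)]
    simp only [g, abs_of_nonneg ht]
    rw [div_le_iff₀ (by positivity), inv_mul_eq_div, le_div_iff₀ h1]
    nlinarith [Real.sq_sqrt ht, Real.sq_sqrt hδ.le, sq_nonneg (Real.sqrt t - Real.sqrt δ),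
      Real.sqrt_nonneg t]
  conv_lhs => enter [1, 2]; rw [← cfcₙ_id' ℝ d hd.isSelfAdjoint]
  rw [← cfcₙ_mul g (fun t : ℝ => t) d (by fun_prop) hg0 (by fun_prop) rfl,
    ← cfcₙ_mul (fun t : ℝ => g t * t) g d (by fun_prop) (by simp) (by fun_prop) hg0,
    approxUnit, ← cfcₙ_mul _ _ d hc.continuousOn (by simp) hc.continuousOn (by simp)]
  refine cfcₙ_congr fun t ht => ?_
  have ht := quasispectrum_nonneg_of_nonneg d hd t ht
  simp only [g, abs_of_nonneg ht]
  field_simp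
  rw [Real.sq_sqrt ht]
  ring

theorem tendsto_approxUnit_mul {d y : A} (h : y * star y ≤ d) {ε : ℝ} (hε : 0 < ε) :
    ∃ δ : ℝ, 0 < δ ∧ ‖y - approxUnit d δ * y‖ < ε := by
  refine ⟨(ε / 2) ^ 2, by positivity, ?_⟩
  have := norm_sub_approxUnit_mul_sq_le h (δ := (ε / 2) ^ 2) (by positivity)
  have := abs_le_of_sq_le_sq this (by positivity)
  rw [abs_of_nonneg (norm_nonneg _)] at this
  linarith

theorem exists_sqrt {c : A} (hc : 0 ≤ c) : ∃ y : A, 0 ≤ y ∧ y * y = c :=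
  ⟨CFC.sqrt c, CFC.sqrt_nonneg c, CFC.sqrt_mul_sqrt_self c hc⟩

end FunctionalCalculus

/-! ### Closed one-sided and two-sided ideals. -/

section Ideals

variable {A : Type*} [NonUnitalCStarAlgebra A]

/-- The ⋆-subalgebra `R ∩ R⋆` attached to a right ideal `R`. -/
def rightIdealHer (R : Submodule ℂ A) (hR : ∀ x ∈ R, ∀ a : A, x * a ∈ R) :
    NonUnitalStarSubalgebra ℂ A where
  carrier := {x | x ∈ R ∧ star x ∈ R}
  mul_mem' := fun {x y} hx hy => ⟨hR _ hx.1 _, by rw [star_mul]; exact hR _ hy.2 _⟩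
  add_mem' := fun {x y} hx hy => ⟨R.add_mem hx.1 hy.1, by rw [star_add]; exact R.add_mem hx.2 hy.2⟩
  zero_mem' := ⟨R.zero_mem, by rw [star_zero]; exact R.zero_mem⟩
  smul_mem' := fun c x hx => ⟨R.smul_mem c hx.1, by rw [star_smul]; exact R.smul_mem _ hx.2⟩
  star_mem' := fun {x} hx => ⟨hx.2, by rw [star_star]; exact hx.1⟩

theorem mem_rightIdealHer {R : Submodule ℂ A} {hR : ∀ x ∈ R, ∀ a : A, x * a ∈ R} {x : A} :
    x ∈ rightIdealHer R hR ↔ x ∈ R ∧ star x ∈ R := Iff.rfl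

theorem isClosed_rightIdealHer {R : Submodule ℂ A} (hR : ∀ x ∈ R, ∀ a : A, x * a ∈ R)
    (hc : IsClosed (R : Set A)) : IsClosed (rightIdealHer R hR : Set A) :=
  hc.inter (hc.preimage continuous_star)

theorem closed_of_forall_norm_lt {S : Set A} (hS : IsClosed S) {x : A}
    (h : ∀ ε : ℝ, 0 < ε → ∃ y ∈ S, ‖y - x‖ < ε) : x ∈ S := by
  rw [← hS.closure_eq, Metric.mem_closure_iff]
  intro ε hε
  obtain ⟨y, hy, hyx⟩ := h ε hε
  exact ⟨y, hy, by rwa [dist_comm, dist_eq_norm]⟩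

theorem cfcₙ_mem_rightIdeal {R : Submodule ℂ A} (hR : ∀ x ∈ R, ∀ a : A, x * a ∈ R)
    (hc : IsClosed (R : Set A)) {a : A} (ha : IsSelfAdjoint a) (haR : a ∈ R) (f : ℝ → ℝ) :
    cfcₙ f a ∈ R :=
  (cfcₙ_real_mem (isClosed_rightIdealHer hR hc) ha
    (mem_rightIdealHer.2 ⟨haR, by rwa [ha.star_eq]⟩) f).1

namespace IsClosedIdeal

variable {I : Submodule ℂ A} (hI : IsClosedIdeal I)
include hI

theorem mul_left {x : A} (hx : x ∈ I) (a : A) : a * x ∈ I := (hI.2 x hx a).1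

theorem mul_right {x : A} (hx : x ∈ I) (a : A) : x * a ∈ I := (hI.2 x hx a).2

theorem cfcₙ_mem {a : A} (ha : IsSelfAdjoint a) (haI : a ∈ I) (f : ℝ → ℝ) : cfcₙ f a ∈ I :=
  cfcₙ_mem_rightIdeal (fun _ hx => hI.mul_right hx) hI.1 ha haI f

end IsClosedIdeal

variable [PartialOrder A] [StarOrderedRing A]

/-- In the unitization 0 ≤ 1 - f ≤ 1, so multiplication by 1 - f is contractive. -/
theorem norm_sub_mul_le {f : A} (hf0 : 0 ≤ f) (hf1 : ‖f‖ ≤ 1) (z : A) : ‖z - f * z‖ ≤ ‖z‖ := by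
  have h1 : (1 : Unitization ℂ A) - f ≤ 1 := by
    simpa using Unitization.inr_nonneg_iff.2 hf0
  have h0 : (0 : Unitization ℂ A) ≤ 1 - f := by
    rw [sub_nonneg]
    exact ((CStarAlgebra.norm_le_one_iff_of_nonneg _ (Unitization.inr_nonneg_iff.2 hf0)).1
      (by rwa [Unitization.norm_inr]))
  have h2 := (CStarAlgebra.norm_le_one_iff_of_nonneg _ h0).2 h1
  have h3 : ((z - f * z : A) : Unitization ℂ A) = (1 - f) * z := by
    simp [sub_mul]
  rw [← Unitization.norm_inr (𝕜 := ℂ), h3, ← Unitization.norm_inr (𝕜 := ℂ) z]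
  exact (norm_mul_le _ _).trans (mul_le_of_le_one_left (norm_nonneg _) h2)

theorem norm_sub_mul_le' {f : A} (hf0 : 0 ≤ f) (hf1 : ‖f‖ ≤ 1) (z : A) : ‖z - z * f‖ ≤ ‖z‖ := by
  have := norm_sub_mul_le hf0 hf1 (star z)
  rw [← norm_star (z - z * f)]
  simpa [hf0.isSelfAdjoint.star_eq] using this

/-- The elements `approxUnit d δ * y` lie in R, because functions of d do, and they approximate y.
-/
theorem mem_rightIdeal_of_mul_star_le {R : Submodule ℂ A} (hR : ∀ x ∈ R, ∀ a : A, x * a ∈ R)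
    (hc : IsClosed (R : Set A)) {y d : A} (h : y * star y ≤ d) (hd : d ∈ R) : y ∈ R := by
  refine closed_of_forall_norm_lt hc fun ε hε => ?_
  obtain ⟨δ, hδ, hk⟩ := tendsto_approxUnit_mul h hε
  refine ⟨approxUnit d δ * y, hR _ (cfcₙ_mem_rightIdeal hR hc ?_ hd _) _, by rwa [norm_sub_rev]⟩
  exact ((mul_star_self_nonneg y).trans h).isSelfAdjoint

theorem isHereditary_rightIdealHer {R : Submodule ℂ A} (hR : ∀ x ∈ R, ∀ a : A, x * a ∈ R)
    (hc : IsClosed (R : Set A)) : IsHereditary (rightIdealHer R hR) := by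
  refine ⟨isClosed_rightIdealHer hR hc, fun a b ha hab hb => ?_⟩
  obtain ⟨y, hy, rfl⟩ := exists_sqrt ha
  have : y ∈ R := mem_rightIdeal_of_mul_star_le hR hc (by rwa [hy.isSelfAdjoint.star_eq]) hb.1
  exact ⟨hR _ this _, by rw [ha.isSelfAdjoint.star_eq]; exact hR _ this _⟩

namespace IsClosedIdeal

variable {I : Submodule ℂ A} (hI : IsClosedIdeal I)
include hI

theorem mem_of_mul_star_le {y d : A} (h : y * star y ≤ d) (hd : d ∈ I) : y ∈ I :=
  mem_rightIdeal_of_mul_star_le (fun _ hx => hI.mul_right hx) hI.1 h hd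

omit [PartialOrder A] [StarOrderedRing A] in
theorem mem_of_mul_star_mem {y : A} (h : y * star y ∈ I) : y ∈ I := by
  let _ := CStarAlgebra.spectralOrder A
  let _ := CStarAlgebra.spectralOrderedRing A
  exact hI.mem_of_mul_star_le le_rfl h

omit [PartialOrder A] [StarOrderedRing A] in
theorem star_mem {x : A} (hx : x ∈ I) : star x ∈ I :=
  hI.mem_of_mul_star_mem (by rw [star_star]; exact hI.mul_left hx _)

/-- A closed ideal as a ⋆-subalgebra. -/
def starSubalgebra : NonUnitalStarSubalgebra ℂ A where
  carrier := I
  mul_mem' := fun _ hy => hI.mul_left hy _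
  add_mem' := fun hx hy => I.add_mem hx hy
  zero_mem' := I.zero_mem
  smul_mem' := fun c _ hx => I.smul_mem c hx
  star_mem' := fun hx => hI.star_mem hx

omit [PartialOrder A] [StarOrderedRing A] in
theorem mem_of_star_mul_mem {y : A} (h : star y * y ∈ I) : y ∈ I := by
  rw [← star_star y]
  exact hI.star_mem (hI.mem_of_mul_star_mem (by rwa [star_star]))

theorem mem_of_le {a b : A} (ha : 0 ≤ a) (hab : a ≤ b) (hb : b ∈ I) : a ∈ I := by
  obtain ⟨y, hy, rfl⟩ := exists_sqrt ha
  exact hI.mul_right (hI.mem_of_mul_star_le (by rwa [hy.isSelfAdjoint.star_eq]) hb) _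

/-- Every finite family in a closed ideal is almost fixed by some positive contraction of the
ideal. -/
theorem exists_approxUnit (s : Finset A) (hs : ∀ x ∈ s, x ∈ I) {ε : ℝ} (hε : 0 < ε) :
    ∃ f ∈ I, 0 ≤ f ∧ ‖f‖ ≤ 1 ∧ ∀ x ∈ s, ‖x - f * x‖ < ε := by
  -- The sum dominates every x x⋆, so a single approximate unit of d serves the whole family.
  set d := ∑ x ∈ s, x * star x with hd
  have hdI : d ∈ I := I.sum_mem fun x hx => hI.mul_right (hs x hx) _
  have hd0 : 0 ≤ d := Finset.sum_nonneg fun x _ => mul_star_self_nonneg x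
  have hδ : 0 < (ε / 2) ^ 2 := by positivity
  refine ⟨approxUnit d ((ε / 2) ^ 2), hI.cfcₙ_mem hd0.isSelfAdjoint hdI _,
    approxUnit_nonneg hd0 hδ, norm_approxUnit_le d hδ, fun x hx => ?_⟩
  have hle : x * star x ≤ d := Finset.single_le_sum (fun x _ => mul_star_self_nonneg x) hx
  have := abs_le_of_sq_le_sq (norm_sub_approxUnit_mul_sq_le hle hδ) (by positivity)
  rw [abs_of_nonneg (norm_nonneg _)] at this
  linarith

end IsClosedIdeal

end Ideals

/-! ### Closed ideals generated by sets. -/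

section Span

variable {A : Type*} [NonUnitalNormedRing A] [Module ℂ A]

theorem isClosedIdeal_sInf {F : Set (Submodule ℂ A)} (hF : ∀ I ∈ F, IsClosedIdeal I) :
    IsClosedIdeal (sInf F) := by
  refine ⟨?_, fun x hx a => ?_⟩
  · rw [Submodule.coe_sInf]
    exact isClosed_biInter fun I hI => (hF I hI).1
  · rw [Submodule.mem_sInf] at hx
    exact ⟨Submodule.mem_sInf.2 fun I hI => ((hF I hI).2 x (hx I hI) a).1,
      Submodule.mem_sInf.2 fun I hI => ((hF I hI).2 x (hx I hI) a).2⟩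

theorem isClosedIdeal_closedIdealSpan (S : Set A) : IsClosedIdeal (closedIdealSpan S) :=
  isClosedIdeal_sInf fun _ hI => hI.1

theorem subset_closedIdealSpan (S : Set A) : S ⊆ closedIdealSpan S := fun _ hx =>
  Submodule.mem_sInf.2 fun _ hI => hI.2 hx

theorem closedIdealSpan_le {S : Set A} {I : Submodule ℂ A} (hI : IsClosedIdeal I) (h : S ⊆ I) :
    closedIdealSpan S ≤ I := sInf_le ⟨hI, h⟩

theorem closedIdealSpan_mono {S T : Set A} (h : S ⊆ T) : closedIdealSpan S ≤ closedIdealSpan T :=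
  closedIdealSpan_le (isClosedIdeal_closedIdealSpan T) (h.trans (subset_closedIdealSpan T))

theorem mem_closedIdealSpan_singleton (a : A) : a ∈ closedIdealSpan {a} :=
  subset_closedIdealSpan _ rfl

theorem closedIdealSpan_singleton_le {a : A} {I : Submodule ℂ A} (hI : IsClosedIdeal I)
    (h : a ∈ I) : closedIdealSpan {a} ≤ I :=
  closedIdealSpan_le hI (Set.singleton_subset_iff.2 h)

end Span

/-! ### Quotients as C⋆-algebras. -/

section Quotient

variable {A : Type u} [NonUnitalCStarAlgebra A]

/-- The quotient of a C⋆-algebra by a closed ideal. -/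
def IsClosedIdeal.Quotient {I : Submodule ℂ A} (_ : IsClosedIdeal I) : Type u := A ⧸ I

namespace IsClosedIdeal.Quotient

variable {I : Submodule ℂ A} (hI : IsClosedIdeal I)

/-- The proof `hI` is carried by the type, so that instance search has access to the closedness of
I. -/
noncomputable instance : NormedAddCommGroup hI.Quotient :=
  haveI : IsClosed (I : Set A) := hI.1
  inferInstanceAs (NormedAddCommGroup (A ⧸ I))

noncomputable instance : NormedSpace ℂ hI.Quotient :=
  haveI : IsClosed (I : Set A) := hI.1
  inferInstanceAs (NormedSpace ℂ (A ⧸ I))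

instance : CompleteSpace hI.Quotient :=
  haveI : IsClosed (I : Set A) := hI.1
  inferInstanceAs (CompleteSpace (A ⧸ I))

/-- The quotient map, as a linear map. -/
def mkₗ : A →ₗ[ℂ] hI.Quotient := I.mkQ

variable {hI}

theorem mkₗ_surjective : Function.Surjective (mkₗ hI) := I.mkQ_surjective

theorem mkₗ_eq_zero {x : A} : mkₗ hI x = 0 ↔ x ∈ I := Submodule.Quotient.mk_eq_zero I

theorem mkₗ_eq_iff {x y : A} : mkₗ hI x = mkₗ hI y ↔ x - y ∈ I := Submodule.Quotient.eq I

theorem norm_mkₗ_le (x : A) : ‖mkₗ hI x‖ ≤ ‖x‖ := Submodule.Quotient.norm_mk_le (S := I) x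

theorem exists_norm_lt (x : hI.Quotient) {ε : ℝ} (hε : ‖x‖ < ε) : ∃ a, mkₗ hI a = x ∧ ‖a‖ < ε := by
  obtain ⟨m, hm, h⟩ := Submodule.Quotient.norm_mk_lt (S := I) x (sub_pos.2 hε)
  exact ⟨m, hm, h.trans_eq (add_sub_cancel _ _)⟩

theorem exists_mem_norm_sub_lt {x : A} {ε : ℝ} (hε : ‖mkₗ hI x‖ < ε) :
    ∃ l ∈ I, ‖x - l‖ < ε := by
  obtain ⟨m, hm, h⟩ := exists_norm_lt _ hε
  exact ⟨x - m, mkₗ_eq_iff.1 hm.symm, by rwa [sub_sub_cancel]⟩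

noncomputable instance : Mul hI.Quotient where
  mul x y := mkₗ hI (Function.surjInv mkₗ_surjective x * Function.surjInv mkₗ_surjective y)

noncomputable instance : Star hI.Quotient where
  star x := mkₗ hI (star (Function.surjInv mkₗ_surjective x))

theorem mkₗ_mul (a b : A) : mkₗ hI (a * b) = mkₗ hI a * mkₗ hI b := by
  have ha := mkₗ_eq_iff.1 (Function.surjInv_eq (mkₗ_surjective (hI := hI)) (mkₗ hI a))
  have hb := mkₗ_eq_iff.1 (Function.surjInv_eq (mkₗ_surjective (hI := hI)) (mkₗ hI b))
  refine (mkₗ_eq_iff.2 ?_).symm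
  convert I.add_mem (hI.mul_right ha b)
    (hI.mul_left hb (Function.surjInv (mkₗ_surjective (hI := hI)) (mkₗ hI a))) using 1
  noncomm_ring

theorem mkₗ_star (a : A) : mkₗ hI (star a) = star (mkₗ hI a) := by
  have ha := mkₗ_eq_iff.1 (Function.surjInv_eq (mkₗ_surjective (hI := hI)) (mkₗ hI a))
  refine (mkₗ_eq_iff.2 ?_).symm
  rw [← star_sub]
  exact hI.star_mem ha

noncomputable instance : NonUnitalRing hI.Quotient where
  left_distrib x y z := by
    obtain ⟨a, rfl⟩ := mkₗ_surjective x
    obtain ⟨b, rfl⟩ := mkₗ_surjective y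
    obtain ⟨c, rfl⟩ := mkₗ_surjective z
    simp only [← map_add, ← mkₗ_mul, mul_add]
  right_distrib x y z := by
    obtain ⟨a, rfl⟩ := mkₗ_surjective x
    obtain ⟨b, rfl⟩ := mkₗ_surjective y
    obtain ⟨c, rfl⟩ := mkₗ_surjective z
    simp only [← map_add, ← mkₗ_mul, add_mul]
  zero_mul x := by
    obtain ⟨a, rfl⟩ := mkₗ_surjective x
    rw [← map_zero (mkₗ hI), ← mkₗ_mul, zero_mul]
  mul_zero x := by
    obtain ⟨a, rfl⟩ := mkₗ_surjective x
    rw [← map_zero (mkₗ hI), ← mkₗ_mul, mul_zero]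
  mul_assoc x y z := by
    obtain ⟨a, rfl⟩ := mkₗ_surjective x
    obtain ⟨b, rfl⟩ := mkₗ_surjective y
    obtain ⟨c, rfl⟩ := mkₗ_surjective z
    simp only [← mkₗ_mul, mul_assoc]

noncomputable instance : StarRing hI.Quotient where
  star_involutive x := by
    obtain ⟨a, rfl⟩ := mkₗ_surjective x
    simp only [← mkₗ_star, star_star]
  star_mul x y := by
    obtain ⟨a, rfl⟩ := mkₗ_surjective x
    obtain ⟨b, rfl⟩ := mkₗ_surjective y
    simp only [← mkₗ_mul, ← mkₗ_star, star_mul]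
  star_add x y := by
    obtain ⟨a, rfl⟩ := mkₗ_surjective x
    obtain ⟨b, rfl⟩ := mkₗ_surjective y
    simp only [← map_add, ← mkₗ_star, star_add]

theorem norm_mul_le' (x y : hI.Quotient) : ‖x * y‖ ≤ ‖x‖ * ‖y‖ := by
  refine le_of_forall_pos_le_add fun ε hε => ?_
  obtain ⟨δ, hδ, h⟩ : ∃ δ : ℝ, 0 < δ ∧ (‖x‖ + δ) * (‖y‖ + δ) < ‖x‖ * ‖y‖ + ε := by
    have hc : Filter.Tendsto (fun δ : ℝ => (‖x‖ + δ) * (‖y‖ + δ)) (nhdsWithin 0 (Set.Ioi 0))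
        (nhds (‖x‖ * ‖y‖)) := by
      have : Continuous fun δ : ℝ => (‖x‖ + δ) * (‖y‖ + δ) := by fun_prop
      simpa using (this.tendsto 0).mono_left nhdsWithin_le_nhds
    obtain ⟨δ, hδ, h⟩ := ((hc.eventually_lt_const (lt_add_of_pos_right _ hε)).and
      self_mem_nhdsWithin).exists
    exact ⟨δ, h, hδ⟩
  obtain ⟨a, rfl, ha⟩ := exists_norm_lt x (lt_add_of_pos_right _ hδ)
  obtain ⟨b, rfl, hb⟩ := exists_norm_lt y (lt_add_of_pos_right _ hδ)
  rw [← mkₗ_mul]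
  calc _ ≤ ‖a * b‖ := norm_mkₗ_le _
    _ ≤ ‖a‖ * ‖b‖ := norm_mul_le _ _
    _ ≤ (‖mkₗ hI a‖ + δ) * (‖mkₗ hI b‖ + δ) := by gcongr
    _ ≤ _ := h.le

noncomputable instance : NonUnitalNormedRing hI.Quotient where
  __ := (inferInstance : NormedAddCommGroup hI.Quotient)
  __ := (inferInstance : NonUnitalRing hI.Quotient)
  norm_mul_le := norm_mul_le'

/-- The C⋆-inequality in the quotient. -/
theorem norm_mul_self_le (x : hI.Quotient) : ‖x‖ * ‖x‖ ≤ ‖star x * x‖ := by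
  let _ := CStarAlgebra.spectralOrder A
  let _ := CStarAlgebra.spectralOrderedRing A
  obtain ⟨a, rfl⟩ := mkₗ_surjective x
  rw [← mkₗ_star, ← mkₗ_mul]
  refine le_of_forall_pos_lt_add fun ε hε => ?_
  -- The element l ∈ I nearly realizes the quotient norm of a⋆a, and f ∈ I nearly fixes l. Since
  -- ‖a(1 - f)‖² ≤ ‖(1 - f)a⋆a‖, which is at most ‖a⋆a - l‖ + ‖(1 - f)l‖, the estimate follows.
  obtain ⟨l, hl, hlt⟩ := exists_mem_norm_sub_lt (hI := hI) (x := star a * a)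
    (lt_add_of_pos_right _ (half_pos hε))
  obtain ⟨f, hf, hf0, hf1, hfl⟩ := hI.exists_approxUnit {l} (by simpa using hl) (half_pos hε)
  replace hfl := hfl l (by simp)
  have hfs := hf0.isSelfAdjoint
  have key : ‖mkₗ hI a‖ ≤ ‖a - a * f‖ := by
    have : mkₗ hI a = mkₗ hI (a - a * f) :=
      mkₗ_eq_iff.2 (by rw [sub_sub_cancel]; exact hI.mul_left hf a)
    rw [this]
    exact norm_mkₗ_le _
  have hcontr : ∀ z : A, ‖z - f * z‖ ≤ ‖z‖ := norm_sub_mul_le hf0 hf1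
  calc ‖mkₗ hI a‖ * ‖mkₗ hI a‖ ≤ ‖a - a * f‖ * ‖a - a * f‖ := by gcongr
    _ = ‖(star a * a - f * (star a * a)) - (star a * a - f * (star a * a)) * f‖ := by
      rw [← CStarRing.norm_star_mul_self, star_sub, star_mul, hfs.star_eq]
      congr 1
      noncomm_ring
    _ ≤ ‖star a * a - f * (star a * a)‖ := by
      rw [← norm_star]
      refine le_trans (le_of_eq ?_) ((hcontr _).trans_eq
        (norm_star (star a * a - f * (star a * a))))
      congr 1
      simp [hfs.star_eq]
    _ = ‖((star a * a - l) - f * (star a * a - l)) + (l - f * l)‖ := by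
      congr 1
      noncomm_ring
    _ ≤ ‖star a * a - l‖ + ‖l - f * l‖ := (norm_add_le _ _).trans (by gcongr; exact hcontr _)
    _ < (‖mkₗ hI (star a * a)‖ + ε / 2) + ε / 2 := add_lt_add hlt hfl
    _ = ‖mkₗ hI (star a * a)‖ + ε := by ring

instance : IsScalarTower ℂ hI.Quotient hI.Quotient where
  smul_assoc c x y := by
    obtain ⟨a, rfl⟩ := mkₗ_surjective x
    obtain ⟨b, rfl⟩ := mkₗ_surjective y
    simp only [smul_eq_mul, ← map_smul, ← mkₗ_mul, smul_mul_assoc]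

instance : SMulCommClass ℂ hI.Quotient hI.Quotient where
  smul_comm c x y := by
    obtain ⟨a, rfl⟩ := mkₗ_surjective x
    obtain ⟨b, rfl⟩ := mkₗ_surjective y
    simp only [smul_eq_mul, ← map_smul, ← mkₗ_mul, mul_smul_comm]

instance : StarModule ℂ hI.Quotient where
  star_smul c x := by
    obtain ⟨a, rfl⟩ := mkₗ_surjective x
    simp only [← map_smul, ← mkₗ_star, star_smul]

instance : CStarRing hI.Quotient where
  norm_mul_self_le := norm_mul_self_le

noncomputable instance : NonUnitalCStarAlgebra hI.Quotient where
  __ := (inferInstance : NonUnitalNormedRing hI.Quotient)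
  __ := (inferInstance : StarRing hI.Quotient)
  __ := (inferInstance : CompleteSpace hI.Quotient)
  __ := (inferInstance : CStarRing hI.Quotient)
  __ := (inferInstance : NormedSpace ℂ hI.Quotient)
  __ := (inferInstance : IsScalarTower ℂ hI.Quotient hI.Quotient)
  __ := (inferInstance : SMulCommClass ℂ hI.Quotient hI.Quotient)
  __ := (inferInstance : StarModule ℂ hI.Quotient)

noncomputable instance : PartialOrder hI.Quotient := CStarAlgebra.spectralOrder hI.Quotient

instance : StarOrderedRing hI.Quotient := CStarAlgebra.spectralOrderedRing hI.Quotient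

variable (hI) in
/-- The quotient map. -/
noncomputable def mk : A →⋆ₙₐ[ℂ] hI.Quotient where
  toFun := mkₗ hI
  map_smul' := map_smul _
  map_zero' := map_zero _
  map_add' := map_add _
  map_mul' := mkₗ_mul
  map_star' := mkₗ_star

theorem mk_surjective : Function.Surjective (mk hI) := mkₗ_surjective

theorem mk_eq_zero {x : A} : mk hI x = 0 ↔ x ∈ I := mkₗ_eq_zero

theorem norm_mk_le (x : A) : ‖mk hI x‖ ≤ ‖x‖ := norm_mkₗ_le x

theorem exists_mem_norm_sub_lt_of_norm_mk_lt {x : A} {ε : ℝ} (hε : ‖mk hI x‖ < ε) :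
    ∃ l ∈ I, ‖x - l‖ < ε := exists_mem_norm_sub_lt hε

end IsClosedIdeal.Quotient

end Quotient

/-! ### Cuntz comparison of pairs and the absorbed ideal. -/

section Comparison

variable {A : Type*} [NonUnitalCStarAlgebra A]

/-- The Gram matrices, with respect to `b`, of pairs of elements. -/
def pairGram (b : A) : Set (A × A × A) :=
  Set.range fun p : A × A => (star p.1 * b * p.1, star p.2 * b * p.2, star p.1 * b * p.2)

/-- Cuntz comparison `x ⊕ c ≾ b`, expressed without matrix algebras. -/
def PairLE (x c b : A) : Prop := (x, c, (0 : A)) ∈ closure (pairGram b)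

theorem cuntzLE_iff_mem_closure {a b : A} :
    CuntzLE a b ↔ a ∈ closure (Set.range fun x : A => star x * b * x) := by
  rw [Metric.mem_closure_iff]
  refine forall₂_congr fun ε _ => ?_
  simp [dist_eq_norm, norm_sub_rev]

theorem pairLE_iff {x c b : A} : PairLE x c b ↔ ∀ ε : ℝ, 0 < ε → ∃ y z : A,
    ‖star y * b * y - x‖ < ε ∧ ‖star z * b * z - c‖ < ε ∧ ‖star y * b * z‖ < ε := by
  rw [PairLE, Metric.mem_closure_iff]
  refine forall₂_congr fun ε _ => ?_
  simp [pairGram, dist_eq_norm, norm_sub_rev, Prod.norm_def]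

/-- Reading ≾ as membership in a closure lets continuity of t ↦ u⋆tu handle every ε; the comparison
lemmas for pairs work in the same way. -/
theorem CuntzLE.trans {a b c : A} (hab : CuntzLE a b) (hbc : CuntzLE b c) : CuntzLE a c := by
  rw [cuntzLE_iff_mem_closure] at *
  refine closure_minimal ?_ isClosed_closure hab
  rintro _ ⟨u, rfl⟩
  refine map_mem_closure (f := fun t => star u * t * u) (by fun_prop) hbc ?_
  rintro _ ⟨w, rfl⟩
  exact ⟨w * u, by simp [mul_assoc]⟩

theorem CuntzLE.mem_closedIdeal {a b : A} (h : CuntzLE a b) {I : Submodule ℂ A}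
    (hI : IsClosedIdeal I) (hb : b ∈ I) : a ∈ I := by
  rw [cuntzLE_iff_mem_closure] at h
  refine closure_minimal ?_ hI.1 h
  rintro _ ⟨u, rfl⟩
  exact hI.mul_right (hI.mul_left hb _) _

theorem CuntzLE.real_smul {a b : A} (h : CuntzLE a b) {t : ℝ} (ht : 0 ≤ t) :
    CuntzLE (t • a) b := by
  rw [cuntzLE_iff_mem_closure] at *
  refine map_mem_closure (f := fun x => t • x) (by fun_prop) h ?_
  rintro _ ⟨u, rfl⟩
  refine ⟨Real.sqrt t • u, ?_⟩
  simp only [star_smul, smul_mul_assoc, mul_smul_comm, smul_smul, star_trivial]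
  rw [Real.mul_self_sqrt ht]

theorem cuntzLE_conj (b u : A) : CuntzLE (star u * b * u) b := fun ε hε =>
  ⟨u, by simpa using hε⟩

theorem PairLE.trans {x c b b' : A} (h : PairLE x c b) (hb : CuntzLE b b') : PairLE x c b' := by
  rw [cuntzLE_iff_mem_closure] at hb
  refine closure_minimal ?_ isClosed_closure h
  rintro _ ⟨⟨y, z⟩, rfl⟩
  refine map_mem_closure (f := fun t => (star y * t * y, star z * t * z, star y * t * z))
    (by fun_prop) hb ?_
  rintro _ ⟨w, rfl⟩
  exact ⟨(w * y, w * z), by simp [mul_assoc]⟩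

theorem PairLE.mono {x c x' c' b : A} (h : PairLE x c b) (hx : CuntzLE x' x) (hc : CuntzLE c' c) :
    PairLE x' c' b := by
  have key : ∀ u v : A, PairLE (star u * x * u) (star v * c * v) b := by
    intro u v
    have := map_mem_closure (t := pairGram b)
      (f := fun p : A × A × A => (star u * p.1 * u, star v * p.2.1 * v, star u * p.2.2 * v))
      (by fun_prop) h (by
        rintro _ ⟨⟨y, z⟩, rfl⟩
        exact ⟨(y * u, z * v), by simp [mul_assoc]⟩)
    rw [PairLE]
    simpa using this
  rw [cuntzLE_iff_mem_closure] at hx hc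
  have h1 : ∀ v : A, PairLE x' (star v * c * v) b := by
    intro v
    refine closure_minimal (t := {t | PairLE t (star v * c * v) b}) ?_
      (isClosed_closure.preimage (by fun_prop)) hx
    rintro _ ⟨u, rfl⟩
    exact key u v
  refine closure_minimal (t := {t | PairLE x' t b}) ?_
      (isClosed_closure.preimage (by fun_prop)) hc
  rintro _ ⟨v, rfl⟩
  exact h1 v

theorem PairLE.right {x c b : A} (h : PairLE x c b) : CuntzLE c b := fun ε hε =>
  let ⟨_, z, _, hz, _⟩ := pairLE_iff.1 h ε hε
  ⟨z, hz⟩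

theorem pairLE_of_eq {b y z : A} (h : star y * b * z = 0) :
    PairLE (star y * b * y) (star z * b * z) b :=
  subset_closure ⟨(y, z), by simp [h]⟩

theorem mem_closure_pairGram_swap {b p q r : A} (hb : IsSelfAdjoint b)
    (h : (p, q, r) ∈ closure (pairGram b)) : (q, p, star r) ∈ closure (pairGram b) := by
  refine map_mem_closure (f := fun p : A × A × A => (p.2.1, p.1, star p.2.2)) (by fun_prop) h ?_
  rintro _ ⟨⟨y, z⟩, rfl⟩
  exact ⟨(z, y), by simp [mul_assoc, hb.star_eq]⟩

theorem mem_closure_pairGram_conj {b p q r : A} (h : (p, q, r) ∈ closure (pairGram b)) (u v : A) :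
    (star u * p * u, star v * q * v, star u * r * v) ∈ closure (pairGram b) := by
  refine map_mem_closure
    (f := fun p : A × A × A => (star u * p.1 * u, star v * p.2.1 * v, star u * p.2.2 * v))
    (by fun_prop) h ?_
  rintro _ ⟨⟨y, z⟩, rfl⟩
  exact ⟨(y * u, z * v), by simp [mul_assoc]⟩

/-- If `x ⊕ c ≾ x`, then `c` can be added to a diagonal entry of a Gram matrix. -/
theorem PairLE.add_mem_closure {x c p q r : A} (hx : IsSelfAdjoint x) (hc : PairLE x c x)
    (h : (p, q, r) ∈ closure (pairGram x)) : (p, q + c, r) ∈ closure (pairGram x) := by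
  have key : ∀ a ∈ pairGram x, (a.1, a.2.1 + c, a.2.2) ∈ closure (pairGram x) := by
    rintro _ ⟨⟨y, z⟩, rfl⟩
    -- If (y', w) has Gram data close to (x, c, 0), then (y'y, y'z + w) has nearly the Gram data of
    -- (y, z), with c added to the second diagonal entry.
    have := map_mem_closure (t := pairGram x) (f := fun p : A × A × A =>
      (star y * p.1 * y, star z * p.1 * z + p.2.1 + (star z * p.2.2 + star p.2.2 * z),
        star y * p.1 * z + star y * p.2.2)) (by fun_prop) hc (by
        rintro _ ⟨⟨y', w⟩, rfl⟩
        refine ⟨(y' * y, y' * z + w), ?_⟩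
        simp only [star_mul, star_add, hx.star_eq, star_star, Prod.mk.injEq]
        refine ⟨?_, ?_, ?_⟩ <;> noncomm_ring)
    simpa using this
  rw [← isClosed_closure.closure_eq]
  exact map_mem_closure (f := fun a : A × A × A => (a.1, a.2.1 + c, a.2.2)) (by fun_prop) h key

theorem PairLE.add_mem_closure' {x c p q r : A} (hx : IsSelfAdjoint x) (hc : PairLE x c x)
    (h : (p, q, r) ∈ closure (pairGram x)) : (p + c, q, r) ∈ closure (pairGram x) := by
  simpa using mem_closure_pairGram_swap hx
    (hc.add_mem_closure hx (mem_closure_pairGram_swap hx h))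

variable [PartialOrder A] [StarOrderedRing A]

/-- A positive element dominated by `d` is approximately of the form `u⋆ d u`, with a bound for
`u` that does not depend on `d`. -/
theorem exists_norm_le_conj_sub_lt {c : A} (hc : 0 ≤ c) {ε : ℝ} (hε : 0 < ε) :
    ∃ C : ℝ, 0 < C ∧ ∀ d : A, c ≤ d → ∃ u : A, ‖u‖ ≤ C ∧ ‖star u * d * u - c‖ < ε := by
  obtain ⟨y, hy, rfl⟩ := exists_sqrt hc
  have hys := hy.isSelfAdjoint
  obtain ⟨η, hη, hηε⟩ : ∃ η : ℝ, 0 < η ∧ η * (2 * ‖y‖) < ε := by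
    refine ⟨ε / (2 * ‖y‖ + 1), by positivity, ?_⟩
    rw [div_mul_eq_mul_div, div_lt_iff₀ (by positivity)]
    nlinarith
  -- With y = √c and δ = η² the witness is u = gy, where ‖g‖ ≤ η⁻¹ for every d. Then u⋆du = yk²y,
  -- and k almost fixes y because c ≤ d. The summand 1 only makes the bound positive.
  refine ⟨η⁻¹ * ‖y‖ + 1, by positivity, fun d hd => ?_⟩
  have hd0 : 0 ≤ d := hc.trans hd
  have hδ : 0 < η ^ 2 := by positivity
  obtain ⟨g, hg, hgn, hgd⟩ := exists_conj_eq_approxUnit_sq hd0 hδ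
  set k := approxUnit d (η ^ 2) with hk
  have hks : IsSelfAdjoint k := isSelfAdjoint_approxUnit d _
  have hkn : ‖k‖ ≤ 1 := norm_approxUnit_le d hδ
  have h1 : ‖y - k * y‖ ≤ η := by
    have := abs_le_of_sq_le_sq (norm_sub_approxUnit_mul_sq_le (d := d) (y := y)
      (by rwa [hys.star_eq]) hδ) hη.le
    rwa [abs_of_nonneg (norm_nonneg _)] at this
  refine ⟨g * y, ?_, ?_⟩
  · calc ‖g * y‖ ≤ ‖g‖ * ‖y‖ := norm_mul_le _ _
      _ ≤ η⁻¹ * ‖y‖ := by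
        gcongr
        rwa [Real.sqrt_sq hη.le] at hgn
      _ ≤ _ := by linarith
  · have h2 : star (g * y) * d * (g * y) - y * y
        = -((y - y * k) * (k * y) + y * (y - k * y)) := by
      calc _ = y * (g * d * g) * y - y * y := by
            rw [star_mul, hys.star_eq, hg.star_eq]; noncomm_ring
        _ = _ := by rw [hgd]; noncomm_ring
    have h3 : ‖y - y * k‖ ≤ η := by
      rw [← norm_star]
      simpa [hys.star_eq, hks.star_eq] using h1
    rw [h2, norm_neg]
    calc _ ≤ ‖(y - y * k) * (k * y)‖ + ‖y * (y - k * y)‖ := norm_add_le _ _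
      _ ≤ ‖y - y * k‖ * (‖k‖ * ‖y‖) + ‖y‖ * ‖y - k * y‖ := by
        gcongr
        · exact (norm_mul_le _ _).trans (by gcongr; exact norm_mul_le _ _)
        · exact norm_mul_le _ _
      _ ≤ η * (1 * ‖y‖) + ‖y‖ * η := by gcongr
      _ < ε := by linarith

theorem cuntzLE_of_le {c d : A} (hc : 0 ≤ c) (h : c ≤ d) : CuntzLE c d := fun _ hε =>
  let ⟨_, _, hC⟩ := exists_norm_le_conj_sub_lt hc hε
  let ⟨u, _, hu⟩ := hC d h
  ⟨u, hu⟩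

theorem cuntzLE_refl {c : A} (hc : 0 ≤ c) : CuntzLE c c := cuntzLE_of_le hc le_rfl

theorem cuntzLE_of_le_smul {c d : A} (hc : 0 ≤ c) {t : ℝ} (ht : 0 ≤ t) (h : c ≤ t • d)
    (hd : 0 ≤ d) : CuntzLE c d :=
  (cuntzLE_of_le hc h).trans ((cuntzLE_refl hd).real_smul ht)

/-- The closed ideal of all `c` with `x ⊕ c⋆c ≾ x`. -/
def absorbedIdeal (x : A) (hx : 0 ≤ x) : Submodule ℂ A where
  carrier := {c | PairLE x (star c * c) x}
  zero_mem' := by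
    refine pairLE_iff.2 fun ε hε => ?_
    obtain ⟨u, hu⟩ := cuntzLE_refl hx ε hε
    exact ⟨u, 0, hu, by simpa using hε, by simpa using hε⟩
  add_mem' {c d} hc hd := by
    have h : PairLE x (star c * c + star d * d) x :=
      PairLE.add_mem_closure hx.isSelfAdjoint hd hc
    -- Parallelogram law: (c + d)⋆(c + d) ≤ 2(c⋆c + d⋆d), with difference (c - d)⋆(c - d).
    refine h.mono (cuntzLE_refl hx) (cuntzLE_of_le_smul (star_mul_self_nonneg _) (t := 2)
      (by norm_num) ?_ (add_nonneg (star_mul_self_nonneg _) (star_mul_self_nonneg _)))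
    rw [← sub_nonneg]
    convert star_mul_self_nonneg (c - d) using 1
    simp only [two_smul, star_add, star_sub]
    noncomm_ring
  smul_mem' t c hc := by
    refine PairLE.mono hc (cuntzLE_refl hx) ?_
    have : star (t • c) * (t • c) = (‖t‖ ^ 2 : ℝ) • (star c * c) := by
      rw [star_smul, smul_mul_smul_comm, ← Complex.coe_smul]
      congr 1
      rw [Complex.star_def, Complex.conj_mul', Complex.ofReal_pow]
    rw [this]
    exact (cuntzLE_refl (star_mul_self_nonneg c)).real_smul (by positivity)

theorem mem_absorbedIdeal {x : A} {hx : 0 ≤ x} {c : A} :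
    c ∈ absorbedIdeal x hx ↔ PairLE x (star c * c) x := Iff.rfl

/-- On the left, (ac)⋆(ac) ≤ ‖a⋆a‖ c⋆c; on the right, (ca)⋆(ca) = a⋆(c⋆c)a ≾ c⋆c. Closedness holds
because `PairLE` is membership in a closure. -/
theorem isClosedIdeal_absorbedIdeal {x : A} (hx : 0 ≤ x) : IsClosedIdeal (absorbedIdeal x hx) := by
  refine ⟨?_, fun c hc a => ⟨?_, ?_⟩⟩
  · exact isClosed_closure.preimage (f := fun c : A => (x, star c * c, (0 : A))) (by fun_prop)
  · rw [mem_absorbedIdeal] at *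
    refine hc.mono (cuntzLE_refl hx) (cuntzLE_of_le_smul (star_mul_self_nonneg _)
      (norm_nonneg (star a * a)) ?_ (star_mul_self_nonneg _))
    have := CStarAlgebra.star_left_conjugate_le_norm_smul (a := c) (b := star a * a)
    simpa [mul_assoc] using this
  · rw [mem_absorbedIdeal] at *
    refine hc.mono (cuntzLE_refl hx) ?_
    have := cuntzLE_conj (star c * c) a
    simpa [mul_assoc] using this

theorem mem_absorbedIdeal_of_pairLE {x c : A} (hx : 0 ≤ x) (hc : 0 ≤ c) (h : PairLE x c x) :
    c ∈ absorbedIdeal x hx := by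
  obtain ⟨y, hy, rfl⟩ := exists_sqrt hc
  have : y ∈ absorbedIdeal x hx := by rwa [mem_absorbedIdeal, hy.isSelfAdjoint.star_eq]
  exact (isClosedIdeal_absorbedIdeal hx).mul_left this y

theorem pairLE_of_mem_absorbedIdeal {x c : A} (hx : 0 ≤ x) (hc : 0 ≤ c)
    (h : c ∈ absorbedIdeal x hx) : PairLE x c x := by
  obtain ⟨y, hy, rfl⟩ := exists_sqrt hc
  have hys := hy.isSelfAdjoint.star_eq
  have : y ∈ absorbedIdeal x hx :=
    (isClosedIdeal_absorbedIdeal hx).mem_of_mul_star_mem (by rwa [hys])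
  rwa [mem_absorbedIdeal, hys] at this

/-- An x that absorbs itself absorbs its whole closed ideal, and the second component of x ⊕ c ≾ x
is c ≾ x. -/
theorem cuntzLE_of_mem_closedIdealSpan {x c : A} (hx : 0 ≤ x) (hc : 0 ≤ c)
    (h : x ∈ absorbedIdeal x hx) (hcx : c ∈ closedIdealSpan {x}) : CuntzLE c x :=
  (pairLE_of_mem_absorbedIdeal hx hc
    (closedIdealSpan_singleton_le (isClosedIdeal_absorbedIdeal hx) h hcx)).right

end Comparison

/-! ### From approximate to exact partial isometries. -/

section Projections

variable {A : Type*} [NonUnitalCStarAlgebra A]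

/-- An element `m` of `A p` with `m⋆ m` close to the projection `p` can be corrected to a partial
isometry with initial projection `p`. -/
theorem exists_correction {p m : A} (hp : IsStarProjection p) (hm : m * p = m)
    (h : ‖star m * m - p‖ ≤ 1 / 2) :
    ∃ w : A, p * w = w ∧ w * p = w ∧ ‖w‖ ≤ 2 ∧ star (m * w) * (m * w) = p := by
  let _ := CStarAlgebra.spectralOrder A
  let _ := CStarAlgebra.spectralOrderedRing A
  have hps := hp.isSelfAdjoint.star_eq
  have hpp : p * p = p := hp.isIdempotentElem
  have hpm : p * star m = star m := by rw [← hps, ← star_mul, hm]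
  set P : Unitization ℂ A := (p : Unitization ℂ A) with hP
  have hPP : P * P = P := by rw [hP, ← Unitization.inr_mul, hpp]
  have hPs : star P = P := by rw [hP, ← Unitization.inr_star, hps]
  set N : Unitization ℂ A := ((star m * m : A) : Unitization ℂ A) with hN
  have hNP : N * P = N := by rw [hN, hP, ← Unitization.inr_mul, mul_assoc, hm]
  have hPN : P * N = N := by rw [hN, hP, ← Unitization.inr_mul, ← mul_assoc, hpm]
  set M : Unitization ℂ A := N + (1 - P) with hM
  have hM0 : 0 ≤ M := by
    refine add_nonneg (Unitization.inr_nonneg_iff.2 (star_mul_self_nonneg m)) ?_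
    have : 1 - P = star (1 - P) * (1 - P) := by
      rw [star_sub, star_one, hPs, mul_sub, sub_mul, sub_mul, hPP]
      simp
    rw [this]
    exact star_mul_self_nonneg _
  have hMu : IsUnit M := by
    have h1 : ‖1 - M‖ < 1 := by
      have : 1 - M = -((star m * m - p : A) : Unitization ℂ A) := by
        rw [hM, Unitization.inr_sub, ← hN, ← hP]
        abel
      rw [this, norm_neg, Unitization.norm_inr]
      linarith
    have := (Units.oneSub (1 - M) h1).isUnit
    rwa [Units.val_oneSub, sub_sub_cancel] at this
  have hMp : IsStrictlyPositive M := IsUnit.isStrictlyPositive hMu hM0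
  set W : Unitization ℂ A := M ^ (-(1 / 2) : ℝ) with hW
  have hWM : W * M * W = 1 := CFC.conjugate_rpow_neg_one_half M
  have hWs : star W = W := (CFC.rpow_nonneg : 0 ≤ W).isSelfAdjoint.star_eq
  have hcomm : Commute M P := by
    rw [Commute, SemiconjBy, hM, add_mul, mul_add, hNP, hPN, sub_mul, mul_sub, one_mul, mul_one]
  have hWP : W * P = P * W := (hcomm.cfc_nnreal _).eq
  have hWPs : ((W * P).snd : Unitization ℂ A) = W * P := by
    have : (W * P).fst = 0 := by simp [hP]
    rw [← Unitization.inl_fst_add_inr_snd_eq (W * P)]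
    simp [this]
  have hmain : (W * P) * N * (W * P) = P := by
    calc (W * P) * N * (W * P) = W * (P * N) * (P * W) := by rw [← hWP]; simp only [mul_assoc]
      _ = W * (M * P) * W := by
        rw [hPN, ← mul_assoc, mul_assoc W, hNP, hM, add_mul, sub_mul, hPP, hNP]
        simp
      _ = W * M * W * P := by rw [mul_assoc W, mul_assoc M, ← hWP]; simp only [mul_assoc]
      _ = P := by rw [hWM, one_mul]
  refine ⟨(W * P).snd, ?_, ?_, ?_, ?_⟩
  · apply Unitization.inr_injective (R := ℂ)
    rw [Unitization.inr_mul, hWPs, ← hP, hWP, ← mul_assoc, hPP]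
  · apply Unitization.inr_injective (R := ℂ)
    rw [Unitization.inr_mul, hWPs, ← hP, mul_assoc, hPP]
  · have hpn : ‖P‖ ≤ 1 := by
      rw [hP, Unitization.norm_inr]
      exact hp.norm_le
    have h2 : star (W * P) * (W * P) = P - (W * P) * (N - P) * (W * P) := by
      rw [mul_sub, sub_mul, hmain, star_mul, hWs, hPs, hWP]
      rw [sub_sub_cancel, mul_assoc (P * W) P, ← mul_assoc P P W, hPP]
    have h3 : ‖N - P‖ ≤ 1 / 2 := by rwa [hN, hP, ← Unitization.inr_sub, Unitization.norm_inr]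
    rw [← Unitization.norm_inr (𝕜 := ℂ), hWPs]
    -- This says ‖WP‖² ≤ 2.
    have h4 : ‖W * P‖ * ‖W * P‖ ≤ 1 + ‖W * P‖ * (1 / 2) * ‖W * P‖ := by
      rw [← CStarRing.norm_star_mul_self, h2]
      refine (norm_sub_le _ _).trans (add_le_add hpn ?_)
      refine (norm_mul_le _ _).trans ?_
      gcongr
      refine (norm_mul_le _ _).trans ?_
      gcongr
    nlinarith [norm_nonneg (W * P)]
  · apply Unitization.inr_injective (R := ℂ)
    have h5 : ((star (m * (W * P).snd) * (m * (W * P).snd) : A) : Unitization ℂ A)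
        = star ((W * P).snd : Unitization ℂ A) * N * ((W * P).snd : Unitization ℂ A) := by
      rw [hN]
      simp only [star_mul, Unitization.inr_mul, Unitization.inr_star, mul_assoc]
    rw [h5, hWPs, star_mul, hWs, hPs, ← hWP, hmain]

theorem mul_eq_self_of_star_mul_self {p v : A} (hp : IsStarProjection p) (h : star v * v = p) :
    v * p = v := by
  have hps := hp.isSelfAdjoint.star_eq
  have hpp : p * p = p := hp.isIdempotentElem
  rw [← sub_eq_zero, ← CStarRing.star_mul_self_eq_zero_iff, star_sub, star_mul, hps]
  calc (p * star v - star v) * (v * p - v)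
      = p * (star v * v) * p - p * (star v * v) - (star v * v) * p + star v * v := by noncomm_ring
    _ = 0 := by simp [h, hpp]

theorem isStarProjection_mul_star {p v : A} (hp : IsStarProjection p) (h : star v * v = p) :
    IsStarProjection (v * star v) := by
  refine ⟨?_, .mul_star_self v⟩
  rw [IsIdempotentElem, mul_assoc, ← mul_assoc (star v), h, ← mul_assoc,
    mul_eq_self_of_star_mul_self hp h]

/-- A projection Cuntz below `a⋆ a` is equivalent to a projection of the form `a x x⋆ a⋆`. -/
theorem CuntzLE.exists_partialIsometry {p a : A} (hp : IsStarProjection p)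
    (h : CuntzLE p (star a * a)) : ∃ x : A, star (a * x) * (a * x) = p := by
  have hps := hp.isSelfAdjoint.star_eq
  have hpp : p * p = p := hp.isIdempotentElem
  obtain ⟨y, hy⟩ := h (1 / 2) (by norm_num)
  obtain ⟨w, -, -, -, hw⟩ := exists_correction (m := a * y * p) hp (by rw [mul_assoc, hpp]) (by
    have : star (a * y * p) * (a * y * p) - p = p * (star y * (star a * a) * y - p) * p := by
      simp only [star_mul, hps, mul_sub, sub_mul, hpp, mul_assoc]
    rw [this]
    calc _ ≤ ‖p‖ * ‖star y * (star a * a) * y - p‖ * ‖p‖ :=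
          (norm_mul_le _ _).trans (by gcongr; exact norm_mul_le _ _)
      _ ≤ 1 * (1 / 2) * 1 := by gcongr <;> exact hp.norm_le
      _ = 1 / 2 := by norm_num)
  exact ⟨y * p * w, by simpa only [mul_assoc] using hw⟩

/-- A projection `p` with `p ⊕ p ≾ p` contains two orthogonal copies of itself. -/
theorem PairLE.exists_isometries {p : A} (hp : IsStarProjection p) (h : PairLE p p p) :
    ∃ v₁ v₂ : A, p * v₁ = v₁ ∧ p * v₂ = v₂ ∧ star v₁ * v₁ = p ∧ star v₂ * v₂ = p ∧
      star v₁ * v₂ = 0 := by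
  have hps := hp.isSelfAdjoint.star_eq
  have hpp : p * p = p := hp.isIdempotentElem
  have hpn := hp.norm_le
  have hcorner : ∀ (z : A) (c : ℝ), ‖z‖ ≤ c → ‖p * z * p‖ ≤ c := fun z c hz => by
    calc ‖p * z * p‖ ≤ ‖p‖ * ‖z‖ * ‖p‖ := (norm_mul_le _ _).trans (by gcongr; exact norm_mul_le _ _)
      _ ≤ 1 * c * 1 := by gcongr; linarith [norm_nonneg z]
      _ = c := by ring
  obtain ⟨y, z, hy, hz, hyz⟩ := pairLE_iff.1 h (1 / 8) (by norm_num)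
  have hsq : ∀ y : A, star (p * y * p) * (p * y * p) - p = p * (star y * p * y - p) * p := by
    intro y
    simp only [star_mul, hps, mul_sub, sub_mul, hpp, mul_assoc]
    rw [← mul_assoc p p, hpp]
  obtain ⟨w, hw1, hw2, hwn, hw⟩ := exists_correction (m := p * y * p) hp (by rw [mul_assoc, hpp])
    (by rw [hsq]; exact (hcorner _ _ hy.le).trans (by norm_num))
  obtain ⟨v, hv⟩ : ∃ v, v = p * y * p * w := ⟨_, rfl⟩
  rw [← hv] at hw
  have hpv : p * v = v := by rw [hv]; simp only [← mul_assoc, hpp]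
  have hvp : v * p = v := by rw [hv, mul_assoc, hw2]
  obtain ⟨t, ht⟩ : ∃ t, t = p * z * p := ⟨_, rfl⟩
  have hvt : ‖star v * t‖ ≤ 1 / 4 := by
    have : star v * t = star w * (p * (star y * p * z) * p) := by
      rw [hv, ht]
      simp only [star_mul, hps, mul_assoc]
      rw [← mul_assoc p p, hpp]
    rw [this]
    calc _ ≤ ‖star w‖ * ‖p * (star y * p * z) * p‖ := norm_mul_le _ _
      _ ≤ 2 * (1 / 8) := by
        rw [norm_star]
        gcongr
        exact hcorner _ _ hyz.le
      _ = 1 / 4 := by norm_num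
  -- Gram–Schmidt: the part of t in the range of v is removed, so v⋆m = 0 exactly. The loss in m⋆m
  -- is ‖v⋆t‖² ≤ 1/16, and 1/8 + 1/16 stays below the 1/2 allowed by `exists_correction`.
  obtain ⟨m, hm⟩ : ∃ m, m = t - v * (star v * t) := ⟨_, rfl⟩
  have hpt : p * t = t := by rw [ht]; simp only [← mul_assoc, hpp]
  have htp : t * p = t := by rw [ht, mul_assoc, hpp]
  have hstarvp : p * star v = star v := by rw [← hps, ← star_mul, hvp]
  have hvm : star v * m = 0 := by
    rw [hm, mul_sub, ← mul_assoc (star v) v, hw, ← mul_assoc, hstarvp, sub_self]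
  have hmm : star m * m - p = (star t * t - p) - star (star v * t) * (star v * t) := by
    have : star m * m = star t * m := by
      nth_rewrite 1 [hm]
      rw [star_sub, star_mul, sub_mul, mul_assoc, hvm, mul_zero, sub_zero]
    rw [this, hm, mul_sub, star_mul, star_star]
    noncomm_ring
  obtain ⟨w', hw1', hw2', hwn', hw'⟩ := exists_correction (m := m) hp
    (by rw [hm, sub_mul, mul_assoc, mul_assoc, htp]) (by
      rw [hmm]
      refine (norm_sub_le _ _).trans ?_
      rw [CStarRing.norm_star_mul_self]
      have h1 : ‖star t * t - p‖ ≤ 1 / 8 := by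
        rw [ht, hsq]
        exact hcorner _ _ hz.le
      nlinarith [norm_nonneg (star v * t)])
  refine ⟨v, m * w', hpv, ?_, hw, hw', ?_⟩
  · rw [← mul_assoc, hm, mul_sub, hpt, ← mul_assoc p v, hpv]
  · rw [← mul_assoc, hvm, zero_mul]

end Projections

/-! ### The scaling construction of projections. -/

section Scaling

/-- The Blackadar–Cuntz construction: an approximate isometry `s + (1 - e)` of the unitization
produces a projection. -/
theorem exists_projection_of_scaling {B : Type*} [NonUnitalCStarAlgebra B] {e s t : B}
    (he : IsSelfAdjoint e) (hs : e * s = s) (ht : e * t = t)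
    (h1 : ‖star s * s - (e + e - e * e)‖ < 1 / 4) (h2 : ‖star t * t - (e + e - e * e)‖ < 1 / 4)
    (h3 : ‖star s * t‖ < 1 / 4) :
    ∃ p : B, IsStarProjection p ∧ ‖(e + e - e * e) - star t * p * t‖ ≤ 1 / 2 := by
  have hse : star s * e = star s := by rw [← he.star_eq, ← star_mul, hs]
  -- Because es = s, the cross terms vanish and v⋆v = 1 + (s⋆s - (2e - e²)) is close to 1.
  set v : Unitization ℂ B := s + (1 - (e : Unitization ℂ B)) with hv
  have hvv : star v * v = 1 + ((star s * s - (e + e - e * e) : B) : Unitization ℂ B) := by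
    have e1 : star (s : Unitization ℂ B) * (e : Unitization ℂ B) = star (s : Unitization ℂ B) := by
      rw [← Unitization.inr_star, ← Unitization.inr_mul, hse]
    have e2 : (e : Unitization ℂ B) * (s : Unitization ℂ B) = s := by rw [← Unitization.inr_mul, hs]
    have e3 : star (e : Unitization ℂ B) = e := by rw [← Unitization.inr_star, he.star_eq]
    rw [hv, star_add, star_sub, star_one, e3]
    simp only [Unitization.inr_sub, Unitization.inr_add, Unitization.inr_mul, Unitization.inr_star]
    rw [add_mul, mul_add, mul_add, mul_sub, mul_one, e1, sub_mul 1 (e : Unitization ℂ B) (s : Unitization ℂ B), e2]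
    noncomm_ring
  have hn : ‖1 - star v * v‖ < 1 / 4 := by
    rw [hvv, sub_add_cancel_left, norm_neg, Unitization.norm_inr]
    exact h1
  set N : (Unitization ℂ B)ˣ := Units.oneSub (1 - star v * v) (hn.trans (by norm_num)) with hN
  have hNv : (N : Unitization ℂ B) = star v * v := by rw [hN, Units.val_oneSub, sub_sub_cancel]
  set K : Unitization ℂ B := ((N⁻¹ : (Unitization ℂ B)ˣ) : Unitization ℂ B) with hK
  have hKN : K * (star v * v) = 1 := by rw [← hNv, hK, Units.inv_mul]
  have hNK : (star v * v) * K = 1 := by rw [← hNv, hK, Units.mul_inv]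
  have hKs : star K = K := by
    have : star K * (star v * v) = 1 := by
      have := congrArg star hNK
      simpa [mul_assoc] using this
    calc star K = star K * ((star v * v) * K) := by rw [hNK, mul_one]
      _ = K := by rw [← mul_assoc, this, one_mul]
  have hKn : ‖K‖ ≤ 2 := by
    have : K = 1 + K * (1 - star v * v) := by rw [mul_sub, hKN]; simp
    have h4 : ‖K‖ ≤ 1 + ‖K‖ * (1 / 4) := by
      calc ‖K‖ = ‖1 + K * (1 - star v * v)‖ := by rw [← this]
        _ ≤ ‖(1 : Unitization ℂ B)‖ + ‖K‖ * ‖1 - star v * v‖ :=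
          (norm_add_le _ _).trans (by gcongr; exact norm_mul_le _ _)
        _ ≤ 1 + ‖K‖ * (1 / 4) := by
          gcongr
          exact CStarRing.norm_one.le
    linarith
  -- The complement of the range projection of v. Both v and K have scalar part 1, so P has scalar
  -- part 0 and lies in B.
  set P : Unitization ℂ B := 1 - v * K * star v with hP
  have hfst : P.fst = 0 := by
    let φ : Unitization ℂ B →ₐ[ℂ] ℂ := Unitization.fstHom ℂ B
    have hφ : ∀ b : B, φ b = 0 := fun _ => rfl
    have hvf : φ v = 1 := by rw [hv, map_add, map_sub, map_one, hφ, hφ]; simp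
    have hvs : φ (star v) = 1 := by
      rw [hv, star_add, star_sub, star_one, ← Unitization.inr_star, ← Unitization.inr_star, map_add,
        map_sub, map_one, hφ, hφ]
      simp
    have hKf : φ K = 1 := by
      have := congrArg φ hKN
      rwa [map_mul, map_mul, map_one, hvf, hvs, mul_one, mul_one] at this
    change φ P = 0
    rw [hP, map_sub, map_one, map_mul, map_mul, hvf, hvs, hKf]
    simp
  have hPs : star P = P := by simp [hP, hKs, mul_assoc]
  have hPP : P * P = P := by
    have : v * K * star v * (v * K * star v) = v * K * star v := by
      calc _ = v * (K * (star v * v)) * K * star v := by noncomm_ring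
        _ = _ := by rw [hKN, mul_one]
    rw [hP, mul_sub, mul_one, sub_mul, one_mul, this, sub_self, sub_zero]
  have hPsnd : (P.snd : Unitization ℂ B) = P := by
    conv_rhs => rw [← Unitization.inl_fst_add_inr_snd_eq P]
    simp [hfst]
  refine ⟨P.snd, ⟨?_, ?_⟩, ?_⟩
  · apply Unitization.inr_injective (R := ℂ)
    rw [Unitization.inr_mul, hPsnd, hPP]
  · apply Unitization.inr_injective (R := ℂ)
    rw [Unitization.inr_star, hPsnd, hPs]
  -- Since (1 - e)t = 0, v⋆t = s⋆t is small: t is almost orthogonal to the range of v, hence almost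
  -- fixed by P, and t⋆Pt remains near t⋆t.
  · have hvt : star v * t = ((star s * t : B) : Unitization ℂ B) := by
      have e2 : (e : Unitization ℂ B) * (t : Unitization ℂ B) = t := by rw [← Unitization.inr_mul, ht]
      have e3 : star (e : Unitization ℂ B) = e := by rw [← Unitization.inr_star, he.star_eq]
      rw [hv, star_add, star_sub, star_one, e3, add_mul, sub_mul, e2, one_mul, sub_self, add_zero,
        Unitization.inr_mul, Unitization.inr_star]
    have h5 : (((e + e - e * e) - star t * P.snd * t : B) : Unitization ℂ B)
        = -((star t * t - (e + e - e * e) : B) : Unitization ℂ B) + star (star v * t) * K * (star v * t) := by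
      simp only [Unitization.inr_sub, Unitization.inr_mul, hPsnd, Unitization.inr_star]
      rw [hP]
      simp only [star_mul, star_star]
      noncomm_ring
    rw [← Unitization.norm_inr (𝕜 := ℂ), h5, hvt]
    calc _ ≤ ‖star t * t - (e + e - e * e)‖ + ‖star s * t‖ * ‖K‖ * ‖star s * t‖ := by
          refine (norm_add_le _ _).trans (add_le_add ?_ ?_)
          · rw [norm_neg, Unitization.norm_inr]
          · refine (norm_mul_le _ _).trans ?_
            refine (mul_le_mul_of_nonneg_right (norm_mul_le _ _) (norm_nonneg _)).trans ?_
            rw [norm_star, Unitization.norm_inr]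
      _ ≤ 1 / 4 + 1 / 4 * 2 * (1 / 4) := by gcongr
      _ ≤ 1 / 2 := by norm_num

end Scaling

/-! ### Hereditary subalgebras of positive elements. -/

section Hereditary

variable {A : Type*} [NonUnitalCStarAlgebra A]

/-- The closed right ideal generated by `x`. -/
def principalRightIdeal (x : A) : Submodule ℂ A :=
  (LinearMap.range (LinearMap.mulLeft ℂ x)).topologicalClosure

theorem isClosed_principalRightIdeal (x : A) : IsClosed (principalRightIdeal x : Set A) :=
  Submodule.isClosed_topologicalClosure _

theorem mem_principalRightIdeal_iff {x y : A} :
    y ∈ principalRightIdeal x ↔ y ∈ closure (Set.range fun z => x * z) := by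
  rw [principalRightIdeal, ← SetLike.mem_coe, Submodule.topologicalClosure_coe]
  rfl

theorem mul_mem_principalRightIdeal {x y : A} (hy : y ∈ principalRightIdeal x) (a : A) :
    y * a ∈ principalRightIdeal x := by
  rw [mem_principalRightIdeal_iff] at *
  refine map_mem_closure (f := fun t => t * a) (by fun_prop) hy ?_
  rintro _ ⟨z, rfl⟩
  exact ⟨z * a, by simp [mul_assoc]⟩

/-- The hereditary sub-C⋆-algebra generated by a positive element. -/
def her (x : A) : NonUnitalStarSubalgebra ℂ A :=
  rightIdealHer (principalRightIdeal x) fun _ => mul_mem_principalRightIdeal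

variable [PartialOrder A] [StarOrderedRing A]

theorem isHereditary_her (x : A) : IsHereditary (her x) :=
  isHereditary_rightIdealHer _ (isClosed_principalRightIdeal x)

/-- Without a unit, x ∈ closure(xA) needs an argument: `approxUnit` of x² lies in this right ideal
because x² does, and it approximately fixes x. -/
theorem self_mem_her {x : A} (hx : 0 ≤ x) : x ∈ her x := by
  have : x ∈ principalRightIdeal x := by
    obtain ⟨y, hy, rfl⟩ := exists_sqrt hx
    refine closed_of_forall_norm_lt (isClosed_principalRightIdeal _) fun ε hε => ?_
    have hx2 : 0 ≤ (y * y) * (y * y) := by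
      have := star_mul_self_nonneg (y * y)
      rwa [hx.isSelfAdjoint.star_eq] at this
    obtain ⟨δ, hδ, h⟩ := tendsto_approxUnit_mul (d := y * y * (y * y)) (y := y * y)
      (by rw [hx.isSelfAdjoint.star_eq]) hε
    refine ⟨approxUnit (y * y * (y * y)) δ * (y * y), ?_, by rwa [norm_sub_rev]⟩
    refine mul_mem_principalRightIdeal ?_ _
    refine cfcₙ_mem_rightIdeal (fun _ => mul_mem_principalRightIdeal)
      (isClosed_principalRightIdeal _) hx2.isSelfAdjoint ?_ _
    rw [mem_principalRightIdeal_iff]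
    exact subset_closure ⟨_, rfl⟩
  exact ⟨this, by rwa [hx.isSelfAdjoint.star_eq]⟩

/-- The root √c lies in the closure of xA, and (xz)⋆(xz) = (√x z)⋆ x (√x z). -/
theorem cuntzLE_of_mem_her {x c : A} (hx : 0 ≤ x) (hc : 0 ≤ c) (h : c ∈ her x) : CuntzLE c x := by
  obtain ⟨y, hy, rfl⟩ := exists_sqrt hc
  have hys := hy.isSelfAdjoint.star_eq
  have : y ∈ principalRightIdeal x :=
    mem_rightIdeal_of_mul_star_le (fun _ => mul_mem_principalRightIdeal)
      (isClosed_principalRightIdeal x) (by rw [hys]) h.1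
  obtain ⟨s, hs, rfl⟩ := exists_sqrt hx
  rw [mem_principalRightIdeal_iff] at this
  rw [cuntzLE_iff_mem_closure]
  have h2 := map_mem_closure (f := fun t => star t * t)
    (t := Set.range fun z => star z * (s * s) * z) (by fun_prop) this (by
      rintro _ ⟨z, rfl⟩
      exact ⟨s * z, by simp [mul_assoc, hs.isSelfAdjoint.star_eq]⟩)
  simpa only [hys] using h2

/-- For positive x this is u⋆xu ≤ ‖x‖u⋆u, and positive elements span A. Polarization then gives BAB
⊆ B in `IsHereditary.mul_mem`. -/
theorem IsHereditary.conj_mem {B : NonUnitalStarSubalgebra ℂ A} (hB : IsHereditary B) {u : A}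
    (hu : u ∈ B) (x : A) : star u * x * u ∈ B := by
  have hx : x ∈ Submodule.span ℂ {a : A | 0 ≤ a} := by
    rw [CStarAlgebra.span_nonneg]
    exact Submodule.mem_top
  induction hx using Submodule.span_induction with
  | mem x hx =>
    refine hB.2 _ _ (star_left_conjugate_nonneg hx u)
      (CStarAlgebra.star_left_conjugate_le_norm_smul (a := u) (b := x)
        (hb := (show (0 : A) ≤ x from hx).isSelfAdjoint)) ?_
    have := SMulMemClass.smul_mem (‖x‖ : ℂ) (mul_mem (star_mem hu) hu)
    rwa [Complex.coe_smul] at this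
  | zero => simp
  | add x y _ _ hx hy => simpa [mul_add, add_mul] using add_mem hx hy
  | smul c x _ hx => simpa [mul_smul_comm, smul_mul_assoc] using SMulMemClass.smul_mem c hx

theorem IsHereditary.mul_mem {B : NonUnitalStarSubalgebra ℂ A} (hB : IsHereditary B) {u v : A}
    (hu : u ∈ B) (hv : v ∈ B) (x : A) : u * x * v ∈ B := by
  have key : ∀ u ∈ B, star u * x * v ∈ B := by
    intro u hu
    have h : star u * x * v = (1 / 4 : ℂ) • (star (u + v) * x * (u + v)
        - star (u - v) * x * (u - v)
        - Complex.I • (star (u + Complex.I • v) * x * (u + Complex.I • v)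
          - star (u - Complex.I • v) * x * (u - Complex.I • v))) := by
      simp only [star_add, star_sub, star_smul, Complex.star_def, Complex.conj_I, add_mul, sub_mul,
        mul_add, mul_sub, smul_mul_assoc, mul_smul_comm, smul_sub, smul_add, smul_smul]
      simp only [mul_neg, Complex.I_mul_I, neg_neg, mul_one]
      module
    rw [h]
    have hI : Complex.I • v ∈ B := SMulMemClass.smul_mem _ hv
    exact SMulMemClass.smul_mem _ (sub_mem (sub_mem (hB.conj_mem (add_mem hu hv) x)
      (hB.conj_mem (sub_mem hu hv) x)) (SMulMemClass.smul_mem _ (sub_mem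
      (hB.conj_mem (add_mem hu hI) x) (hB.conj_mem (sub_mem hu hI) x))))
  simpa using key (star u) (star_mem hu)

/-- If `p` is a projection in the hereditary subalgebra generated by `x` and `v` is an isometry of
the corner of `p`, then `x` absorbs the defect projection of `v`. -/
theorem pairLE_defect {x p v : A} (hx : 0 ≤ x) (hp : IsStarProjection p) (hpx : p ∈ her x)
    (hv : star v * v = p) (hpv : p * v = v) : PairLE x (p - v * star v) x := by
  have hps := hp.isSelfAdjoint.star_eq
  have hpp : p * p = p := hp.isIdempotentElem
  have hvp := mul_eq_self_of_star_mul_self hp hv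
  have hsvp : star v * p = star v := by rw [← hps, ← star_mul, hpv]
  have hpsv : p * star v = star v := by rw [← hps, ← star_mul, hvp]
  obtain ⟨f, hf⟩ : ∃ f, f = p - v * star v := ⟨_, rfl⟩
  -- Here m = (1 - p)x(1 - p). The element p + m is Cuntz equivalent to x and has p as an orthogonal
  -- summand.
  obtain ⟨m, hm⟩ : ∃ m, m = x - p * x - x * p + p * x * p := ⟨_, rfl⟩
  have hpm : p * m = 0 := by
    rw [hm, mul_add, mul_sub, mul_sub]
    simp only [← mul_assoc, hpp]
    abel
  have hmp : m * p = 0 := by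
    rw [hm, add_mul, sub_mul, sub_mul]
    simp only [mul_assoc, hpp]
    abel
  have hm0 : 0 ≤ m := by
    rw [hm]
    simpa using sub_conj_mono hx hp.isSelfAdjoint
  have hx'0 : 0 ≤ p + m := add_nonneg hp.nonneg hm0
  have hx'm : p + m ∈ her x := by
    have hxx := self_mem_her hx
    have h1 := mul_mem hpx hxx
    rw [hm]
    exact add_mem hpx (add_mem (sub_mem (sub_mem hxx h1) (mul_mem hxx hpx)) (mul_mem h1 hpx))
  have hxx' : CuntzLE x (p + m) := by
    refine cuntzLE_of_le_smul hx (t := 2 * (‖x‖ + 1)) (by positivity) ?_ hx'0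
    have h1 : p * x * p ≤ ‖x‖ • p := by
      have := CStarAlgebra.star_left_conjugate_le_norm_smul (a := p) (b := x)
        (hb := hx.isSelfAdjoint)
      rwa [hps, hpp] at this
    have h2 : x ≤ (2 : ℝ) • (p * x * p + m) := by
      rw [← sub_nonneg]
      convert sub_conj_mono hx (hp.isSelfAdjoint.add hp.isSelfAdjoint) using 1
      · simp
      · rw [hm, two_smul]
        noncomm_ring
    calc x ≤ (2 : ℝ) • (p * x * p + m) := h2
      _ ≤ (2 : ℝ) • (‖x‖ • p + m) := by gcongr
      _ ≤ (2 : ℝ) • ((‖x‖ + 1) • (p + m)) := by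
        gcongr
        rw [smul_add, add_smul, one_smul, add_smul, one_smul, add_assoc]
        gcongr
        rw [← add_assoc]
        exact le_add_of_nonneg_left (add_nonneg hp.nonneg (smul_nonneg (norm_nonneg x) hm0))
      _ = _ := by rw [smul_smul]
  have hpf : p * f = f := by rw [hf, mul_sub, hpp, ← mul_assoc, hpv]
  have hff : star f * (p + m) * f = f := by
    have h1 : (p + m) * f = f := by
      rw [add_mul, hpf]
      nth_rewrite 2 [← hpf]
      rw [← mul_assoc, hmp, zero_mul, add_zero]
    have hfs : star f = f := by rw [hf]; simp [hps]
    rw [mul_assoc, h1, hfs, hf, mul_sub, sub_mul, sub_mul, hpp, ← mul_assoc p v, hpv]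
    rw [mul_assoc v (star v) p, hsvp, mul_assoc v, ← mul_assoc (star v) v, hv, hpsv]
    abel
  -- Conjugation by v + (1 - p) fixes p + m, while (p + m)(v + (1 - p)) is annihilated by f = p -
  -- vv⋆ on the left. This frees f: the pair (vu + (1 - p)u, f) has the required Gram data.
  have key : ∀ u : A, PairLE (star u * (p + m) * u) f (p + m) := by
    intro u
    have hmv : m * v = 0 := by rw [← hpv, ← mul_assoc, hmp, zero_mul]
    have h1 : (p + m) * (v * u + (u - p * u)) = v * u + m * u := by
      have e1 : p * (v * u) = v * u := by rw [← mul_assoc, hpv]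
      have e2 : m * (v * u) = 0 := by rw [← mul_assoc, hmv, zero_mul]
      have e3 : p * (u - p * u) = 0 := by rw [mul_sub, ← mul_assoc, hpp, sub_self]
      have e4 : m * (u - p * u) = m * u := by rw [mul_sub, ← mul_assoc, hmp, zero_mul, sub_zero]
      rw [add_mul, mul_add, mul_add, e1, e2, e3, e4, add_zero, zero_add]
    have h2 : star (v * u + (u - p * u)) * (p + m) * (v * u + (u - p * u))
        = star u * (p + m) * u := by
      rw [mul_assoc, h1, star_add, star_sub, star_mul, star_mul, hps, add_mul, mul_add, mul_add]
      have e1 : star u * star v * (v * u) = star u * p * u := by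
        rw [mul_assoc, ← mul_assoc (star v), hv, mul_assoc]
      have e2 : star u * star v * (m * u) = 0 := by
        rw [mul_assoc, ← mul_assoc (star v), ← hsvp, mul_assoc (star v), hpm]; simp
      have e3 : (star u - star u * p) * (v * u) = 0 := by
        rw [sub_mul, mul_assoc, ← mul_assoc p, hpv, sub_self]
      have e4 : (star u - star u * p) * (m * u) = star u * m * u := by
        rw [sub_mul, mul_assoc, ← mul_assoc p, hpm]; simp [mul_assoc]
      rw [e1, e2, e3, e4, mul_add, add_mul]
      abel
    have h3 : star f * (p + m) * (v * u + (u - p * u)) = 0 := by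
      have hfs : star f = f := by rw [hf]; simp [hps]
      have hfv : f * v = 0 := by
        rw [hf, sub_mul, hpv, mul_assoc, hv, hvp, sub_self]
      have hfm : f * m = 0 := by
        rw [hf, sub_mul, hpm, mul_assoc, ← hsvp, mul_assoc (star v), hpm]; simp
      rw [mul_assoc, h1, hfs, mul_add, ← mul_assoc, ← mul_assoc, hfv, hfm]
      simp
    have h4 : star (v * u + (u - p * u)) * (p + m) * f = 0 := by
      have := congrArg star h3
      simpa [mul_assoc, hx'0.isSelfAdjoint.star_eq] using this
    have := pairLE_of_eq h4
    rwa [h2, hff] at this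
  rw [← hf]
  refine PairLE.trans ?_ (cuntzLE_of_mem_her hx hx'0 hx'm)
  rw [cuntzLE_iff_mem_closure] at hxx'
  refine closure_minimal (t := {t | PairLE t f (p + m)}) ?_
    (isClosed_closure.preimage (by fun_prop)) hxx'
  rintro _ ⟨u, rfl⟩
  exact key u

end Hereditary

-- The norm of a projection in the quotient is 0 or 1.
open IsClosedIdeal.Quotient in
theorem IsClosedIdeal.mem_of_norm_mk_projection_lt {A : Type u} [NonUnitalCStarAlgebra A] {I : Submodule ℂ A} (hI : IsClosedIdeal I)
    {p : A} (hp : IsStarProjection p) (h : ‖mk hI p‖ < 1) : p ∈ I := by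
  have hp' : mk hI p * mk hI p = mk hI p := by rw [← map_mul, hp.isIdempotentElem.eq]
  have hps : star (mk hI p) = mk hI p := by rw [← map_star, hp.isSelfAdjoint.star_eq]
  have h1 : ‖mk hI p‖ * ‖mk hI p‖ = ‖mk hI p‖ := by
    rw [← CStarRing.norm_star_mul_self, hps, hp']
  rw [← mk_eq_zero (hI := hI), ← norm_eq_zero]
  by_contra hne
  have : ‖mk hI p‖ = 1 := mul_left_cancel₀ hne (by rw [h1, mul_one])
  linarith

/-! ### Absorption in quotients; projections from absorbed truncations. -/

section Absorption

variable {A : Type u} [NonUnitalCStarAlgebra A] [PartialOrder A] [StarOrderedRing A]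

open IsClosedIdeal.Quotient in
/-- The image of `x` in the quotient by its absorbed ideal absorbs nothing. -/
theorem mem_absorbedIdeal_of_pairLE_mk {x d : A} (hx : 0 ≤ x) (hd : 0 ≤ d)
    (h : PairLE (mk (isClosedIdeal_absorbedIdeal hx) x) (mk (isClosedIdeal_absorbedIdeal hx) d)
      (mk (isClosedIdeal_absorbedIdeal hx) x)) : d ∈ absorbedIdeal x hx := by
  set hL := isClosedIdeal_absorbedIdeal hx with hLdef
  have hxs := hx.isSelfAdjoint
  refine mem_absorbedIdeal_of_pairLE hx hd ?_
  rw [PairLE, ← isClosed_closure.closure_eq, Metric.mem_closure_iff]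
  intro ε hε
  -- The bounds for u and v do not depend on the cut-down f ∈ L(x), so η can be fixed before f is
  -- chosen.
  obtain ⟨C₁, hC₁, hu₁⟩ := exists_norm_le_conj_sub_lt hx (half_pos hε)
  obtain ⟨C₂, hC₂, hu₂⟩ := exists_norm_le_conj_sub_lt hd (half_pos hε)
  obtain ⟨C, hC, hC1, hC2⟩ : ∃ C : ℝ, 0 < C ∧ C₁ ≤ C ∧ C₂ ≤ C :=
    ⟨max C₁ C₂, lt_max_of_lt_left hC₁, le_max_left _ _, le_max_right _ _⟩
  -- the tolerance for the approximations in the quotient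
  obtain ⟨η, hη, hηε⟩ : ∃ η : ℝ, 0 < η ∧ 2 * (C * (2 * η) * C) < ε / 2 := by
    refine ⟨ε / (16 * C ^ 2), by positivity, ?_⟩
    have : 2 * (C * (2 * (ε / (16 * C ^ 2))) * C) = ε / 4 := by field_simp; ring
    rw [this]
    linarith
  obtain ⟨y', z', hy, hz, hyz⟩ := pairLE_iff.1 h η hη
  obtain ⟨y, rfl⟩ := mk_surjective y'
  obtain ⟨z, rfl⟩ := mk_surjective z'
  simp only [← map_star, ← map_mul, ← map_sub] at hy hz hyz
  obtain ⟨l₁, hl₁, h₁⟩ := exists_mem_norm_sub_lt_of_norm_mk_lt hy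
  obtain ⟨l₂, hl₂, h₂⟩ := exists_mem_norm_sub_lt_of_norm_mk_lt hz
  obtain ⟨l₃, hl₃, h₃⟩ := exists_mem_norm_sub_lt_of_norm_mk_lt hyz
  classical
  obtain ⟨f, hfL, hf0, hf1, hf⟩ := hL.exists_approxUnit {l₁, l₂, l₃}
    (by simp [hl₁, hl₂, hl₃]) hη
  have hfs := hf0.isSelfAdjoint.star_eq
  -- cutting down by `1 - f`
  have hcut : ∀ w l : A, ‖w - l‖ < η → ‖l - f * l‖ < η → ‖(w - f * w) - (w - f * w) * f‖ ≤ 2 * η := by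
    intro w l h1 h2
    refine (norm_sub_mul_le' hf0 hf1 _).trans ?_
    have : w - f * w = ((w - l) - f * (w - l)) + (l - f * l) := by noncomm_ring
    rw [this]
    refine (norm_add_le _ _).trans ?_
    have := norm_sub_mul_le hf0 hf1 (w - l)
    linarith
  have g₁ := hcut _ _ h₁ (hf l₁ (by simp))
  have g₂ := hcut _ _ h₂ (hf l₂ (by simp))
  have g₃ := hcut _ _ h₃ (hf l₃ (by simp))
  have hconj : ∀ c : A, 0 ≤ c → PairLE x (f * c * f) x := by
    intro c hc
    obtain ⟨s, hs, rfl⟩ := exists_sqrt hc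
    have : s * f ∈ absorbedIdeal x hx := hL.mul_left hfL s
    rw [mem_absorbedIdeal, star_mul, hs.isSelfAdjoint.star_eq, hfs] at this
    simpa only [mul_assoc] using this
  -- The difference of the two sides is (1 - 2f)c(1 - 2f) ≥ 0; hence c is recovered from its two
  -- diagonal corners.
  have hdouble : ∀ c : A, 0 ≤ c →
      c ≤ (2 : ℝ) • ((c - f * c - c * f + f * c * f) + f * c * f) := by
    intro c hc
    rw [← sub_nonneg]
    convert sub_conj_mono hc (hf0.isSelfAdjoint.add hf0.isSelfAdjoint) using 1
    · simp
    · rw [two_smul]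
      noncomm_ring
  obtain ⟨u, hun, hu⟩ := hu₁ _ (hdouble x hx)
  obtain ⟨v, hvn, hv⟩ := hu₂ _ (hdouble d hd)
  obtain ⟨r, hr⟩ : ∃ r : ℝ, r = Real.sqrt 2 := ⟨_, rfl⟩
  have hrr : r * r = 2 := by rw [hr]; exact Real.mul_self_sqrt (by norm_num)
  -- This Gram matrix is close to the (1 - f)-corners of x, d and 0. The corners fxf and fdf are
  -- absorbed since f ∈ L(x), so they may be added to the diagonal; conjugation by √2 u and √2 v
  -- then leads close to (x, d, 0).
  have hG : (star (y - y * f) * x * (y - y * f), star (z - z * f) * x * (z - z * f),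
      star (y - y * f) * x * (z - z * f)) ∈ closure (pairGram x) :=
    subset_closure ⟨(y - y * f, z - z * f), rfl⟩
  have hG2 := mem_closure_pairGram_conj
    ((hconj x hx).add_mem_closure' hxs ((hconj d hd).add_mem_closure hxs hG)) (r • u) (r • v)
  refine ⟨_, hG2, ?_⟩
  have hexp : ∀ (a b w : A), star (r • a) * w * (r • b) = (2 : ℝ) • (star a * w * b) := by
    intro a b w
    simp only [star_smul, star_trivial, smul_mul_assoc, mul_smul_comm, smul_smul, hrr]
  have hbound : ∀ (a b w : A), ‖a‖ ≤ C → ‖b‖ ≤ C → ‖w‖ ≤ 2 * η →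
      ‖(2 : ℝ) • (star a * w * b)‖ < ε / 2 := by
    intro a b w ha hb hw
    refine lt_of_le_of_lt ?_ hηε
    rw [norm_smul, Real.norm_eq_abs, abs_of_pos (by norm_num : (0 : ℝ) < 2)]
    gcongr
    refine (norm_mul_le _ _).trans ?_
    gcongr
    refine (norm_mul_le _ _).trans ?_
    rw [norm_star]
    gcongr
  have hdiag : ∀ (c w a : A), 0 ≤ c → ‖a‖ ≤ C →
      ‖star a * ((2 : ℝ) • ((c - f * c - c * f + f * c * f) + f * c * f)) * a - c‖ < ε / 2 →
      ‖((star w * x * w - c) - f * (star w * x * w - c))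
        - ((star w * x * w - c) - f * (star w * x * w - c)) * f‖ ≤ 2 * η →
      ‖c - star (r • a) * (star (w - w * f) * x * (w - w * f) + f * c * f) * (r • a)‖ < ε := by
    intro c w a hc ha h1 h2
    have key : star (r • a) * (star (w - w * f) * x * (w - w * f) + f * c * f) * (r • a) - c
        = (2 : ℝ) • (star a * (((star w * x * w - c) - f * (star w * x * w - c))
        - ((star w * x * w - c) - f * (star w * x * w - c)) * f) * a)
        + (star a * ((2 : ℝ) • ((c - f * c - c * f + f * c * f) + f * c * f)) * a - c) := by
      rw [hexp, mul_smul_comm, smul_mul_assoc, add_sub_assoc', ← smul_add, ← add_mul, ← mul_add,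
        star_sub, star_mul, hfs]
      congr 4
      noncomm_ring
    rw [norm_sub_rev, key]
    refine (norm_add_le _ _).trans_lt ?_
    have := hbound a a _ ha ha h2
    linarith
  rw [dist_eq_norm, Prod.norm_def, Prod.norm_def]
  refine max_lt ?_ (max_lt ?_ ?_)
  · exact hdiag x y u hx (hun.trans hC1) hu g₁
  · exact hdiag d z v hd (hvn.trans hC2) hv g₂
  · change ‖0 - star (r • u) * (star (y - y * f) * x * (z - z * f)) * (r • v)‖ < ε
    rw [zero_sub, norm_neg, hexp]
    refine (hbound u v _ (hun.trans hC1) (hvn.trans hC2) ?_).trans (half_lt_self hε)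
    convert g₃ using 2
    rw [star_sub, star_mul, hfs]
    noncomm_ring

open IsClosedIdeal.Quotient in
/-- If `(d - α)₊` is absorbed by `(d - β)₊` for some `α < β`, then there is a projection in the
ideal of `d` whose ideal contains `(d - β)₊`. -/
theorem exists_projection_of_cut_mem_absorbedIdeal {d : A} (hd : 0 ≤ d) {α β : ℝ} (hα : 0 ≤ α)
    (hαβ : α < β) (h : cut d α ∈ absorbedIdeal (cut d β) (cut_nonneg d β)) {I : Submodule ℂ A}
    (hI : IsClosedIdeal I) (hdI : d ∈ I) :
    ∃ p : A, IsStarProjection p ∧ p ∈ I ∧ cut d β ∈ closedIdealSpan {p} := by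
  have hx := cut_nonneg d β
  have hg := cut_nonneg d α
  have hP : PairLE (cut d α) (cut d α) (cut d β) :=
    let h1 := pairLE_of_mem_absorbedIdeal hx hg h
    h1.mono h1.right (cuntzLE_refl hg)
  -- the functions used in the construction
  set γ := (α + β) / 2 with hγ
  have hαγ : α < γ := by rw [hγ]; linarith
  have hγβ : γ < β := by rw [hγ]; linarith
  have hβγ0 : 0 < β - γ := by linarith
  -- f = 1 from β on, so e = f(d) is a unit for (d - β)₊. f = 0 up to γ > α, so 2e - e² can be
  -- written as a conjugate of (d - α)₊.
  let f : ℝ → ℝ := fun t => min (max (t - γ) 0 / (β - γ)) 1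
  have hfc : Continuous f := by fun_prop
  have hf0 : ∀ t, t ≤ γ → f t = 0 := by
    intro t ht
    simp [f, max_eq_right (sub_nonpos.2 ht)]
  have hf00 : f 0 = 0 := hf0 0 (by linarith)
  have hfnn : ∀ t, 0 ≤ f t := fun t => le_min (by positivity) zero_le_one
  have hf1 : ∀ t, f t ≤ 1 := fun t => min_le_right _ _
  have hfβ : ∀ t, β ≤ t → f t = 1 := by
    intro t ht
    refine min_eq_right ?_
    rw [le_div_iff₀ hβγ0, one_mul]
    exact le_max_of_le_left (by linarith)
  -- Chosen so that k(t)²(t - α)₊ = 2f - f². The clamp at γ - α matters only where f = 0 and keeps k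
  -- continuous.
  let k : ℝ → ℝ := fun t => Real.sqrt (f t + f t - f t * f t) / Real.sqrt (max (t - α) (γ - α))
  have hkden : ∀ t, 0 < Real.sqrt (max (t - α) (γ - α)) := fun t =>
    Real.sqrt_pos.2 (lt_max_of_lt_right (by linarith))
  have hkc : Continuous k := Continuous.div (by fun_prop) (by fun_prop) fun t => (hkden t).ne'
  have hk0 : k 0 = 0 := by simp [k, hf00]
  have hcut0 : ∀ c : ℝ, 0 ≤ c → max (0 - c) 0 = 0 := fun c hc => max_eq_right (by linarith)
  set e := cfcₙ f d with he
  set h' := cfcₙ k d with hh'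
  have hes : IsSelfAdjoint e := cfcₙ_predicate _ d
  have hhs : IsSelfAdjoint h' := cfcₙ_predicate _ d
  have hex : e * cut d β = cut d β := by
    rw [he, cut, ← cfcₙ_mul f (fun t : ℝ => max (t - β) 0) d (by fun_prop) hf00 (by fun_prop)
      (hcut0 β (by linarith))]
    refine cfcₙ_congr fun t _ => ?_
    rcases le_total β t with ht | ht
    · rw [hfβ t ht, one_mul]
    · rw [max_eq_right (by linarith), mul_zero]
  have hmid : h' * cut d α * h' = e + e - e * e := by
    rw [he, hh', cut, ← cfcₙ_mul k (fun t : ℝ => max (t - α) 0) d (by fun_prop) hk0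
      (by fun_prop) (hcut0 α hα),
      ← cfcₙ_mul (fun t => k t * max (t - α) 0) k d (by fun_prop) (by simp [hk0]) (by fun_prop) hk0,
      ← cfcₙ_add f f d (by fun_prop) hf00 (by fun_prop) hf00,
      ← cfcₙ_mul f f d (by fun_prop) hf00 (by fun_prop) hf00,
      ← cfcₙ_sub (fun t => f t + f t) (fun t => f t * f t) d (by fun_prop) (by simp [hf00]) (by fun_prop) (by simp [hf00])]
    refine cfcₙ_congr fun t _ => ?_
    rcases le_total t γ with ht | ht
    · simp [k, hf0 t ht]
    · have h1 : 0 < t - α := by linarith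
      have h2 : 0 ≤ f t + f t - f t * f t := by nlinarith [hfnn t, hf1 t]
      have h3 : 0 < Real.sqrt (t - α) := Real.sqrt_pos.2 h1
      simp only [k]
      rw [max_eq_left (by linarith : γ - α ≤ t - α), max_eq_left h1.le]
      have h4 := Real.mul_self_sqrt h2
      have h5 := Real.mul_self_sqrt h1.le
      generalize Real.sqrt (f t + f t - f t * f t) = s at h4 ⊢
      generalize Real.sqrt (t - α) = r at h3 h5 ⊢
      rw [← h4, ← h5]
      field_simp
  obtain ⟨x', hx'0, hx'⟩ := exists_sqrt hx
  have hx's := hx'0.isSelfAdjoint.star_eq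
  have hex' : e * x' = x' := by
    rw [← sub_eq_zero, ← CStarRing.mul_star_self_eq_zero_iff, star_sub, star_mul, hes.star_eq, hx's]
    have : (e * x' - x') * (x' * e - x') = e * (x' * x') * e - e * (x' * x') - (x' * x') * e
        + x' * x' := by noncomm_ring
    rw [this, hx', hex]
    abel
  have hx'I : x' ∈ I := by
    have hxI : cut d β ∈ I := hI.cfcₙ_mem hd.isSelfAdjoint hdI _
    exact hI.mem_of_mul_star_mem (by rwa [hx's, hx'])
  have heI : e ∈ I := hI.cfcₙ_mem hd.isSelfAdjoint hdI _
  -- the approximate partial isometries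
  obtain ⟨η, hη, hηh⟩ : ∃ η : ℝ, 0 < η ∧ ‖h'‖ * η * ‖h'‖ < 1 / 4 := by
    refine ⟨1 / (4 * (‖h'‖ * ‖h'‖ + 1)), by positivity, ?_⟩
    have : ‖h'‖ * (1 / (4 * (‖h'‖ * ‖h'‖ + 1))) * ‖h'‖
        = ‖h'‖ * ‖h'‖ / (4 * (‖h'‖ * ‖h'‖ + 1)) := by ring
    rw [this, div_lt_iff₀ (by positivity)]
    linarith
  obtain ⟨y, z, hy, hz, hyz⟩ := pairLE_iff.1 hP η hη
  have hsandwich : ∀ w : A, ‖w‖ < η → ‖h' * w * h'‖ < 1 / 4 := fun w hw =>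
    calc _ ≤ ‖h'‖ * ‖w‖ * ‖h'‖ := (norm_mul_le _ _).trans (by gcongr; exact norm_mul_le _ _)
      _ ≤ ‖h'‖ * η * ‖h'‖ := by gcongr
      _ < _ := hηh
  have hprod : ∀ a b : A, star (x' * a * h') * (x' * b * h') = h' * (star a * cut d β * b) * h' := by
    intro a b
    rw [← hx']
    simp only [star_mul, hhs.star_eq, hx's, mul_assoc]
  have hcl : IsClosed (hI.starSubalgebra : Set A) := hI.1
  -- The construction is carried out inside I, which places the projection in I.
  let e' : hI.starSubalgebra := ⟨e, heI⟩
  let s : hI.starSubalgebra := ⟨x' * y * h', hI.mul_right (hI.mul_right hx'I _) _⟩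
  let t : hI.starSubalgebra := ⟨x' * z * h', hI.mul_right (hI.mul_right hx'I _) _⟩
  obtain ⟨p, hp, hpt⟩ := exists_projection_of_scaling (e := e') (s := s) (t := t)
    (Subtype.ext hes.star_eq)
    (Subtype.ext (show e * (x' * y * h') = x' * y * h' by simp only [← mul_assoc, hex']))
    (Subtype.ext (show e * (x' * z * h') = x' * z * h' by simp only [← mul_assoc, hex']))
    (by
      change ‖star (x' * y * h') * (x' * y * h') - (e + e - e * e)‖ < 1 / 4
      rw [hprod, ← hmid, ← sub_mul, ← mul_sub]
      exact hsandwich _ hy)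
    (by
      change ‖star (x' * z * h') * (x' * z * h') - (e + e - e * e)‖ < 1 / 4
      rw [hprod, ← hmid, ← sub_mul, ← mul_sub]
      exact hsandwich _ hz)
    (by
      change ‖star (x' * y * h') * (x' * z * h')‖ < 1 / 4
      rw [hprod]
      exact hsandwich _ hyz)
  change ‖(e + e - e * e) - star (x' * z * h') * p * (x' * z * h')‖ ≤ 1 / 2 at hpt
  have hpA : IsStarProjection (p : A) :=
    ⟨congrArg Subtype.val hp.isIdempotentElem.eq, congrArg Subtype.val hp.isSelfAdjoint.star_eq⟩
  refine ⟨p, hpA, p.2, ?_⟩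
  have hJ := isClosedIdeal_closedIdealSpan {(p : A)}
  have hpJ : (p : A) ∈ closedIdealSpan {(p : A)} := mem_closedIdealSpan_singleton _
  -- Modulo the ideal of p, (d - β)₊ is fixed by 2e - e², whose norm is at most 1/2; so it vanishes.
  have h1 : ‖mk hJ (e + e - e * e)‖ ≤ 1 / 2 := by
    have : mk hJ (e + e - e * e)
        = mk hJ ((e + e - e * e) - star (x' * z * h') * p * (x' * z * h')) := by
      rw [map_sub _ (e + e - e * e), mk_eq_zero.2 (hJ.mul_right (hJ.mul_left hpJ _) _), sub_zero]
    rw [this]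
    exact (norm_mk_le _).trans hpt
  have h2 : mk hJ (cut d β) = mk hJ (e + e - e * e) * mk hJ (cut d β) := by
    rw [← map_mul, sub_mul, add_mul, mul_assoc, hex, hex, add_sub_cancel_right]
  have h3 : ‖mk hJ (cut d β)‖ ≤ 1 / 2 * ‖mk hJ (cut d β)‖ := by
    calc _ ≤ ‖mk hJ (e + e - e * e)‖ * ‖mk hJ (cut d β)‖ := by
          conv_lhs => rw [h2]
          exact norm_mul_le _ _
      _ ≤ _ := by gcongr
  rw [← mk_eq_zero (hI := hJ), ← norm_eq_zero]
  linarith [norm_nonneg (mk hJ (cut d β))]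

end Absorption

/-! ### Irreducible representations from extreme norming states. -/

section PureStates

open scoped ComplexOrder InnerProductSpace

variable {U : Type u} [CStarAlgebra U]

/-- The states of a unital C⋆-algebra that attain the norm of `b`, as functions. -/
def normingStates (b : U) : Set (U → ℂ) :=
  {φ | (∀ x y, φ (x + y) = φ x + φ y) ∧ (∀ (c : ℂ) x, φ (c • x) = c * φ x) ∧
    (∀ x, ‖φ x‖ ≤ ‖x‖) ∧ (∀ x, 0 ≤ φ (star x * x)) ∧ φ 1 = 1 ∧ φ b = ‖b‖}

/-- Tychonoff for a product of closed discs: every defining condition is closed under pointwise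
convergence. -/
theorem isCompact_normingStates (b : U) : IsCompact (normingStates b) := by
  have hK : IsCompact (Set.univ.pi fun x : U => Metric.closedBall (0 : ℂ) ‖x‖) :=
    isCompact_univ_pi fun x => isCompact_closedBall _ _
  refine hK.of_isClosed_subset ?_ fun φ hφ x _ => by simpa using hφ.2.2.1 x
  simp only [normingStates, Set.ofPred_and, Set.ofPred_forall]
  refine IsClosed.inter ?_ (IsClosed.inter ?_ (IsClosed.inter ?_ (IsClosed.inter ?_
    (IsClosed.inter ?_ ?_))))
  · exact isClosed_iInter fun x => isClosed_iInter fun y =>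
      isClosed_eq (by fun_prop) (by fun_prop)
  · exact isClosed_iInter fun x => isClosed_iInter fun y =>
      isClosed_eq (by fun_prop) (by fun_prop)
  · exact isClosed_iInter fun x => isClosed_le (by fun_prop) (by fun_prop)
  · exact isClosed_iInter fun x => isClosed_le (by fun_prop) (by fun_prop)
  · exact isClosed_eq (by fun_prop) (by fun_prop)
  · exact isClosed_eq (by fun_prop) (by fun_prop)

theorem eq_ofReal_of_norm_le {z : ℂ} {r : ℝ} (hz : ‖z‖ ≤ r) (hzr : z.re = r) : z = r := by
  have h1 : ‖z‖ ^ 2 = z.re ^ 2 + z.im ^ 2 := by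
    rw [Complex.sq_norm, Complex.normSq_apply]; ring
  have h2 : ‖z‖ ^ 2 ≤ r ^ 2 := by gcongr
  have h3 : z.im = 0 := by
    rw [hzr] at h1
    nlinarith [sq_nonneg z.im]
  exact Complex.ext (by simpa using hzr) (by simpa using h3)

/-- The bound |φ(a + it)|² ≤ ‖a‖² + t² for all real t is impossible if y = Im φ(a) ≠ 0: take t with
2yt = ‖a‖² + 1. -/
theorem im_eq_zero_of_norm_le [Nontrivial U] {φ : StrongDual ℂ U} (hφ : ‖φ‖ ≤ 1) (h1 : φ 1 = 1) {a : U}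
    (ha : IsSelfAdjoint a) : (φ a).im = 0 := by
  have key : ∀ t : ℝ, ((φ a).im + t) ^ 2 ≤ ‖a‖ ^ 2 + t ^ 2 := by
    intro t
    obtain ⟨w, hw⟩ : ∃ w : U, w = a + (t * Complex.I) • (1 : U) := ⟨_, rfl⟩
    have hstar : star w * w = a * a + ((t : ℂ) ^ 2) • (1 : U) := by
      have hst : star w = a - (t * Complex.I) • (1 : U) := by
        rw [hw, star_add, star_smul, ha.star_eq, star_one, sub_eq_add_neg, ← neg_smul]
        simp
      rw [hst, hw]
      simp only [sub_mul, mul_add, smul_mul_assoc, mul_smul_comm, one_mul, mul_one, smul_sub,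
        smul_smul]
      have : (t : ℂ) * Complex.I * (t * Complex.I) = -(t : ℂ) ^ 2 := by
        rw [mul_mul_mul_comm, Complex.I_mul_I]; ring
      rw [this, neg_smul]
      abel
    have hn : ‖w‖ ^ 2 ≤ ‖a‖ ^ 2 + t ^ 2 := by
      rw [sq, ← CStarRing.norm_star_mul_self, hstar]
      refine (norm_add_le _ _).trans ?_
      gcongr
      · exact (norm_mul_le _ _).trans_eq (sq _).symm
      · rw [norm_smul]
        simp
    have him : (φ w).im = (φ a).im + t := by
      rw [hw, map_add, map_smul, h1]
      simp
    rw [← him]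
    calc (φ w).im ^ 2 ≤ ‖φ w‖ ^ 2 := by
          rw [← sq_abs]
          gcongr
          exact Complex.abs_im_le_norm _
      _ ≤ ‖w‖ ^ 2 := by
          gcongr
          exact φ.le_of_opNorm_le_of_le hφ le_rfl |>.trans_eq (one_mul _)
      _ ≤ _ := hn
  by_contra hne
  obtain ⟨y, hy⟩ : ∃ y, y = (φ a).im := ⟨_, rfl⟩
  rw [← hy] at key hne
  have := key ((‖a‖ ^ 2 + 1) / (2 * y))
  have h2 : y * ((‖a‖ ^ 2 + 1) / (2 * y)) = (‖a‖ ^ 2 + 1) / 2 := by field_simp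
  nlinarith [sq_nonneg y]

/-- The vector state of a unit vector. -/
theorem vectorState_mem_normingStates {H : Type*} [NormedAddCommGroup H] [InnerProductSpace ℂ H]
    [CompleteSpace H] (π : U →⋆ₐ[ℂ] (H →L[ℂ] H)) {b : U} {η : H} (hη : ‖η‖ = 1)
    (hb : ⟪η, π b η⟫_ℂ = ‖b‖) : (fun x => ⟪η, π x η⟫_ℂ) ∈ normingStates b := by
  refine ⟨fun x y => ?_, fun c x => ?_, fun x => ?_, fun x => ?_, ?_, hb⟩
  · simp
  · simp
  · refine (norm_inner_le_norm _ _).trans ?_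
    rw [hη, one_mul]
    refine ((π x).le_opNorm _).trans ?_
    rw [hη, mul_one]
    exact NonUnitalStarAlgHom.norm_apply_le π x
  · change 0 ≤ ⟪η, π (star x * x) η⟫_ℂ
    rw [map_mul, map_star, ContinuousLinearMap.star_eq_adjoint, mul_apply_eq_comp,
      ContinuousLinearMap.adjoint_inner_right]
    rw [inner_self_eq_norm_sq_to_K]
    positivity
  · simp [hη]

variable [PartialOrder U] [StarOrderedRing U]

/-- Hahn–Banach at 1 + b. As ‖1 + b‖ = 1 + ‖b‖, a norming functional must attain φ(1) = 1 and φ(b) =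
‖b‖ separately, and a contractive functional with φ(1) = 1 is positive. -/
theorem normingStates_nonempty [Nontrivial U] {b : U} (hb : 0 ≤ b) :
    (normingStates b).Nonempty := by
  have h1b : ‖1 + b‖ = 1 + ‖b‖ := by
    refine le_antisymm ((norm_add_le _ _).trans (by rw [norm_one])) ?_
    have h2 : 1 + b ≤ algebraMap ℝ U ‖1 + b‖ :=
      IsSelfAdjoint.le_algebraMap_norm_self ((IsSelfAdjoint.one U).add hb.isSelfAdjoint)
    have h3 : b ≤ algebraMap ℝ U (‖1 + b‖ - 1) := by
      rw [map_sub, map_one]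
      exact le_sub_iff_add_le'.2 h2
    have h4 : 0 ≤ ‖1 + b‖ - 1 := by
      rw [sub_nonneg]
      have : ‖(1 : U)‖ ≤ ‖1 + b‖ := CStarAlgebra.norm_le_norm_of_nonneg_of_le zero_le_one
        (le_add_of_nonneg_right hb)
      rwa [norm_one] at this
    have := (CStarAlgebra.norm_le_iff_le_algebraMap b h4 hb).2 h3
    linarith
  obtain ⟨φ, hφ, hφb⟩ := exists_dual_vector ℂ (1 + b) (by rw [h1b]; positivity)
  have hφle : ∀ x, ‖φ x‖ ≤ ‖x‖ := fun x =>
    (φ.le_of_opNorm_le_of_le hφ.le le_rfl).trans_eq (one_mul _)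
  rw [map_add, h1b] at hφb
  have hre : (φ 1).re + (φ b).re = 1 + ‖b‖ := by
    have := congrArg Complex.re hφb
    simpa using this
  have hr1 : (φ 1).re ≤ 1 := (Complex.re_le_norm _).trans ((hφle 1).trans_eq norm_one)
  have hrb : (φ b).re ≤ ‖b‖ := (Complex.re_le_norm _).trans (hφle b)
  have h1 : φ 1 = 1 := by
    have := eq_ofReal_of_norm_le ((hφle 1).trans_eq norm_one) (by linarith : (φ 1).re = 1)
    simpa using this
  have hb' : φ b = ‖b‖ := eq_ofReal_of_norm_le (hφle b) (by linarith)
  refine ⟨φ, fun x y => map_add φ x y, fun c x => map_smul φ c x, hφle, fun x => ?_, h1, hb'⟩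
  have hx : 0 ≤ star x * x := star_mul_self_nonneg x
  have him := im_eq_zero_of_norm_le hφ.le h1 hx.isSelfAdjoint
  refine Complex.nonneg_iff.2 ⟨?_, him.symm⟩
  obtain ⟨a, rfl⟩ : ∃ a, a = star x * x := ⟨_, rfl⟩
  have h5 : ‖algebraMap ℝ U ‖star x * x‖ - star x * x‖ ≤ ‖star x * x‖ := by
    refine (CStarAlgebra.norm_le_iff_le_algebraMap _ (norm_nonneg _) ?_).2 ?_
    · exact sub_nonneg.2 (IsSelfAdjoint.le_algebraMap_norm_self hx.isSelfAdjoint)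
    · exact sub_le_self _ hx
  have h6 := (Complex.re_le_norm _).trans ((hφle _).trans h5)
  rw [map_sub, IsScalarTower.algebraMap_apply ℝ ℂ U, Algebra.algebraMap_eq_smul_one, map_smul,
    h1] at h6
  simp only [Complex.sub_re, smul_eq_mul, mul_one, Complex.coe_algebraMap, Complex.ofReal_re] at h6
  linarith

/-- A positive element of a unital C⋆-algebra is not annihilated by all irreducible
representations. -/
theorem exists_irreducible_unital {b : U} (hb : 0 ≤ b) (hb0 : b ≠ 0) :
    ∃ (H : Type u) (_ : NormedAddCommGroup H) (_ : InnerProductSpace ℂ H) (_ : CompleteSpace H)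
      (π : U →⋆ₐ[ℂ] (H →L[ℂ] H)), π b ≠ 0 ∧
        ∀ K : Submodule ℂ H, IsClosed (K : Set H) → (∀ a : U, ∀ x ∈ K, π a x ∈ K) →
          K = ⊥ ∨ K = ⊤ := by
  have : Nontrivial U := ⟨⟨b, 0, hb0⟩⟩
  -- The GNS representation of an extreme point is irreducible: an invariant subspace writes φ as a
  -- convex combination of two vector states, and both must norm b because neither value exceeds
  -- ‖b‖.
  obtain ⟨φ, hφ⟩ := (isCompact_normingStates b).extremePoints_nonempty (normingStates_nonempty hb)
  rw [mem_extremePoints] at hφ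
  obtain ⟨⟨hadd, hsmul, hnorm, hpos, hone, hφb⟩, hext⟩ := hφ
  obtain ⟨f, hf⟩ : ∃ f : U →ₚ[ℂ] ℂ, ∀ x, f x = φ x := by
    refine ⟨PositiveLinearMap.mk₀ { toFun := φ, map_add' := hadd, map_smul' := hsmul } ?_,
      fun x => rfl⟩
    intro x hx
    obtain ⟨y, rfl⟩ := CStarAlgebra.nonneg_iff_eq_star_mul_self.1 hx
    exact hpos y
  obtain ⟨ξ, hξ⟩ : ∃ ξ : f.GNS, ξ = ((f.toPreGNS 1 : f.PreGNS) : f.GNS) := ⟨_, rfl⟩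
  have hπξ : ∀ a, f.gnsStarAlgHom a ξ = ((f.toPreGNS a : f.PreGNS) : f.GNS) := by
    intro a
    rw [hξ]
    simp [PositiveLinearMap.gnsStarAlgHom_apply]
  have hstate : ∀ a, ⟪ξ, f.gnsStarAlgHom a ξ⟫_ℂ = φ a := by
    intro a
    rw [hπξ, hξ, UniformSpace.Completion.inner_coe, PositiveLinearMap.preGNS_inner_def]
    simp [hf]
  have hcyc : ∀ S : Set f.GNS, IsClosed S → (∀ a, f.gnsStarAlgHom a ξ ∈ S) → ∀ x, x ∈ S := by
    intro S hS hT x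
    induction x using UniformSpace.Completion.induction_on with
    | hp => exact hS
    | ih x =>
      have := hT (f.ofPreGNS x)
      rwa [hπξ] at this
  refine ⟨f.GNS, inferInstance, inferInstance, inferInstance, f.gnsStarAlgHom, ?_, ?_⟩
  · intro h0
    have := hstate b
    rw [h0, zero_apply, inner_zero_right, hφb] at this
    exact hb0 (norm_eq_zero.1 (by exact_mod_cast this.symm))
  intro K hK hKinv
  have : CompleteSpace K := hK.completeSpace_coe
  obtain ⟨π, hπ⟩ : ∃ π, π = f.gnsStarAlgHom := ⟨_, rfl⟩
  rw [← hπ] at hstate hcyc hKinv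
  have hadj : ∀ a x y, ⟪x, π a y⟫_ℂ = ⟪π (star a) x, y⟫_ℂ := by
    intro a x y
    rw [map_star, ContinuousLinearMap.star_eq_adjoint, ContinuousLinearMap.adjoint_inner_left]
  have hcomm : ∀ a x, K.starProjection (π a x) = π a (K.starProjection x) := by
    intro a x
    symm
    refine (Submodule.eq_starProjection_of_mem_orthogonal (u := π a x)
      (hKinv a _ (Submodule.starProjection_apply_mem K x)) ?_).symm
    rw [← map_sub, Submodule.mem_orthogonal]
    intro k hk
    rw [hadj]
    exact Submodule.inner_right_of_mem_orthogonal (hKinv _ k hk)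
      (Submodule.sub_starProjection_mem_orthogonal x)
  obtain ⟨η₁, hη₁⟩ : ∃ η, η = K.starProjection ξ := ⟨_, rfl⟩
  obtain ⟨η₂, hη₂⟩ : ∃ η, η = ξ - η₁ := ⟨_, rfl⟩
  have hη₁K : η₁ ∈ K := hη₁ ▸ Submodule.starProjection_apply_mem K ξ
  have hη₂K : η₂ ∈ Kᗮ := by
    rw [hη₂, hη₁]
    exact Submodule.sub_starProjection_mem_orthogonal ξ
  have hξη : ξ = η₁ + η₂ := by rw [hη₂]; abel
  have hKo : ∀ a, π a η₁ ∈ K := fun a => hKinv a _ hη₁K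
  have hKo' : ∀ a, π a η₂ ∈ Kᗮ := by
    intro a
    rw [Submodule.mem_orthogonal]
    intro k hk
    rw [hadj]
    exact Submodule.inner_right_of_mem_orthogonal (hKinv _ k hk) hη₂K
  have hsplit : ∀ a, φ a = ⟪η₁, π a η₁⟫_ℂ + ⟪η₂, π a η₂⟫_ℂ := by
    intro a
    rw [← hstate, hξη, map_add, inner_add_left, inner_add_right, inner_add_right,
      Submodule.inner_right_of_mem_orthogonal hη₁K (hKo' a),
      Submodule.inner_left_of_mem_orthogonal (hKo a) hη₂K]
    ring
  by_cases h₁ : η₁ = 0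
  · left
    rw [eq_bot_iff]
    intro x hx
    have := hcyc {x | K.starProjection x = 0} (isClosed_eq (by fun_prop) (by fun_prop))
      (fun a => by rw [Set.mem_ofPred_eq, hcomm, ← hη₁, h₁, map_zero]) x
    rw [Set.mem_ofPred_eq, Submodule.starProjection_eq_self_iff.2 hx] at this
    exact this
  by_cases h₂ : η₂ = 0
  · right
    rw [eq_top_iff]
    intro x _
    refine hcyc K hK (fun a => ?_) x
    rw [hξη, h₂, add_zero]
    exact hKo a
  exfalso
  have hn₁ : 0 < ‖η₁‖ := norm_pos_iff.2 h₁
  have hn₂ : 0 < ‖η₂‖ := norm_pos_iff.2 h₂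
  have hsum : ‖η₁‖ ^ 2 + ‖η₂‖ ^ 2 = 1 := by
    have := hsplit 1
    rw [hone, map_one] at this
    change (1 : ℂ) = ⟪η₁, η₁⟫_ℂ + ⟪η₂, η₂⟫_ℂ at this
    rw [inner_self_eq_norm_sq_to_K, inner_self_eq_norm_sq_to_K,
      RCLike.ofReal_eq_complex_ofReal] at this
    exact_mod_cast this.symm
  -- the normalized vector states
  have hunit : ∀ η : f.GNS, 0 < ‖η‖ → ‖((‖η‖⁻¹ : ℝ) : ℂ) • η‖ = 1 := by
    intro η h
    rw [norm_smul, Complex.norm_real, norm_inv, norm_norm, inv_mul_cancel₀ h.ne']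
  have hvec : ∀ (η : f.GNS) (a : U), 0 < ‖η‖ → ⟪η, π a η⟫_ℂ
      = ((‖η‖ ^ 2 : ℝ) : ℂ) * ⟪((‖η‖⁻¹ : ℝ) : ℂ) • η, π a (((‖η‖⁻¹ : ℝ) : ℂ) • η)⟫_ℂ := by
    intro η a h
    rw [map_smul, inner_smul_left, inner_smul_right, Complex.conj_ofReal, ← mul_assoc, ← mul_assoc,
      ← Complex.ofReal_mul, ← Complex.ofReal_mul]
    have : ‖η‖ ^ 2 * ‖η‖⁻¹ * ‖η‖⁻¹ = 1 := by field_simp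
    rw [this, Complex.ofReal_one, one_mul]
  obtain ⟨u₁, hu₁⟩ : ∃ u, u = ((‖η₁‖⁻¹ : ℝ) : ℂ) • η₁ := ⟨_, rfl⟩
  obtain ⟨u₂, hu₂⟩ : ∃ u, u = ((‖η₂‖⁻¹ : ℝ) : ℂ) • η₂ := ⟨_, rfl⟩
  have hu₁n : ‖u₁‖ = 1 := hu₁ ▸ hunit η₁ hn₁
  have hu₂n : ‖u₂‖ = 1 := hu₂ ▸ hunit η₂ hn₂
  have hconv : ∀ a, φ a = ((‖η₁‖ ^ 2 : ℝ) : ℂ) * ⟪u₁, π a u₁⟫_ℂ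
      + ((‖η₂‖ ^ 2 : ℝ) : ℂ) * ⟪u₂, π a u₂⟫_ℂ := by
    intro a
    rw [hsplit, hvec η₁ a hn₁, hvec η₂ a hn₂, ← hu₁, ← hu₂]
  have hle : ∀ u : f.GNS, ‖u‖ = 1 → ‖⟪u, π b u⟫_ℂ‖ ≤ ‖b‖ := by
    intro u hu
    refine (norm_inner_le_norm _ _).trans ?_
    rw [hu, one_mul]
    refine ((π b).le_opNorm _).trans ?_
    rw [hu, mul_one]
    exact NonUnitalStarAlgHom.norm_apply_le π b
  have hre := congrArg Complex.re (hconv b)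
  rw [hφb, Complex.ofReal_re, Complex.add_re, Complex.re_ofReal_mul, Complex.re_ofReal_mul] at hre
  have hb₁ := (Complex.re_le_norm _).trans (hle u₁ hu₁n)
  have hb₂ := (Complex.re_le_norm _).trans (hle u₂ hu₂n)
  have hs₁ : 0 < ‖η₁‖ ^ 2 := by positivity
  have hs₂ : 0 < ‖η₂‖ ^ 2 := by positivity
  have harith : ∀ {s t p q B : ℝ}, 0 < s → 0 < t → s + t = 1 → p ≤ B → q ≤ B →
      B = s * p + t * q → p = B := by
    intro s t p q B hs ht hst hp hq h
    refine hp.antisymm (le_of_not_gt fun hlt => ?_)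
    have h1 := mul_pos hs (sub_pos.2 hlt)
    have h2 := mul_nonneg ht.le (sub_nonneg.2 hq)
    have h3 : s * (B - p) + t * (B - q) = 0 := by linear_combination B * hst + h
    linarith
  have hm₁ : (fun x => ⟪u₁, π x u₁⟫_ℂ) ∈ normingStates b :=
    vectorState_mem_normingStates π hu₁n (eq_ofReal_of_norm_le (hle u₁ hu₁n)
      (harith hs₁ hs₂ hsum hb₁ hb₂ hre))
  have hm₂ : (fun x => ⟪u₂, π x u₂⟫_ℂ) ∈ normingStates b :=
    vectorState_mem_normingStates π hu₂n (eq_ofReal_of_norm_le (hle u₂ hu₂n)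
      (harith hs₂ hs₁ (by rw [add_comm, hsum]) hb₂ hb₁ (by rw [add_comm, ← hre])))
  have heq := (hext _ hm₁ _ hm₂ ⟨_, _, hs₁, hs₂, hsum, by
    ext a
    simp only [Pi.add_apply, Pi.smul_apply, Complex.real_smul]
    exact (hconv a).symm⟩).1
  -- By extremality the normalized state of η₁ is φ, so η₁ - ‖η₁‖²ξ is orthogonal to the orbit of
  -- the cyclic vector ξ, hence to η₂. Since η₁ ⊥ η₂, this gives ‖η₁‖²‖η₂‖² = 0.
  have horth : ∀ a, ⟪η₁, π a ξ⟫_ℂ = ((‖η₁‖ ^ 2 : ℝ) : ℂ) * ⟪ξ, π a ξ⟫_ℂ := by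
    intro a
    rw [hstate, ← heq]
    beta_reduce
    rw [hu₁, ← hvec η₁ a hn₁]
    conv_lhs => rw [hξη, map_add, inner_add_right,
      Submodule.inner_right_of_mem_orthogonal hη₁K (hKo' a), add_zero]
  have hzero := hcyc {x | ⟪η₁ - ((‖η₁‖ ^ 2 : ℝ) : ℂ) • ξ, x⟫_ℂ = 0}
    (isClosed_eq (by fun_prop) (by fun_prop)) (fun a => by
      rw [Set.mem_ofPred_eq, inner_sub_left, inner_smul_left, Complex.conj_ofReal, horth, sub_self])
    η₂
  rw [Set.mem_ofPred_eq, hξη, inner_sub_left, inner_smul_left, inner_add_left,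
    Submodule.inner_right_of_mem_orthogonal hη₁K hη₂K, Complex.conj_ofReal, zero_add, zero_sub,
    neg_eq_zero, mul_eq_zero, inner_self_eq_zero] at hzero
  rcases hzero with h | h
  · exact hs₁.ne' (by exact_mod_cast h)
  · exact h₂ h

end PureStates

/-! ### Closed ideals as intersections of primitive ideals. -/

section Prim

variable {A : Type u} [NonUnitalCStarAlgebra A]

/-- The unital case is applied to a⋆a in the unitization. Restriction to A stays irreducible since
scalars preserve every subspace. -/
theorem exists_isIrreducible {a : A} (ha : a ≠ 0) :
    ∃ (H : Type u) (_ : NormedAddCommGroup H) (_ : InnerProductSpace ℂ H) (_ : CompleteSpace H)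
      (π : A →⋆ₙₐ[ℂ] (H →L[ℂ] H)), IsIrreducible π ∧ π a ≠ 0 := by
  let _ := CStarAlgebra.spectralOrder (Unitization ℂ A)
  let _ := CStarAlgebra.spectralOrderedRing (Unitization ℂ A)
  have hb : 0 ≤ ((star a * a : A) : Unitization ℂ A) := by
    rw [Unitization.inr_mul, Unitization.inr_star]
    exact star_mul_self_nonneg _
  have hb0 : ((star a * a : A) : Unitization ℂ A) ≠ 0 := by
    rw [← Unitization.inr_zero ℂ, Ne, (Unitization.inr_injective (R := ℂ)).eq_iff,
      CStarRing.star_mul_self_eq_zero_iff]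
    exact ha
  obtain ⟨H, _, _, _, π, hπb, hπ⟩ := exists_irreducible_unital hb hb0
  have hπa : π (a : Unitization ℂ A) ≠ 0 := by
    intro h
    rw [Unitization.inr_mul, map_mul, h, mul_zero] at hπb
    exact hπb rfl
  refine ⟨H, _, _, _, (π : Unitization ℂ A →⋆ₙₐ[ℂ] (H →L[ℂ] H)).comp
    (Unitization.inrNonUnitalStarAlgHom ℂ A), ⟨fun h => hπa (DFunLike.congr_fun h a), ?_⟩, hπa⟩
  intro K hK hinv
  refine hπ K hK fun w x hx => ?_
  induction w using Unitization.ind with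
  | inl_add_inr r b =>
    rw [map_add, add_apply]
    refine K.add_mem ?_ (hinv b x hx)
    have : (Unitization.inl r : Unitization ℂ A) = algebraMap ℂ _ r := rfl
    rw [this, AlgHomClass.commutes, Algebra.algebraMap_eq_smul_one]
    exact K.smul_mem r hx

theorem IsPrimitiveIdeal.isClosedIdeal {P : Submodule ℂ A} (hP : IsPrimitiveIdeal P) :
    IsClosedIdeal P := by
  refine ⟨?_, fun x hx a => hP.mul_mem hx a⟩
  obtain ⟨H, _, _, _, π, -, hk⟩ := hP
  have : (P : Set A) = {a | π a = 0} := by ext a; exact hk a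
  rw [this]
  exact isClosed_eq (AddMonoidHomClass.continuous_of_bound π 1 fun x => by
    simpa using NonUnitalStarAlgHom.norm_apply_le π x) continuous_const

open IsClosedIdeal.Quotient in
/-- A closed ideal is the kernel of irreducible representations not killing a given element
outside it. -/
theorem IsClosedIdeal.exists_isIrreducible {J : Submodule ℂ A} (hJ : IsClosedIdeal J) {a : A}
    (ha : a ∉ J) :
    ∃ (H : Type u) (_ : NormedAddCommGroup H) (_ : InnerProductSpace ℂ H) (_ : CompleteSpace H)
      (π : A →⋆ₙₐ[ℂ] (H →L[ℂ] H)), IsIrreducible π ∧ (∀ x ∈ J, π x = 0) ∧ π a ≠ 0 := by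
  obtain ⟨H, _, _, _, π, hπ, hπa⟩ :=
    CStarPI.exists_isIrreducible (a := mk hJ a) (by rwa [Ne, mk_eq_zero])
  refine ⟨H, _, _, _, π.comp (mk hJ), ⟨fun h => hπa (DFunLike.congr_fun h a), ?_⟩, ?_, hπa⟩
  · intro K hK hinv
    refine hπ.2 K hK fun w x hx => ?_
    obtain ⟨w, rfl⟩ := mk_surjective w
    exact hinv w x hx
  · intro x hx
    change π (mk hJ x) = 0
    rw [mk_eq_zero.2 hx, map_zero]

/-- Closed ideals are intersections of primitive ideals. -/
theorem IsClosedIdeal.exists_prim {J : Submodule ℂ A} (hJ : IsClosedIdeal J) {a : A}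
    (ha : a ∉ J) : ∃ P : Prim A, J ≤ P.1 ∧ a ∉ P.1 := by
  obtain ⟨H, _, _, _, π, hπ, hπJ, hπa⟩ := hJ.exists_isIrreducible ha
  refine ⟨⟨LinearMap.ker (π : A →ₗ[ℂ] (H →L[ℂ] H)), H, _, _, _, π, hπ, fun a => Iff.rfl⟩, ?_, ?_⟩
  · exact fun x hx => hπJ x hx
  · exact hπa

end Prim

/-! ### Truncations. -/

section Cut

variable {A : Type*} [NonUnitalCStarAlgebra A]

theorem norm_cut_sub_cut_le (d : A) {μ ν : ℝ} (hμ : 0 ≤ μ) (hν : 0 ≤ ν) :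
    ‖cut d μ - cut d ν‖ ≤ |μ - ν| := by
  rw [cut, cut, ← cfcₙ_sub (fun t : ℝ => max (t - μ) 0) (fun t : ℝ => max (t - ν) 0) d
    (by fun_prop) (max_eq_right (by linarith)) (by fun_prop) (max_eq_right (by linarith))]
  refine norm_cfcₙ_le fun t _ => ?_
  rw [Real.norm_eq_abs]
  refine (abs_max_sub_max_le_abs _ _ _).trans_eq ?_
  rw [abs_sub_comm μ ν]
  congr 1
  ring

variable [PartialOrder A] [StarOrderedRing A]

/-- d - (d - μ)₊ is min(d, μ), which equals μ where (d - μ)₊ does not vanish. For μ > 0, dividing by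
μ gives a unit for (d - μ)₊. -/
theorem sub_cut_mul_cut {d : A} (hd : 0 ≤ d) {μ : ℝ} (hμ : 0 ≤ μ) :
    (d - cut d μ) * cut d μ = μ • cut d μ := by
  have h0 : max (0 - μ) 0 = 0 := max_eq_right (by linarith)
  have h1 : d - cut d μ = cfcₙ (fun t : ℝ => t - max (t - μ) 0) d := by
    rw [cfcₙ_sub (fun t : ℝ => t) (fun t => max (t - μ) 0) d (by fun_prop) rfl (by fun_prop) h0,
      cfcₙ_id' ℝ d hd.isSelfAdjoint, cut]
  rw [h1, cut, ← cfcₙ_mul (fun t : ℝ => t - max (t - μ) 0) (fun t => max (t - μ) 0) d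
    (by fun_prop) (by simp [hμ]) (by fun_prop) h0, ← cfcₙ_smul μ (fun t : ℝ => max (t - μ) 0) d
    (by fun_prop) h0]
  refine cfcₙ_congr fun t _ => ?_
  rcases max_cases (t - μ) 0 with h | h <;> simp only [h.1, smul_eq_mul] <;> ring

theorem cut_zero {d : A} (hd : 0 ≤ d) : cut d 0 = d := by
  have := norm_sub_cut_le hd le_rfl
  rw [norm_le_zero_iff, sub_eq_zero] at this
  exact this.symm

theorem cut_eq_zero {d : A} (hd : 0 ≤ d) {μ : ℝ} (hμ : ‖d‖ ≤ μ) : cut d μ = 0 := by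
  rw [cut, ← cfcₙ_zero ℝ d]
  refine cfcₙ_congr fun t ht => max_eq_right ?_
  have := NonUnitalIsometricContinuousFunctionalCalculus.norm_quasispectrum_le d ht
    hd.isSelfAdjoint
  rw [Real.norm_eq_abs] at this
  have := le_abs_self t
  linarith

theorem mem_of_cut_mem {d : A} (hd : 0 ≤ d) {S : Set A} (hS : IsClosed S)
    (h : ∀ δ : ℝ, 0 < δ → cut d δ ∈ S) : d ∈ S :=
  closed_of_forall_norm_lt hS fun ε hε => ⟨cut d (ε / 2), h _ (half_pos hε), by
    rw [norm_sub_rev]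
    exact (norm_sub_cut_le hd (half_pos hε).le).trans_lt (half_lt_self hε)⟩

end Cut

/-! ### Rigidity of irreducible representations. -/

section Irreducible

variable {A : Type u} [NonUnitalCStarAlgebra A]

/-- An operator that acts as the identity on the range of a nonzero operator, even after applying
an irreducible representation, is the identity. -/
theorem IsIrreducible.eq_one {H : Type*} [NormedAddCommGroup H] [InnerProductSpace ℂ H]
    [CompleteSpace H] {π : A →⋆ₙₐ[ℂ] (H →L[ℂ] H)} (hπ : IsIrreducible π) {S T : H →L[ℂ] H}
    (hS : S ≠ 0) (h : ∀ y, T * π y * S = π y * S) : T = 1 := by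
  -- K is closed, invariant and contains the range of S ≠ 0, so K = H. Then the fixed space of T
  -- contains π(A)H and is itself invariant and nonzero.
  let K : Submodule ℂ H := ⨅ y : A, LinearMap.ker (T * π y - π y : H →L[ℂ] H).toLinearMap
  have memK : ∀ w, w ∈ K ↔ ∀ y, T (π y w) = π y w := by
    intro w; simp [K, Submodule.mem_iInf, sub_eq_zero]
  have hKc : IsClosed (K : Set H) := by
    have : (K : Set H) = ⋂ y : A, {w | T (π y w) = π y w} := by ext w; simp [memK]
    rw [this]
    exact isClosed_iInter fun y =>
      isClosed_eq (T.continuous.comp (π y).continuous) (π y).continuous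
  have hK : K = ⊤ := by
    refine (hπ.2 K hKc fun y w hw => ?_).resolve_left fun hbot => hS ?_
    · rw [memK] at hw ⊢
      intro z
      have := hw (z * y)
      rwa [map_mul] at this
    · ext w
      have : S w ∈ K := (memK _).2 fun y => DFunLike.congr_fun (h y) w
      rw [hbot] at this
      simpa using this
  have hT : ∀ y w, T (π y w) = π y w := fun y w => (memK w).1 (hK ▸ Submodule.mem_top) y
  let L : Submodule ℂ H := LinearMap.ker (T - 1 : H →L[ℂ] H).toLinearMap
  have memL : ∀ w, w ∈ L ↔ T w = w := by intro w; simp [L, sub_eq_zero]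
  have hL : L = ⊤ := by
    refine (hπ.2 L ?_ fun y w _ => (memL _).2 (hT y w)).resolve_left fun hbot => hπ.1 ?_
    · have : (L : Set H) = {w | T w = w} := by ext w; exact memL w
      rw [this]
      exact isClosed_eq T.continuous continuous_id
    · ext y w
      have : π y w ∈ L := (memL _).2 (hT y w)
      rw [hbot] at this
      simpa using this
  ext w
  exact (memL w).1 (hL ▸ Submodule.mem_top)

end Irreducible

/-! ### Absorption of square-zero elements. -/

section SquareZero

variable {A : Type u} [NonUnitalCStarAlgebra A] [PartialOrder A] [StarOrderedRing A]

/-- In a purely infinite C⋆-algebra, a positive element absorbs the elements of square zero of the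
ideal that it generates. -/
theorem IsPurelyInfinite.mem_absorbedIdeal_of_mul_self_eq_zero (hA : IsPurelyInfinite A) {a n : A}
    (ha : 0 ≤ a) (hn : n * n = 0) (hna : n ∈ closedIdealSpan {a}) : n ∈ absorbedIdeal a ha := by
  rw [mem_absorbedIdeal]
  have hb₁ : 0 ≤ star n * n := star_mul_self_nonneg n
  refine mem_of_cut_mem (S := {c | PairLE a c a}) hb₁
    (isClosed_closure.preimage (by fun_prop : Continuous fun c : A => (a, c, (0 : A)))) ?_
  intro δ hδ
  obtain ⟨c, hc⟩ : ∃ c, c = cut (star n * n) δ := ⟨_, rfl⟩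
  obtain ⟨h, hh⟩ : ∃ h, h = δ⁻¹ • (star n * n - c) := ⟨_, rfl⟩
  have hc0 : 0 ≤ c := hc ▸ cut_nonneg _ _
  have hcs := hc0.isSelfAdjoint.star_eq
  have hhs : star h = h := by
    rw [hh, star_smul, star_trivial, star_sub, hcs, hb₁.isSelfAdjoint.star_eq]
  have hhc : h * c = c := by
    rw [hh, smul_mul_assoc, hc, sub_cut_mul_cut hb₁ hδ.le, smul_smul, inv_mul_cancel₀ hδ.ne',
      one_smul]
  have hch : c * h = c := by
    have := congrArg star hhc
    rwa [star_mul, hcs, hhs] at this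
  have hnsn : star n * star n = 0 := by rw [← star_mul, hn, star_zero]
  -- n n⋆ annihilates n⋆n because n⋆n⋆ = 0, hence also every function of n⋆n.
  have hdc : n * star n * c = 0 := by
    let R : Submodule ℂ A := LinearMap.ker (LinearMap.mulLeft ℂ (n * star n))
    have hRcl : IsClosed (R : Set A) := isClosed_eq
      (show Continuous fun x => n * star n * x by fun_prop) continuous_const
    have hmem : c ∈ R := by
      rw [hc]
      refine cfcₙ_mem_rightIdeal (fun x hx y => ?_) hRcl hb₁.isSelfAdjoint ?_ _
      · change n * star n * (x * y) = 0
        rw [← mul_assoc, show n * star n * x = 0 from hx, zero_mul]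
      · change n * star n * (star n * n) = 0
        rw [mul_assoc, ← mul_assoc (star n), hnsn, zero_mul, mul_zero]
    exact hmem
  -- b = nn⋆ + (1 - h)a(1 - h) is orthogonal to c, yet its ideal contains a: nn⋆ recovers n, then h,
  -- then a. Hence a ≾ b³ and c ≾ c³, while b³ ⊕ c³ ≾ b + c ≾ a. Cubes appear because conjugating b
  -- + c by b gives b³.
  obtain ⟨b, hb⟩ : ∃ b, b = n * star n + (a - h * a - a * h + h * a * h) := ⟨_, rfl⟩
  have hd0 : 0 ≤ n * star n := mul_star_self_nonneg n
  have he0 : 0 ≤ a - h * a - a * h + h * a * h := by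
    have := sub_conj_mono ha (show IsSelfAdjoint h from hhs)
    simpa using this
  have hb0 : 0 ≤ b := hb ▸ add_nonneg hd0 he0
  have hbs := hb0.isSelfAdjoint.star_eq
  have hbc : b * c = 0 := by
    rw [hb, add_mul, hdc, add_mul, sub_mul, sub_mul, mul_assoc a h c, mul_assoc (h * a) h c, hhc]
    abel
  have hcb : c * b = 0 := by
    have := congrArg star hbc
    rwa [star_mul, hcs, hbs, star_zero] at this
  have hmem : ∀ {I : Submodule ℂ A}, IsClosedIdeal I → ∀ {x : A}, 0 ≤ x → x * x * x ∈ I → x ∈ I := by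
    intro I hI x hx h
    have hxs := hx.isSelfAdjoint.star_eq
    refine hI.mem_of_star_mul_mem (hxs.symm ▸ hI.mem_of_star_mul_mem ?_)
    rw [star_mul, hxs, mul_assoc]
    simpa only [mul_assoc] using hI.mul_left h x
  have hb₃ : 0 ≤ b * b * b := by simpa [hbs] using star_left_conjugate_nonneg hb0 b
  have hc₃ : 0 ≤ c * c * c := by simpa [hcs] using star_left_conjugate_nonneg hc0 c
  have hab : CuntzLE a (b * b * b) := by
    refine (hA.2 a _ ha hb₃).1 ?_
    have hI := isClosedIdeal_closedIdealSpan {b * b * b}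
    have hbI : b ∈ closedIdealSpan {b * b * b} := hmem hI hb0 (mem_closedIdealSpan_singleton _)
    have hdI := hI.mem_of_le hd0 (hb ▸ le_add_of_nonneg_right he0) hbI
    have heI := hI.mem_of_le he0 (hb ▸ le_add_of_nonneg_left hd0) hbI
    have hnI := hI.mem_of_mul_star_mem hdI
    have hhI : h ∈ closedIdealSpan {b * b * b} := by
      rw [hh, hc, ← Complex.coe_smul]
      exact Submodule.smul_mem _ _ (Submodule.sub_mem _ (hI.mul_left hnI _)
        (hI.cfcₙ_mem hb₁.isSelfAdjoint (hI.mul_left hnI _) _))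
    have := Submodule.add_mem _ heI (Submodule.sub_mem _ (Submodule.add_mem _ (hI.mul_right hhI a)
      (hI.mul_left hhI a)) (hI.mul_left hhI (h * a)))
    convert this using 1
    abel
  have hcc : CuntzLE c (c * c * c) :=
    (hA.2 c _ hc0 hc₃).1 (hmem (isClosedIdeal_closedIdealSpan _) hc0 (mem_closedIdealSpan_singleton _))
  have hbca : CuntzLE (b + c) a := by
    refine (hA.2 _ _ (add_nonneg hb0 hc0) ha).1 ?_
    have hI := isClosedIdeal_closedIdealSpan {a}
    have haI : a ∈ closedIdealSpan {a} := mem_closedIdealSpan_singleton a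
    refine Submodule.add_mem _ ?_ ?_
    · rw [hb]
      exact Submodule.add_mem _ (hI.mul_right hna _) (Submodule.add_mem _ (Submodule.sub_mem _
        (Submodule.sub_mem _ haI (hI.mul_left haI _)) (hI.mul_right haI _))
        (hI.mul_right (hI.mul_left haI _) _))
    · rw [hc]
      exact hI.cfcₙ_mem hb₁.isSelfAdjoint (hI.mul_left hna _) _
  have hpair : PairLE (b * b * b) (c * c * c) (b + c) := by
    have := pairLE_of_eq (b := b + c) (y := b) (z := c) (by
      rw [hbs, mul_add, hbc, add_zero, mul_assoc, hbc, mul_zero])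
    rw [hbs, hcs, mul_add, hbc, add_zero, mul_add, hcb, zero_add] at this
    exact this
  rw [← hc]
  exact (hpair.trans hbca).mono hab hcc

end SquareZero

/-! ### Purely infinite algebras are self-absorbing. -/

section Absorption

variable {A : Type u} [NonUnitalCStarAlgebra A] [PartialOrder A] [StarOrderedRing A]

/-- An irreducible representation killing the elements of square zero in a closed ideal maps the
positive elements of this ideal to scalars. -/
theorem IsIrreducible.exists_eq_smul_one {H : Type*} [NormedAddCommGroup H] [InnerProductSpace ℂ H]
    [CompleteSpace H] {π : A →⋆ₙₐ[ℂ] (H →L[ℂ] H)} (hπ : IsIrreducible π) {I : Submodule ℂ A}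
    (hI : IsClosedIdeal I) (hsq : ∀ n ∈ I, n * n = 0 → π n = 0) {c : A} (hc : 0 ≤ c) (hcI : c ∈ I) :
    ∃ r : ℝ, π c = (r : ℂ) • (1 : H →L[ℂ] H) := by
  have hle : ∀ x, ‖π x‖ ≤ ‖x‖ := NonUnitalStarAlgHom.norm_apply_le π
  have hcont : ContinuousOn (fun μ => π (cut c μ)) (Set.Ici 0) := by
    rw [Metric.continuousOn_iff]
    intro μ hμ ε hε
    refine ⟨ε, hε, fun ν hν hd => ?_⟩
    rw [dist_eq_norm, ← map_sub]
    exact ((hle _).trans (norm_cut_sub_cut_le c hν hμ)).trans_lt hd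
  -- either the spectrum of `π c` lies below `μ` or it lies above
  have hdich : ∀ μ : ℝ, 0 < μ → π (cut c μ) ≠ 0 → π c - π (cut c μ) = (μ : ℂ) • 1 := by
    intro μ hμ h0
    obtain ⟨g, hg⟩ : ∃ g, g = cut c μ := ⟨_, rfl⟩
    rw [← hg] at h0 ⊢
    obtain ⟨f, hf⟩ : ∃ f, f = μ⁻¹ • (c - g) := ⟨_, rfl⟩
    have hfg : f * g = g := by
      rw [hf, smul_mul_assoc, hg, sub_cut_mul_cut hc hμ.le, smul_smul, inv_mul_cancel₀ hμ.ne',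
        one_smul]
    have hgs : star g = g := by rw [hg]; exact (cut_nonneg c μ).isSelfAdjoint.star_eq
    have hfs : star f = f := by
      rw [hf, star_smul, star_trivial, star_sub, hgs, hc.isSelfAdjoint.star_eq]
    have hgf : g * f = g := by
      have := congrArg star hfg
      rwa [star_mul, hgs, hfs] at this
    have hgI : g ∈ I := hg ▸ hI.cfcₙ_mem hc.isSelfAdjoint hcI _
    have h1 : π f = 1 := by
      refine hπ.eq_one h0 fun y => ?_
      rw [← map_mul, ← map_mul, ← map_mul, eq_comm, ← sub_eq_zero, ← map_sub]
      -- (1 - f)yg has square zero because g(1 - f) = 0; so π(f) acts as the identity on the ranges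
      -- of all π(y)π(g).
      refine hsq _ (Submodule.sub_mem _ (hI.mul_left hgI _) (hI.mul_left hgI _)) ?_
      have : (y * g - f * y * g) * (y * g - f * y * g)
          = y * (g - g * f) * y * g - f * y * (g - g * f) * y * g := by noncomm_ring
      rw [this, hgf]
      simp
    rw [← map_sub, ← h1, ← map_smul, hf, Complex.coe_smul, smul_smul, mul_inv_cancel₀ hμ.ne',
      one_smul]
  -- With m = inf S, the dichotomy holds for every 0 < μ < m; letting μ tend to m gives π(c) = m.
  obtain ⟨S, hS⟩ : ∃ S, S = {μ : ℝ | 0 ≤ μ ∧ π (cut c μ) = 0} := ⟨_, rfl⟩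
  have hScl : IsClosed S := by
    have : S = Set.Ici 0 ∩ (fun μ => π (cut c μ)) ⁻¹' {0} := by rw [hS]; rfl
    rw [this]
    exact hcont.preimage_isClosed_of_isClosed isClosed_Ici isClosed_singleton
  have hSb : BddBelow S := ⟨0, fun μ hμ => by rw [hS] at hμ; exact hμ.1⟩
  have hSm := hScl.csInf_mem ⟨‖c‖, by rw [hS]; exact ⟨norm_nonneg c, by rw [cut_eq_zero hc le_rfl, map_zero]⟩⟩
    hSb
  obtain ⟨m, hm⟩ : ∃ m, m = sInf S := ⟨_, rfl⟩
  have hlt : ∀ μ, μ < m → μ ∉ S := fun μ hμ h => (csInf_le hSb h).not_gt (hm ▸ hμ)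
  rw [← hm] at hSm
  rw [hS] at hSm hlt
  refine ⟨m, ?_⟩
  rcases hSm.1.eq_or_lt with h0 | h0
  · have := hSm.2
    rw [← h0, cut_zero hc] at this
    rw [this, ← h0, Complex.ofReal_zero, zero_smul]
  · refine sub_eq_zero.1 (norm_eq_zero.1 (le_antisymm (le_of_forall_pos_le_add fun ε hε => ?_)
      (norm_nonneg _)))
    obtain ⟨μ, hμ0, hμm, hμε⟩ : ∃ μ, 0 < μ ∧ μ < m ∧ m - μ ≤ ε / 2 :=
      ⟨max (m / 2) (m - ε / 2), lt_max_of_lt_left (by linarith),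
        max_lt (by linarith) (by linarith), by linarith [le_max_right (m / 2) (m - ε / 2)]⟩
    have h1 := hdich μ hμ0 fun h => hlt μ hμm ⟨hμ0.le, h⟩
    have h2 : π c - (m : ℂ) • 1 = π (cut c μ - cut c m) - ((m - μ : ℝ) : ℂ) • (1 : H →L[ℂ] H) := by
      rw [map_sub, hSm.2, sub_zero, Complex.ofReal_sub, sub_smul, ← h1]
      abel
    rw [h2, zero_add]
    refine (norm_sub_le _ _).trans ?_
    have h3 := (hle _).trans (norm_cut_sub_cut_le c hμ0.le h0.le)
    rw [abs_sub_comm, abs_of_pos (sub_pos.2 hμm)] at h3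
    have h4 : ‖((m - μ : ℝ) : ℂ) • (1 : H →L[ℂ] H)‖ ≤ m - μ := by
      rw [norm_smul, Complex.norm_real, Real.norm_eq_abs, abs_of_pos (sub_pos.2 hμm)]
      exact mul_le_of_le_one_right (sub_pos.2 hμm).le ContinuousLinearMap.norm_id_le
    linarith

/-- Every positive element of a purely infinite C⋆-algebra is properly infinite. -/
theorem IsPurelyInfinite.mem_absorbedIdeal (hA : IsPurelyInfinite A) {a : A} (ha : 0 ≤ a) :
    a ∈ absorbedIdeal a ha := by
  by_contra hna
  obtain ⟨H, _, _, _, π, hπ, hπJ, hπa⟩ :=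
    (isClosedIdeal_absorbedIdeal ha).exists_isIrreducible hna
  have hI := isClosedIdeal_closedIdealSpan {a}
  have haI : a ∈ closedIdealSpan {a} := mem_closedIdealSpan_singleton a
  have hpos : ∀ c, 0 ≤ c → c ∈ closedIdealSpan {a} → ∃ z : ℂ, π c = z • (1 : H →L[ℂ] H) := by
    intro c hc hcI
    obtain ⟨r, hr⟩ := hπ.exists_eq_smul_one hI
      (fun n hn hnn => hπJ n (hA.mem_absorbedIdeal_of_mul_self_eq_zero ha hnn hn)) hc hcI
    exact ⟨r, hr⟩
  obtain ⟨m, hm⟩ := hpos a ha haI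
  have hm0 : m ≠ 0 := by
    rintro rfl
    rw [zero_smul] at hm
    exact hπa hm
  have hnt : Nontrivial H := by
    by_contra h
    rw [not_nontrivial_iff_subsingleton] at h
    exact hπa (by ext w; exact Subsingleton.elim _ _)
  obtain ⟨s, hs, hsa⟩ := exists_sqrt ha
  have hss := hs.isSelfAdjoint.star_eq
  have hsI : s ∈ closedIdealSpan {a} := hI.mem_of_mul_star_mem (by rwa [hss, hsa])
  -- ya = u⋆s with u, s in the ideal of a, and polarization expresses it by positive elements of
  -- that ideal, which act as scalars. Dividing by the nonzero scalar π(a) = m leaves π(y).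
  have hscal : ∀ y, ∃ z : ℂ, π y = z • (1 : H →L[ℂ] H) := by
    intro y
    obtain ⟨u, hu⟩ : ∃ u, u = s * star y := ⟨_, rfl⟩
    have huI : u ∈ closedIdealSpan {a} := hu ▸ hI.mul_right hsI _
    have hmem : ∀ z : ℂ, u + z • s ∈ closedIdealSpan {a} := fun z =>
      Submodule.add_mem _ huI (Submodule.smul_mem _ _ hsI)
    have hsq : ∀ z : ℂ, ∃ w : ℂ, π (star (u + z • s) * (u + z • s)) = w • (1 : H →L[ℂ] H) :=
      fun z => hpos _ (star_mul_self_nonneg _) (hI.mul_left (hmem z) _)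
    obtain ⟨w₁, h₁⟩ := hsq 1
    obtain ⟨w₂, h₂⟩ := hsq (-1)
    obtain ⟨w₃, h₃⟩ := hsq Complex.I
    obtain ⟨w₄, h₄⟩ := hsq (-Complex.I)
    have hpol : star u * s = (1 / 4 : ℂ) • (star (u + (1 : ℂ) • s) * (u + (1 : ℂ) • s)
        - star (u + (-1 : ℂ) • s) * (u + (-1 : ℂ) • s)
        - Complex.I • (star (u + Complex.I • s) * (u + Complex.I • s))
        + Complex.I • (star (u + (-Complex.I) • s) * (u + (-Complex.I) • s))) := by
      simp only [star_add, star_smul, add_mul, mul_add, smul_mul_assoc, mul_smul_comm, hss, smul_add,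
        smul_sub, smul_smul, star_one, star_neg, Complex.star_def, Complex.conj_I]
      match_scalars <;> ring_nf <;> simp only [Complex.I_sq] <;> norm_num
    have hya : y * a = star u * s := by
      rw [hu, star_mul, star_star, hss, mul_assoc, hsa]
    refine ⟨m⁻¹ * (1 / 4 * (w₁ - w₂ - Complex.I * w₃ + Complex.I * w₄)), ?_⟩
    have h5 : π (y * a) = m • π y := by
      rw [map_mul, hm, mul_smul_comm, mul_one]
    have h6 : π (y * a) = (1 / 4 * (w₁ - w₂ - Complex.I * w₃ + Complex.I * w₄)) • 1 := by
      rw [hya, hpol, map_smul, map_add, map_sub, map_sub, map_smul, map_smul, h₁, h₂, h₃, h₄]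
      simp only [smul_smul, ← sub_smul, ← add_smul]
    rw [mul_smul, ← h6, h5, smul_smul, inv_mul_cancel₀ hm0, one_smul]
  choose χ hχ using hscal
  have hinj : ∀ {z w : ℂ}, z • (1 : H →L[ℂ] H) = w • 1 → z = w := fun h =>
    smul_left_injective ℂ (one_ne_zero : (1 : H →L[ℂ] H) ≠ 0) h
  let L : A →ₗ[ℂ] ℂ :=
    { toFun := χ
      map_add' := fun x y => hinj (by rw [← hχ, map_add, hχ x, hχ y, add_smul])
      map_smul' := fun z x => hinj (by rw [← hχ, map_smul, hχ x, smul_smul]; rfl) }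
  let φ : WeakDual ℂ A := StrongDual.toWeakDual (L.mkContinuous 1 fun x => by
    have := NonUnitalStarAlgHom.norm_apply_le π x
    rw [hχ x, norm_smul, norm_one, mul_one] at this
    rw [one_mul]
    exact this)
  refine hA.1.false ⟨φ, fun h0 => hπa ?_, fun x y => ?_⟩
  · have : χ a = 0 := DFunLike.congr_fun h0 a
    rw [hχ, this, zero_smul]
  · exact hinj (by
      change χ (x * y) • _ = (χ x * χ y) • _
      rw [← hχ, map_mul, hχ x, hχ y, smul_mul_smul_comm, one_mul])

end Absorption

/-! ### Finite generation, truncations in quotients and self-absorption. -/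

section Approximation

variable {A : Type u} [NonUnitalCStarAlgebra A]

/-- The closed ideal generated by a set is the closure of the union of the closed ideals generated
by its finite subsets. -/
theorem exists_finset_of_mem_closedIdealSpan {S : Set A} {x : A} (hx : x ∈ closedIdealSpan S)
    {ε : ℝ} (hε : 0 < ε) : ∃ F : Finset A, (F : Set A) ⊆ S ∧
      ∃ y ∈ closedIdealSpan (F : Set A), ‖x - y‖ < ε := by
  classical
  let N : Submodule ℂ A :=
    { carrier := {x | ∃ F : Finset A, (F : Set A) ⊆ S ∧ x ∈ closedIdealSpan (F : Set A)}
      zero_mem' := ⟨∅, by simp, Submodule.zero_mem _⟩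
      add_mem' := by
        rintro x y ⟨F, hF, hx⟩ ⟨G, hG, hy⟩
        refine ⟨F ∪ G, by simp [hF, hG], Submodule.add_mem _ ?_ ?_⟩
        · exact closedIdealSpan_mono (by simp) hx
        · exact closedIdealSpan_mono (by simp) hy
      smul_mem' := by
        rintro c x ⟨F, hF, hx⟩
        exact ⟨F, hF, Submodule.smul_mem _ c hx⟩ }
  have hN : IsClosedIdeal N.topologicalClosure := by
    refine ⟨N.isClosed_topologicalClosure, fun x hx a => ⟨?_, ?_⟩⟩
    · refine map_mem_closure (f := fun t => a * t) (by fun_prop) hx ?_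
      rintro t ⟨F, hF, ht⟩
      exact ⟨F, hF, (isClosedIdeal_closedIdealSpan _).mul_left ht a⟩
    · refine map_mem_closure (f := fun t => t * a) (by fun_prop) hx ?_
      rintro t ⟨F, hF, ht⟩
      exact ⟨F, hF, (isClosedIdeal_closedIdealSpan _).mul_right ht a⟩
  have hle : closedIdealSpan S ≤ N.topologicalClosure :=
    closedIdealSpan_le hN fun s hs => N.le_topologicalClosure
      ⟨{s}, by simpa using hs, by simpa using mem_closedIdealSpan_singleton s⟩
  obtain ⟨y, ⟨F, hF, hy⟩, hxy⟩ := Metric.mem_closure_iff.1 (hle hx) ε hε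
  exact ⟨F, hF, y, hy, by rwa [dist_eq_norm] at hxy⟩

open IsClosedIdeal.Quotient in
/-- A projection in the closed ideal generated by a set lies in the closed ideal generated by a
finite subset. -/
theorem exists_finset_of_isStarProjection_mem {S : Set A} {p : A} (hp : IsStarProjection p)
    (hpS : p ∈ closedIdealSpan S) :
    ∃ F : Finset A, (F : Set A) ⊆ S ∧ p ∈ closedIdealSpan (F : Set A) := by
  obtain ⟨F, hF, y, hy, h⟩ := exists_finset_of_mem_closedIdealSpan hpS one_pos
  refine ⟨F, hF, (isClosedIdeal_closedIdealSpan _).mem_of_norm_mk_projection_lt hp ?_⟩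
  refine lt_of_le_of_lt ?_ h
  rw [← sub_zero (mk _ p), ← mk_eq_zero.2 hy, ← map_sub]
  exact norm_mk_le _

theorem map_cut {B : Type*} [NonUnitalCStarAlgebra B] (π : A →⋆ₙₐ[ℂ] B) {d : A}
    (hd : IsSelfAdjoint d) {α : ℝ} (hα : 0 ≤ α) : π (cut d α) = cut (π d) α :=
  NonUnitalStarAlgHomClass.map_cfcₙ (R := ℝ) (S := ℂ) π (fun t : ℝ => max (t - α) 0) d
    (by fun_prop) (max_eq_right (by linarith)) (AddMonoidHomClass.continuous_of_bound π 1 fun x => by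
      simpa using NonUnitalStarAlgHom.norm_apply_le π x) hd (hd.map π)

variable [PartialOrder A] [StarOrderedRing A]

theorem starHom_nonneg {B : Type*} [NonUnitalCStarAlgebra B] [PartialOrder B] [StarOrderedRing B]
    (π : A →⋆ₙₐ[ℂ] B) {d : A} (hd : 0 ≤ d) : 0 ≤ π d := by
  obtain ⟨s, hs, rfl⟩ := exists_sqrt hd
  rw [map_mul]
  exact (hs.isSelfAdjoint.map π).mul_self_nonneg

-- Homomorphisms commute with truncation. This converts membership in an ideal into a norm estimate
-- in the quotient, and back.
open IsClosedIdeal.Quotient in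
theorem IsClosedIdeal.cut_mem_iff {I : Submodule ℂ A} (hI : IsClosedIdeal I) {d : A} (hd : 0 ≤ d)
    {α : ℝ} (hα : 0 ≤ α) : cut d α ∈ I ↔ ‖mk hI d‖ ≤ α := by
  constructor
  · intro h
    rw [← sub_zero (mk hI d), ← mk_eq_zero.2 h, ← map_sub]
    exact (norm_mk_le _).trans (norm_sub_cut_le hd hα)
  · intro h
    rw [← mk_eq_zero (hI := hI), map_cut _ hd.isSelfAdjoint hα]
    exact cut_eq_zero (starHom_nonneg (mk hI) hd) h

/-- Every positive element is properly infinite: it absorbs itself. -/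
def IsSelfAbsorbing (A : Type u) [NonUnitalCStarAlgebra A] [PartialOrder A] [StarOrderedRing A] :
    Prop :=
  ∀ (x : A) (hx : 0 ≤ x), x ∈ absorbedIdeal x hx

theorem IsSelfAbsorbing.pairLE (hA : IsSelfAbsorbing A) {x : A} (hx : 0 ≤ x) : PairLE x x x :=
  pairLE_of_mem_absorbedIdeal hx hx (hA x hx)

theorem IsSelfAbsorbing.mem_closedIdealSpan_iff (hA : IsSelfAbsorbing A) {a b : A} (ha : 0 ≤ a)
    (hb : 0 ≤ b) : a ∈ closedIdealSpan {b} ↔ CuntzLE a b :=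
  ⟨cuntzLE_of_mem_closedIdealSpan hb ha (hA b hb), fun h =>
    h.mem_closedIdeal (isClosedIdeal_closedIdealSpan _) (mem_closedIdealSpan_singleton b)⟩

/-- A character turns Gram data into a scalar 2×2 matrix of determinant zero. If it did not vanish
at a selfadjoint s, absorption of s² by itself would make that matrix close to φ(s²) times the
identity. -/
theorem IsSelfAbsorbing.isEmpty_characterSpace (hA : IsSelfAbsorbing A) :
    IsEmpty (WeakDual.characterSpace ℂ A) := by
  refine ⟨fun ⟨φ, hφ0, hmul⟩ => hφ0 ?_⟩
  have hsa : ∀ s : A, IsSelfAdjoint s → φ s = 0 := by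
    intro s hs
    by_contra h0
    obtain ⟨k, hk⟩ : ∃ k, k = φ (s * s) := ⟨_, rfl⟩
    have hk0 : 0 < ‖k‖ := by
      rw [hk, hmul, norm_pos_iff]
      exact mul_ne_zero h0 h0
    obtain ⟨C, hC, hCb⟩ : ∃ C : ℝ, 0 < C ∧ ∀ x, ‖φ x‖ ≤ C * ‖x‖ := by
      refine ⟨‖WeakDual.toStrongDual φ‖ + 1, by positivity, fun x => ?_⟩
      exact (ContinuousLinearMap.le_opNorm (WeakDual.toStrongDual φ) x).trans
        (by gcongr; exact le_add_of_nonneg_right zero_le_one)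
    have hpos : 0 ≤ s * s := hs.mul_self_nonneg
    obtain ⟨y, z, hy, hz, hyz⟩ := pairLE_iff.1 (hA.pairLE hpos) (‖k‖ / (2 * C)) (by positivity)
    have hb : ∀ w : A, ‖w‖ < ‖k‖ / (2 * C) → ‖φ w‖ < ‖k‖ / 2 := by
      intro w hw
      refine (hCb w).trans_lt ?_
      calc C * ‖w‖ < C * (‖k‖ / (2 * C)) := by gcongr
        _ = _ := by field_simp
    have hy' := hb _ hy
    have hz' := hb _ hz
    have hyz' := hb _ hyz
    have hzy' : ‖φ (star z * (s * s) * y)‖ < ‖k‖ / 2 := by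
      refine hb _ ?_
      rw [← norm_star]
      simpa [mul_assoc, hs.star_eq] using hyz
    have hlow : ∀ w : A, ‖φ (w - s * s)‖ < ‖k‖ / 2 → ‖k‖ / 2 < ‖φ w‖ := by
      intro w hw
      rw [map_sub, ← hk] at hw
      have := norm_sub_norm_le k (φ w)
      rw [norm_sub_rev] at hw
      linarith
    have h1 := mul_lt_mul'' (hlow _ hy') (hlow _ hz') (by positivity) (by positivity)
    have h2 := mul_lt_mul'' hyz' hzy' (norm_nonneg _) (norm_nonneg _)
    have h3 : φ (star y * (s * s) * y) * φ (star z * (s * s) * z)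
        = φ (star y * (s * s) * z) * φ (star z * (s * s) * y) := by
      simp only [hmul]
      ring
    rw [← norm_mul, h3] at h1
    rw [← norm_mul] at h2
    linarith
  refine DFunLike.ext _ _ fun u => ?_
  have h1 := hsa _ (IsSelfAdjoint.add_star_self u)
  have h2 := hsa (Complex.I • (u - star u)) (by
    rw [IsSelfAdjoint, star_smul, star_sub, star_star, Complex.star_def, Complex.conj_I, neg_smul,
      ← smul_neg, neg_sub])
  rw [map_smul, smul_eq_mul, mul_eq_zero, or_iff_right Complex.I_ne_zero, map_sub] at h2
  rw [map_add] at h1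
  change φ u = 0
  linear_combination (h1 + h2) / 2

theorem IsSelfAbsorbing.isPurelyInfinite (hA : IsSelfAbsorbing A) : IsPurelyInfinite A :=
  ⟨hA.isEmpty_characterSpace, fun _ _ ha hb => hA.mem_closedIdealSpan_iff ha hb⟩

theorem IsPurelyInfinite.isSelfAbsorbing (hA : IsPurelyInfinite A) : IsSelfAbsorbing A :=
  fun _ hx => hA.mem_absorbedIdeal hx

end Approximation

/-! ### Projections and ideals in subalgebras. -/

section Subalgebra

variable {A : Type u} [NonUnitalCStarAlgebra A]

theorem IsSubprojection.isStarProjection_sub {R : Type*} [NonUnitalRing R] [StarRing R] {p q : R}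
    (hq : IsSubprojection q p) (hp : IsStarProjection p) : IsStarProjection (p - q) :=
  hq.1.sub_of_mul_eq_right hp hq.2

theorem IsSubprojection.coe {B : NonUnitalStarSubalgebra ℂ A} {p q : B}
    (hq : IsSubprojection q p) : IsSubprojection (q : A) p :=
  ⟨⟨congrArg Subtype.val hq.1.isIdempotentElem.eq, congrArg Subtype.val hq.1.isSelfAdjoint.star_eq⟩,
    congrArg Subtype.val hq.2⟩

theorem isStarProjection_coe_iff {B : NonUnitalStarSubalgebra ℂ A} {p : B} :
    IsStarProjection (p : A) ↔ IsStarProjection p :=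
  ⟨fun h => ⟨Subtype.ext h.isIdempotentElem.eq, Subtype.ext h.isSelfAdjoint.star_eq⟩,
    fun h => ⟨congrArg Subtype.val h.isIdempotentElem.eq,
      congrArg Subtype.val h.isSelfAdjoint.star_eq⟩⟩

theorem IsClosedIdeal.comap_subtype {J : Submodule ℂ A} (hJ : IsClosedIdeal J)
    (B : NonUnitalStarSubalgebra ℂ A) : IsClosedIdeal (J.comap (NonUnitalSubalgebraClass.subtype B : B →ₗ[ℂ] A)) :=
  ⟨hJ.1.preimage continuous_subtype_val, fun _ hx _ => ⟨hJ.mul_left hx _, hJ.mul_right hx _⟩⟩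

/-- A closed ideal contains a subalgebra as soon as it contains generators of this subalgebra as an
ideal of itself. -/
theorem IsClosedIdeal.mem_of_closedIdealSpan_eq_top {J : Submodule ℂ A} (hJ : IsClosedIdeal J)
    {B : NonUnitalStarSubalgebra ℂ A} {S : Set B} (hS : closedIdealSpan S = ⊤)
    (h : ∀ p ∈ S, (p : A) ∈ J) {b : A} (hb : b ∈ B) : b ∈ J := by
  have : closedIdealSpan S ≤ J.comap (NonUnitalSubalgebraClass.subtype B : B →ₗ[ℂ] A) :=
    closedIdealSpan_le (hJ.comap_subtype B) h
  rw [hS] at this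
  exact this (Submodule.mem_top : (⟨b, hb⟩ : B) ∈ ⊤)

theorem ne_bot_of_mem {B : NonUnitalStarSubalgebra ℂ A} {b : A} (hb : b ∈ B) (h0 : b ≠ 0) :
    B ≠ ⊥ := fun h => h0 (by rw [h] at hb; exact NonUnitalStarAlgebra.mem_bot.1 hb)

theorem IsClosedIdeal.exists_nonneg_notMem [PartialOrder A] [StarOrderedRing A] {J : Submodule ℂ A}
    (hJ : IsClosedIdeal J) {I : Submodule ℂ A} (hI : IsClosedIdeal I) (h : ¬ I ≤ J) :
    ∃ a ∈ I, 0 ≤ a ∧ a ∉ J := by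
  obtain ⟨x, hxI, hxJ⟩ := Set.not_subset.1 h
  exact ⟨star x * x, hI.mul_left hxI _, star_mul_self_nonneg x,
    fun hx => hxJ (hJ.mem_of_star_mul_mem hx)⟩

variable [PartialOrder A] [StarOrderedRing A]

theorem IsClosedIdeal.isHereditary_starSubalgebra {I : Submodule ℂ A} (hI : IsClosedIdeal I) :
    IsHereditary hI.starSubalgebra :=
  ⟨hI.1, fun _ _ ha hab hb => hI.mem_of_le ha hab hb⟩

/-- v = pvp and w = pwp lie in B because BAB ⊆ B, so vv⋆, ww⋆ and the equivalences live in B. -/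
theorem IsHereditary.properlyInfinite_of_isometries {B : NonUnitalStarSubalgebra ℂ A}
    (hB : IsHereditary B) {p v w : A} (hp : IsStarProjection p) (hpB : p ∈ B) (hpv : p * v = v)
    (hpw : p * w = w) (hv : star v * v = p) (hw : star w * w = p) (hvw : star v * w = 0) :
    IsProperlyInfiniteProjection (⟨p, hpB⟩ : B) := by
  have hvB : v ∈ B := by
    have := hB.mul_mem hpB hpB v
    rwa [hpv, mul_eq_self_of_star_mul_self hp hv] at this
  have hwB : w ∈ B := by
    have := hB.mul_mem hpB hpB w
    rwa [hpw, mul_eq_self_of_star_mul_self hp hw] at this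
  have hmk : ∀ {u : A} (huB : u ∈ B), p * u = u → star u * u = p →
      IsSubprojection (⟨u, huB⟩ * star ⟨u, huB⟩ : B) ⟨p, hpB⟩ ∧
        MvNEquiv (⟨u, huB⟩ * star ⟨u, huB⟩ : B) ⟨p, hpB⟩ := by
    intro u huB hpu hu
    refine ⟨⟨isStarProjection_coe_iff.1 (isStarProjection_mul_star hp hu), Subtype.ext ?_⟩,
      star ⟨u, huB⟩, ?_, Subtype.ext ?_⟩
    · change p * (u * star u) = u * star u
      rw [← mul_assoc, hpu]
    · rw [star_star]
    · change star u * star (star u) = p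
      rw [star_star, hu]
  refine ⟨isStarProjection_coe_iff.1 hp, ⟨v, hvB⟩ * star ⟨v, hvB⟩, ⟨w, hwB⟩ * star ⟨w, hwB⟩,
    (hmk hvB hpv hv).1, (hmk hwB hpw hw).1, Subtype.ext ?_, (hmk hvB hpv hv).2, (hmk hwB hpw hw).2⟩
  change v * star v * (w * star w) = 0
  rw [mul_assoc, ← mul_assoc (star v), hvw, zero_mul, mul_zero]

theorem exists_nonneg_lift {Q : Type*} [NonUnitalCStarAlgebra Q] [PartialOrder Q] [StarOrderedRing Q]
    {π : A →⋆ₙₐ[ℂ] Q} (hπ : Function.Surjective π) {z : Q} (hz : 0 ≤ z) : ∃ d, 0 ≤ d ∧ π d = z := by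
  obtain ⟨s, hs, rfl⟩ := exists_sqrt hz
  obtain ⟨t, rfl⟩ := hπ s
  exact ⟨star t * t, star_mul_self_nonneg t, by rw [map_mul, map_star, hs.isSelfAdjoint.star_eq]⟩

end Subalgebra

/-! ### Infinite projections and absorption. -/

section Projections

variable {A : Type u} [NonUnitalCStarAlgebra A]

theorem IsProperlyInfiniteProjection.isInfiniteProjection {B : NonUnitalStarSubalgebra ℂ A} {p : B}
    (hp : IsProperlyInfiniteProjection p) (h0 : p ≠ 0) : IsInfiniteProjection p := by
  obtain ⟨hpp, p₁, p₂, h₁, h₂, h₁₂, ⟨v, hv, hv'⟩, ⟨w, hw, hw'⟩⟩ := hp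
  refine ⟨hpp, p₁, h₁, ?_, star v, by rw [star_star, hv'], by rw [star_star, hv]⟩
  rintro rfl
  rw [h₂.2] at h₁₂
  rw [h₁₂] at hw
  apply h0
  have hw0 : (w : A) = 0 := CStarRing.star_mul_self_eq_zero_iff (w : A) |>.1 (congrArg Subtype.val hw)
  rw [← hw', show w = 0 from Subtype.ext hw0, zero_mul]

variable [PartialOrder A] [StarOrderedRing A]

/-- A subprojection equivalent to a projection `p` of the hereditary subalgebra generated by `x` has
a complement in `p` that is absorbed by `x`. -/
theorem pairLE_sub_of_mvnEquiv {x : A} (hx : 0 ≤ x) {p q : her x} (hp : IsStarProjection p)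
    (hq : IsSubprojection q p) (h : MvNEquiv p q) : PairLE x ((p : A) - q) x := by
  obtain ⟨v, hv, hv'⟩ := h
  have hv1 : star (v : A) * v = p := congrArg Subtype.val hv
  have hv2 : (v : A) * star (v : A) = q := congrArg Subtype.val hv'
  have hpA := isStarProjection_coe_iff.2 hp
  rw [← hv2]
  refine pairLE_defect hx hpA p.2 hv1 ?_
  obtain ⟨u, hu⟩ : ∃ u : A, u = v := ⟨_, rfl⟩
  have hpq : p * (u * star u) = u * star u := by
    rw [hu, hv2]
    exact hq.coe.2
  have hqp : u * star u * p = u * star u := by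
    have := congrArg star hpq
    rwa [star_mul, hpA.isSelfAdjoint.star_eq, star_mul, star_star] at this
  rw [← hu, ← sub_eq_zero, ← CStarRing.mul_star_self_eq_zero_iff, star_sub, star_mul,
    hpA.isSelfAdjoint.star_eq]
  calc ((p : A) * u - u) * (star u * p - star u)
      = p * (u * star u) * p - p * (u * star u) - (u * star u) * p + u * star u := by noncomm_ring
    _ = 0 := by rw [hpq, hqp]; abel

/-- Both defects p - p₁ and p - p₂ are absorbed. By orthogonality p₂ = (p - p₁)p₂, so p₂ is absorbed
too, and hence p. -/
theorem IsProperlyInfiniteProjection.mem_absorbedIdeal {x : A} (hx : 0 ≤ x) {p : her x}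
    (hp : IsProperlyInfiniteProjection p) : (p : A) ∈ absorbedIdeal x hx := by
  obtain ⟨hpp, p₁, p₂, h₁, h₂, h₁₂, ⟨v, hv, hv'⟩, ⟨w, hw, hw'⟩⟩ := hp
  have hJ := isClosedIdeal_absorbedIdeal hx
  have hmem : ∀ {q : her x}, IsSubprojection q p → MvNEquiv p q →
      (p : A) - q ∈ absorbedIdeal x hx := by
    intro q hq h
    exact mem_absorbedIdeal_of_pairLE hx
      (hq.coe.isStarProjection_sub (isStarProjection_coe_iff.2 hpp)).nonneg
      (pairLE_sub_of_mvnEquiv hx hpp hq h)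
  have hp₁ := hmem h₁ ⟨star v, by rw [star_star, hv'], by rw [star_star, hv]⟩
  have hp₂ := hmem h₂ ⟨star w, by rw [star_star, hw'], by rw [star_star, hw]⟩
  have e₁ : (p₁ : A) * p₂ = 0 := congrArg Subtype.val h₁₂
  have e₂ : (p : A) * p₂ = p₂ := congrArg Subtype.val h₂.2
  have : (p₂ : A) = (p - p₁) * p₂ := by rw [sub_mul, e₁, e₂, sub_zero]
  have hp₂' : (p₂ : A) ∈ absorbedIdeal x hx := this ▸ hJ.mul_right hp₁ _
  simpa using Submodule.add_mem _ hp₂ hp₂'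

end Projections

/-! ### Self-absorption from conditions (iii) and (iv). -/

section Generated

variable {A : Type u} [NonUnitalCStarAlgebra A] [PartialOrder A] [StarOrderedRing A]

theorem HereditaryGeneratedByProperlyInfinite.isSelfAbsorbing
    (h : HereditaryGeneratedByProperlyInfinite A) : IsSelfAbsorbing A := by
  intro x hx
  by_cases h0 : x = 0
  · have := Submodule.zero_mem (absorbedIdeal x hx)
    exact (congrArg (· ∈ absorbedIdeal x hx) h0).mpr this
  · exact (isClosedIdeal_absorbedIdeal hx).mem_of_closedIdealSpan_eq_top
      (h _ (isHereditary_her x) (ne_bot_of_mem (self_mem_her hx) h0))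
      (fun p hp => IsProperlyInfiniteProjection.mem_absorbedIdeal hx hp) (self_mem_her hx)

theorem HereditaryGeneratedByProperlyInfinite.hasIdealProperty
    (h : HereditaryGeneratedByProperlyInfinite A) : HasIdealProperty A := by
  intro I J hI hJ hIJ
  by_contra! hno
  obtain ⟨x, hxI, hxJ⟩ := Set.not_subset.1 hIJ
  refine hxJ (hJ.mem_of_closedIdealSpan_eq_top (h _ hI.isHereditary_starSubalgebra
    (ne_bot_of_mem (B := hI.starSubalgebra) (b := x) hxI ?_)) (fun p hp => ?_)
    (B := hI.starSubalgebra) hxI)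
  · rintro rfl
    exact hxJ J.zero_mem
  · exact hno p (isStarProjection_coe_iff.2 hp.1) p.2

-- If x ∉ L(x), the image of x modulo L(x) has an infinite projection in its hereditary subalgebra.
-- That image absorbs the nonzero defect, so a positive lift of the defect lies in L(x): a
-- contradiction.
open IsClosedIdeal.Quotient in
theorem QuotientHereditaryContainsInfinite.isSelfAbsorbing
    (h : QuotientHereditaryContainsInfinite A) : IsSelfAbsorbing A := by
  intro x hx
  by_contra hne
  obtain ⟨π, hπ⟩ : ∃ π, π = mk (isClosedIdeal_absorbedIdeal hx) := ⟨_, rfl⟩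
  have hx' : 0 ≤ π x := starHom_nonneg π hx
  have h0 : π x ≠ 0 := by rwa [hπ, Ne, mk_eq_zero]
  obtain ⟨p, hp, q, hq, hqp, hpq⟩ := h _ π (hπ ▸ mk_surjective) _ (isHereditary_her (π x))
    (ne_bot_of_mem (self_mem_her hx') h0)
  have hpair := pairLE_sub_of_mvnEquiv hx' hp hq hpq
  obtain ⟨d, hd, hdpq⟩ := exists_nonneg_lift (hπ ▸ mk_surjective)
    (hq.coe.isStarProjection_sub (isStarProjection_coe_iff.2 hp)).nonneg
  rw [← hdpq] at hpair
  subst hπ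
  have := mem_absorbedIdeal_of_pairLE_mk hx hd hpair
  rw [← mk_eq_zero (hI := isClosedIdeal_absorbedIdeal hx), hdpq, sub_eq_zero] at this
  exact hqp (Subtype.ext this.symm)

end Generated

/-! ### The ideal property and its consequences. -/

section IdealProperty

variable {A : Type u} [NonUnitalCStarAlgebra A] [PartialOrder A] [StarOrderedRing A]

open IsClosedIdeal.Quotient in
/-- If the square of `c` differs from `c` by an element of the closed ideal generated by the
projections of a closed ideal `I` containing `c`, then `c` lies in this ideal. -/
theorem IsSelfAbsorbing.mem_span_projections (hA : IsSelfAbsorbing A) {I : Submodule ℂ A}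
    (hI : IsClosedIdeal I) {c : A} (hc : 0 ≤ c) (hcI : c ∈ I)
    (hcc : c - c * c ∈ closedIdealSpan {p | IsStarProjection p ∧ p ∈ I}) :
    c ∈ closedIdealSpan {p | IsStarProjection p ∧ p ∈ I} := by
  classical
  -- t ≤ 3/16 + t² together with t ≤ 1/2 forces t ≤ 1/4, which leaves room for the cut at 3/8 < 1/2.
  obtain ⟨F, hF, l, hl, hcl⟩ := exists_finset_of_mem_closedIdealSpan hcc
    (by norm_num : (0 : ℝ) < 3 / 16)
  obtain ⟨K, hKdef⟩ : ∃ K, K = closedIdealSpan {p | IsStarProjection p ∧ p ∈ I} := ⟨_, rfl⟩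
  have hK : IsClosedIdeal K := hKdef ▸ isClosedIdeal_closedIdealSpan _
  have hFK : ∀ e ∈ F, e ∈ K := fun e he => hKdef ▸ subset_closedIdealSpan _ (hF he)
  rw [← hKdef] at hcc ⊢
  -- Passing from c to d = c + s makes each e ∈ F at most d; then its norm modulo the ideal of (d -
  -- 1/2)₊ is at most 1/2, and being a projection it vanishes there.
  obtain ⟨s, hs⟩ : ∃ s, s = ∑ e ∈ F, e := ⟨_, rfl⟩
  have hF0 : ∀ e ∈ F, 0 ≤ e := fun e he => (hF he).1.nonneg
  have hs0 : 0 ≤ s := hs ▸ Finset.sum_nonneg hF0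
  have hd0 : 0 ≤ c + s := add_nonneg hc hs0
  have hsI : s ∈ I := hs ▸ Submodule.sum_mem _ fun e he => (hF he).2
  -- modulo the ideal of `(d - 1/2)₊` the finitely many projections vanish
  have hM := isClosedIdeal_closedIdealSpan {cut (c + s) (1 / 2)}
  have hMd : ‖mk hM (c + s)‖ ≤ 1 / 2 :=
    (hM.cut_mem_iff hd0 (by norm_num)).1 (mem_closedIdealSpan_singleton _)
  have hMle : ∀ e, 0 ≤ e → e ≤ c + s → ‖mk hM e‖ ≤ 1 / 2 := by
    intro e he hle
    refine (CStarAlgebra.norm_le_norm_of_nonneg_of_le (starHom_nonneg _ he) ?_).trans hMd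
    rw [← sub_nonneg, ← map_sub]
    exact starHom_nonneg _ (sub_nonneg.2 hle)
  have hFM : ∀ e ∈ F, e ∈ closedIdealSpan {cut (c + s) (1 / 2)} := by
    intro e he
    refine hM.mem_of_norm_mk_projection_lt (hF he).1 ((hMle e (hF0 e he) ?_).trans_lt (by norm_num))
    exact (hs ▸ Finset.single_le_sum hF0 he : e ≤ s).trans (le_add_of_nonneg_left hc)
  have hlM : mk hM l = 0 := mk_eq_zero.2 (closedIdealSpan_le hM hFM hl)
  have hsM : mk hM s = 0 := by
    have := Submodule.sum_mem _ hFM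
    rwa [← hs, ← mk_eq_zero (hI := hM)] at this
  have hcM : ‖mk hM c‖ ≤ 3 / 8 := by
    have h1 := hMle c hc (le_add_of_nonneg_right hs0)
    have h2 : mk hM c = mk hM (c - c * c - l) + mk hM c * mk hM c := by
      rw [map_sub, hlM, map_sub, map_mul]
      abel
    have h3 : ‖mk hM c‖ ≤ 3 / 16 + ‖mk hM c‖ * ‖mk hM c‖ := by
      conv_lhs => rw [h2]
      exact (norm_add_le _ _).trans (add_le_add ((norm_mk_le _).trans hcl.le) (norm_mul_le _ _))
    nlinarith [norm_nonneg (mk hM c)]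
  have hcut : cut (c + s) (3 / 8) ∈ closedIdealSpan {cut (c + s) (1 / 2)} := by
    rw [hM.cut_mem_iff hd0 (by norm_num), map_add, hsM, add_zero]
    exact hcM
  obtain ⟨p, hp, hpI, hpc⟩ := exists_projection_of_cut_mem_absorbedIdeal hd0
    (by norm_num : (0 : ℝ) ≤ 3 / 8) (by norm_num : (3 / 8 : ℝ) < 1 / 2)
    (closedIdealSpan_singleton_le (isClosedIdeal_absorbedIdeal _) (hA _ (cut_nonneg _ _)) hcut)
    hI (Submodule.add_mem _ hcI hsI)
  -- hence `c` has norm at most `1/2` in the quotient by the ideal of the projections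
  have hpK : p ∈ K := hKdef ▸ subset_closedIdealSpan _ ⟨hp, hpI⟩
  have hcutK := closedIdealSpan_singleton_le hK hpK hpc
  rw [hK.cut_mem_iff hd0 (by norm_num), map_add,
    mk_eq_zero.2 (hs ▸ Submodule.sum_mem _ hFK : s ∈ K), add_zero] at hcutK
  have h1 : mk hK c = mk hK c * mk hK c := by
    rw [← sub_eq_zero, ← map_mul, ← map_sub, mk_eq_zero]
    exact hcc
  have h2 : ‖mk hK c‖ ≤ ‖mk hK c‖ * ‖mk hK c‖ := by
    conv_lhs => rw [h1]
    exact norm_mul_le _ _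
  rw [← mk_eq_zero (hI := hK), ← norm_le_zero_iff]
  nlinarith [norm_nonneg (mk hK c)]

-- Let K be generated by the projections of I. If all of them lie in J but I does not, then (iv)
-- gives a nonzero projection modulo K in the hereditary subalgebra of the image of some a ∈ I. It
-- lifts to a positive c = (sx)⋆(sx) ∈ I with c - c² ∈ K, and `IsSelfAbsorbing.mem_span_projections`
-- forces c ∈ K.
open IsClosedIdeal.Quotient in
theorem QuotientHereditaryContainsInfinite.hasIdealProperty
    (h : QuotientHereditaryContainsInfinite A) : HasIdealProperty A := by
  intro I J hI hJ hIJ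
  by_contra! hno
  obtain ⟨K, hKdef⟩ : ∃ K, K = closedIdealSpan {p | IsStarProjection p ∧ p ∈ I} := ⟨_, rfl⟩
  have hK : IsClosedIdeal K := hKdef ▸ isClosedIdeal_closedIdealSpan _
  have hKJ : K ≤ J := hKdef ▸ closedIdealSpan_le hJ fun p hp => hno p hp.1 hp.2
  obtain ⟨a, haI, ha, haJ⟩ := hJ.exists_nonneg_notMem hI hIJ
  have ha' : 0 ≤ mk hK a := starHom_nonneg _ ha
  have ha0 : mk hK a ≠ 0 := fun h0 => haJ (hKJ (mk_eq_zero.1 h0))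
  obtain ⟨q, hq, r, hr, hrq, hqr⟩ := h _ (mk hK) mk_surjective _ (isHereditary_her (mk hK a))
    (ne_bot_of_mem (self_mem_her ha') ha0)
  have hqA := isStarProjection_coe_iff.2 hq
  have hq0 : (q : hK.Quotient) ≠ 0 := by
    intro h0
    apply hrq
    have : q = 0 := Subtype.ext h0
    rw [← hr.2, this, zero_mul]
  obtain ⟨s, hs, rfl⟩ := exists_sqrt ha
  obtain ⟨x', hx'⟩ := CuntzLE.exists_partialIsometry (a := mk hK s) hqA (by
    rw [← map_star, hs.isSelfAdjoint.star_eq, ← map_mul]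
    exact cuntzLE_of_mem_her ha' hqA.nonneg q.2)
  obtain ⟨x, rfl⟩ := mk_surjective x'
  have hsI : s ∈ I := hI.mem_of_mul_star_mem (by rwa [hs.isSelfAdjoint.star_eq])
  rw [← map_mul, ← map_star, ← map_mul] at hx'
  refine hq0 ?_
  rw [← hx', mk_eq_zero, hKdef]
  refine (h.isSelfAbsorbing).mem_span_projections hI (star_mul_self_nonneg _)
    (hI.mul_left (hI.mul_right hsI x) _) ?_
  rw [← hKdef, ← mk_eq_zero (hI := hK), map_sub, map_mul _ (_ * _), hx', hqA.isIdempotentElem.eq,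
    sub_self]

/-- With the ideal property and absorption, hereditary subalgebras contain projections that are not
in a given closed ideal. -/
theorem IsSelfAbsorbing.exists_projection_conj (hA : IsSelfAbsorbing A) (hIP : HasIdealProperty A)
    {J : Submodule ℂ A} (hJ : IsClosedIdeal J) {b : A} (hb : 0 ≤ b) (hbJ : b ∉ J) :
    ∃ x v w, IsStarProjection (b * x * b) ∧ b * x * b * v = v ∧ b * x * b * w = w ∧
      star v * v = b * x * b ∧ star w * w = b * x * b ∧ star v * w = 0 ∧
      ∃ y z, y * (b * x * b) * z ∉ J := by
  have hbs := hb.isSelfAdjoint.star_eq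
  obtain ⟨p, hp, hpb, hpJ⟩ := hIP (closedIdealSpan {b * b}) J (isClosedIdeal_closedIdealSpan _) hJ
    (fun hle => hbJ (hJ.mem_of_mul_star_mem (by
      rw [hbs]
      exact hle (mem_closedIdealSpan_singleton _))))
  -- p = (bx)⋆(bx) is moved to the equivalent projection bxx⋆b, which lies in bAb and still
  -- generates p.
  obtain ⟨x, hx⟩ := CuntzLE.exists_partialIsometry (a := b) hp (by
    rw [hbs]
    exact (hA.mem_closedIdealSpan_iff hp.nonneg hb.isSelfAdjoint.mul_self_nonneg).1 hpb)
  have hproj := isStarProjection_mul_star hp hx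
  have heq : b * x * star (b * x) = b * (x * star x) * b := by
    rw [star_mul, hbs]
    simp only [mul_assoc]
  obtain ⟨v, w, h⟩ := (hA.pairLE hproj.nonneg).exists_isometries hproj
  rw [heq] at hproj h
  refine ⟨x * star x, v, w, hproj, h.1, h.2.1, h.2.2.1, h.2.2.2.1, h.2.2.2.2, star (b * x), b * x,
    ?_⟩
  rw [← heq]
  have : star (b * x) * (b * x * star (b * x)) * (b * x) = p := by
    rw [← mul_assoc (star (b * x)), hx, mul_assoc p, hx, hp.isIdempotentElem.eq]
  rwa [this]

theorem IsSelfAbsorbing.quotientHereditaryContainsInfinite (hA : IsSelfAbsorbing A)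
    (hIP : HasIdealProperty A) : QuotientHereditaryContainsInfinite A := by
  intro Q _ _ _ π hπ B hB hB0
  obtain ⟨b, hbB, hb0⟩ : ∃ b ∈ B, b ≠ 0 := by
    by_contra! h
    exact hB0 (eq_bot_iff.2 fun b hb => NonUnitalStarAlgebra.mem_bot.2 (h b hb))
  obtain ⟨c, hc, hcb⟩ := exists_nonneg_lift hπ (star_mul_self_nonneg b)
  have hcB : π c ∈ B := hcb ▸ mul_mem (star_mem hbB) hbB
  let J : Submodule ℂ A := LinearMap.ker (π : A →ₗ[ℂ] Q)
  have hJ : IsClosedIdeal J := by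
    have hcont : Continuous π := AddMonoidHomClass.continuous_of_bound π 1 fun x => by
      simpa using NonUnitalStarAlgHom.norm_apply_le π x
    refine ⟨isClosed_eq hcont continuous_const, fun x hx a => ⟨?_, ?_⟩⟩
    · change π (a * x) = 0
      rw [map_mul, show π x = 0 from hx, mul_zero]
    · change π (x * a) = 0
      rw [map_mul, show π x = 0 from hx, zero_mul]
  have hcJ : c ∉ J := by
    intro h
    have : π c = 0 := h
    rw [hcb, CStarRing.star_mul_self_eq_zero_iff] at this
    exact hb0 this
  obtain ⟨x, v, w, hp, hpv, hpw, hv, hw, hvw, y, z, hyz⟩ := hA.exists_projection_conj hIP hJ hc hcJ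
  have hpB : π (c * x * c) ∈ B := by
    rw [map_mul, map_mul]
    exact hB.mul_mem hcB hcB _
  refine ⟨⟨_, hpB⟩, (hB.properlyInfinite_of_isometries (v := π v) (w := π w) (hp.map π) hpB ?_ ?_ ?_
    ?_ ?_).isInfiniteProjection fun h0 => hyz ?_⟩
  · rw [← map_mul, hpv]
  · rw [← map_mul, hpw]
  · rw [← map_star, ← map_mul, hv]
  · rw [← map_star, ← map_mul, hw]
  · rw [← map_star, ← map_mul, hvw, map_zero]
  · have : c * x * c ∈ J := congrArg Subtype.val h0
    exact hJ.mul_right (hJ.mul_left this _) _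

/-- If the ideal I of B were proper, the elements x of A with B(AxA)B ⊆ I would form a closed ideal
J missing some positive b ∈ B. Then `exists_projection_conj` gives a properly infinite projection p
∈ B outside J. But p ∈ I, and p = p³ gives uypzv = (uyp)p(pzv) ∈ I, so p ∈ J. -/
theorem IsSelfAbsorbing.hereditaryGeneratedByProperlyInfinite (hA : IsSelfAbsorbing A)
    (hIP : HasIdealProperty A) : HereditaryGeneratedByProperlyInfinite A := by
  intro B hB _
  have hcl : IsClosed (B : Set A) := hB.1
  obtain ⟨I, hIdef⟩ : ∃ I, I = closedIdealSpan {p : B | IsProperlyInfiniteProjection p} := ⟨_, rfl⟩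
  have hI : IsClosedIdeal I := hIdef ▸ isClosedIdeal_closedIdealSpan _
  rw [← hIdef, eq_top_iff]
  by_contra hne
  obtain ⟨b₀, -, hb₀⟩ := Set.not_subset.1 hne
  obtain ⟨b, hb⟩ : ∃ b, b = star b₀ * b₀ := ⟨_, rfl⟩
  have hbI : b ∉ I := fun h => hb₀ (hI.mem_of_star_mul_mem (hb ▸ h))
  have hbA : 0 ≤ (b : A) := by
    rw [hb]
    exact star_mul_self_nonneg (b₀ : A)
  -- the ideal of `A` induced by `I`
  let T (u v : B) (y z : A) : A →ₗ[ℂ] B :=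
    { toFun := fun x => ⟨u * (y * x * z) * v, hB.mul_mem u.2 v.2 _⟩
      map_add' := fun x x' => Subtype.ext (by simp [mul_add, add_mul])
      map_smul' := fun c x => Subtype.ext (by simp [mul_smul_comm, smul_mul_assoc]) }
  let J : Submodule ℂ A := ⨅ (u : B) (v : B) (y : A) (z : A), I.comap (T u v y z)
  have memJ : ∀ {x}, x ∈ J ↔ ∀ u v y z, T u v y z x ∈ I := by
    intro x; simp only [J, Submodule.mem_iInf, Submodule.mem_comap]
  have hJ : IsClosedIdeal J := by
    refine ⟨?_, fun x hx a => ⟨memJ.2 fun u v y z => ?_, memJ.2 fun u v y z => ?_⟩⟩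
    · have : (J : Set A) = ⋂ (u : B) (v : B) (y : A) (z : A), T u v y z ⁻¹' I := by
        ext x
        simp only [SetLike.mem_coe, memJ, Set.mem_iInter, Set.mem_preimage]
      rw [this]
      refine isClosed_iInter fun u => isClosed_iInter fun v => isClosed_iInter fun y =>
        isClosed_iInter fun z => hI.1.preimage ?_
      exact Continuous.subtype_mk (by fun_prop) _
    · have := memJ.1 hx u v (y * a) z
      simpa only [T, LinearMap.coe_mk, AddHom.coe_mk, mul_assoc] using this
    · have := memJ.1 hx u v y (a * z)
      simpa only [T, LinearMap.coe_mk, AddHom.coe_mk, mul_assoc] using this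
  have hbJ : (b : A) ∉ J := by
    intro h
    -- From b⁵ ∈ I one descends to b: b⁶ gives b³, then b⁴ gives b², then b.
    have h5 : b * (b * b * b) * b ∈ I := memJ.1 h b b b b
    have hbs : star b = b := by rw [hb, star_mul, star_star]
    have h6 : star (b * b * b) * (b * b * b) ∈ I := by
      have := hI.mul_left h5 b
      simpa only [star_mul, hbs, mul_assoc] using this
    have h3 := hI.mem_of_star_mul_mem h6
    have h4 : star (b * b) * (b * b) ∈ I := by
      have := hI.mul_left h3 b
      simpa only [star_mul, hbs, mul_assoc] using this
    have h2 := hI.mem_of_star_mul_mem h4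
    exact hbI (hI.mem_of_star_mul_mem (by rwa [hbs]))
  obtain ⟨x, v, w, hp, hpv, hpw, hv, hw, hvw, y, z, hyz⟩ := hA.exists_projection_conj hIP hJ hbA hbJ
  have hpB : (b : A) * x * b ∈ B := hB.mul_mem b.2 b.2 x
  have hpI : (⟨_, hpB⟩ : B) ∈ I := hIdef ▸ subset_closedIdealSpan _
    (hB.properlyInfinite_of_isometries hp hpB hpv hpw hv hw hvw)
  refine hyz (hJ.mul_right (hJ.mul_left (memJ.2 fun u u' y' z' => ?_) _) _)
  obtain ⟨p, hpdef⟩ : ∃ p, p = (b : A) * x * b := ⟨_, rfl⟩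
  have hpB' : p ∈ B := hpdef ▸ hpB
  have hpp : p * p = p := by rw [hpdef]; exact hp.isIdempotentElem.eq
  have h1 : (⟨u * y' * p, hB.mul_mem u.2 hpB' y'⟩ : B) * ⟨_, hpB⟩
      * ⟨p * z' * u', hB.mul_mem hpB' u'.2 z'⟩ ∈ I := hI.mul_right (hI.mul_left hpI _) _
  convert h1 using 1
  refine Subtype.ext ?_
  change (u : A) * (y' * ((b : A) * x * b) * z') * u'
    = u * y' * p * ((b : A) * x * b) * (p * z' * u')
  rw [← hpdef]
  calc (u : A) * (y' * p * z') * u' = u * (y' * (p * p * p) * z') * u' := by rw [hpp, hpp]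
    _ = _ := by simp only [mul_assoc]

end IdealProperty

/-! ### Compact-open sets of primitive ideals and projections. -/

section PrimTopology

variable {A : Type u} [NonUnitalCStarAlgebra A]

theorem isClosed_hull (S : Set A) : IsClosed (hull S) := isClosed_iff_hull.2 ⟨S, rfl⟩

theorem mem_hull_iff {S : Set A} {P : Prim A} : P ∈ hull S ↔ S ⊆ (P.1 : Set A) := Iff.rfl

theorem Prim.isClosedIdeal (P : Prim A) : IsClosedIdeal P.1 := P.2.isClosedIdeal

/-- An element lies in the closed ideal generated by `S` if it lies in all primitive ideals
containing `S`. -/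
theorem mem_closedIdealSpan_of_forall_prim {S : Set A} {x : A} (h : ∀ P ∈ hull S, x ∈ P.1) :
    x ∈ closedIdealSpan S := by
  by_contra hx
  obtain ⟨P, hP, hxP⟩ := (isClosedIdeal_closedIdealSpan S).exists_prim hx
  exact hxP (h P ((subset_closedIdealSpan S).trans hP))

/-- The primitive ideals not containing a given projection form a compact set. -/
theorem isCompact_compl_hull_of_isStarProjection {p : A} (hp : IsStarProjection p) :
    IsCompact (hull {p})ᶜ := by
  rw [isCompact_iff_finite_subcover]
  intro ι U hU hcover
  choose S hS using fun i => isClosed_iff_hull.1 (hU i).isClosed_compl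
  -- The covering says exactly that p lies in the ideal of all the S i; finitely many elements of
  -- their union already suffice for a projection.
  have hmem : p ∈ closedIdealSpan (⋃ i, S i) := by
    refine mem_closedIdealSpan_of_forall_prim fun P hP => ?_
    by_contra hpP
    obtain ⟨i, hi⟩ := Set.mem_iUnion.1 (hcover (show P ∈ (hull {p})ᶜ by
      simpa [mem_hull_iff] using hpP))
    have : P ∈ (U i)ᶜ := by
      rw [hS i]
      exact (Set.subset_iUnion S i).trans hP
    exact this hi
  obtain ⟨F, hF, hpF⟩ := exists_finset_of_isStarProjection_mem hp hmem
  choose g hg using fun x : F => Set.mem_iUnion.1 (hF x.2)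
  classical
  refine ⟨Finset.univ.image g, fun P hP => ?_⟩
  by_contra hno
  simp only [Set.mem_iUnion, not_exists] at hno
  refine hP (mem_hull_iff.2 (Set.singleton_subset_iff.2
    (closedIdealSpan_le P.isClosedIdeal (fun x hx => ?_) hpF)))
  obtain ⟨y, hy⟩ : ∃ y : F, y = ⟨x, hx⟩ := ⟨_, rfl⟩
  have : P ∈ (U (g y))ᶜ := hno _ (Finset.mem_image_of_mem g (Finset.mem_univ y))
  rw [hS] at this
  simpa [hy] using this (hg y)

theorem HasIdealProperty.hasCompactOpenBasis (hIP : HasIdealProperty A) : HasCompactOpenBasis A := by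
  refine TopologicalSpace.isTopologicalBasis_of_isOpen_of_nhds (fun U hU => hU.1) ?_
  intro P U hPU hU
  obtain ⟨S, hS⟩ := isClosed_iff_hull.1 hU.isClosed_compl
  have hPS : ¬ closedIdealSpan S ≤ P.1 := by
    intro h
    have : P ∈ Uᶜ := by
      rw [hS]
      exact (subset_closedIdealSpan S).trans h
    exact this hPU
  obtain ⟨p, hp, hpS, hpP⟩ := hIP _ _ (isClosedIdeal_closedIdealSpan S) P.isClosedIdeal hPS
  refine ⟨(hull {p})ᶜ, ⟨(isClosed_hull _).isOpen_compl,
    isCompact_compl_hull_of_isStarProjection hp⟩, ?_, ?_⟩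
  · simpa [mem_hull_iff] using hpP
  · rw [Set.compl_subset_comm, hS]
    intro Q hQ
    exact Set.singleton_subset_iff.2 (closedIdealSpan_le Q.isClosedIdeal hQ hpS)

variable [PartialOrder A] [StarOrderedRing A]

open IsClosedIdeal.Quotient in
/-- A compact-open set of primitive ideals is given by an element of the corresponding closed ideal
that is bounded away from zero on it. -/
theorem exists_cut_notMem_of_isCompact {S : Set A} (hS : IsCompact (hull S)ᶜ) :
    ∃ x ∈ closedIdealSpan S, 0 ≤ x ∧ ∃ δ : ℝ, 0 < δ ∧ ∀ P ∈ (hull S)ᶜ, cut x δ ∉ P.1 := by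
  have hI := isClosedIdeal_closedIdealSpan S
  let ι := {q : A × ℝ // q.1 ∈ closedIdealSpan S ∧ 0 ≤ q.1 ∧ 0 < q.2}
  let W : ι → Set (Prim A) := fun q => (hull {cut q.1.1 q.1.2})ᶜ
  have memW : ∀ {P : Prim A} {q : ι}, P ∈ W q ↔ cut q.1.1 q.1.2 ∉ P.1 := by
    intro P q
    simp [W, mem_hull_iff]
  have hne : Nonempty ι := ⟨⟨(0, 1), Submodule.zero_mem _, le_rfl, one_pos⟩⟩
  have hcover : (hull S)ᶜ ⊆ ⋃ q, W q := by
    intro P hP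
    obtain ⟨s, hs, hsP⟩ := Set.not_subset.1 hP
    by_contra hno
    rw [Set.mem_iUnion, not_exists] at hno
    refine hsP (P.isClosedIdeal.mem_of_star_mul_mem (mem_of_cut_mem (star_mul_self_nonneg s)
      P.isClosedIdeal.1 fun δ hδ => ?_))
    have := hno ⟨(star s * s, δ), hI.mul_left (subset_closedIdealSpan S hs) _,
      star_mul_self_nonneg s, hδ⟩
    rw [memW, not_not] at this
    exact this
  -- The pair (x + y, min δ η) dominates both: a truncation lies outside P exactly when the norm
  -- modulo P exceeds the threshold. Directedness lets compactness select one pair.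
  have hdir : Directed (· ⊆ ·) W := by
    rintro ⟨⟨x, δ⟩, hxS, hx, hδ⟩ ⟨⟨y, η⟩, hyS, hy, hη⟩
    have key : ∀ {a b : A} {α β : ℝ}, 0 ≤ a → a ≤ b → 0 < β → β ≤ α → ∀ P : Prim A,
        cut a α ∉ P.1 → cut b β ∉ P.1 := by
      intro a b α β ha hab hβ hβα P h1 h2
      rw [P.isClosedIdeal.cut_mem_iff (ha.trans hab) hβ.le] at h2
      refine h1 ((P.isClosedIdeal.cut_mem_iff ha (hβ.le.trans hβα)).2 (le_trans ?_ (h2.trans hβα)))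
      refine CStarAlgebra.norm_le_norm_of_nonneg_of_le (starHom_nonneg _ ha) ?_
      rw [← sub_nonneg, ← map_sub]
      exact starHom_nonneg _ (sub_nonneg.2 hab)
    refine ⟨⟨(x + y, min δ η), Submodule.add_mem _ hxS hyS, add_nonneg hx hy, lt_min hδ hη⟩, ?_, ?_⟩
    · exact fun P hP => memW.2 (key hx (le_add_of_nonneg_right hy) (lt_min hδ hη) (min_le_left _ _) P
        (memW.1 hP))
    · exact fun P hP => memW.2 (key hy (le_add_of_nonneg_left hx) (lt_min hδ hη) (min_le_right _ _) P
        (memW.1 hP))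
  obtain ⟨⟨⟨x, δ⟩, hxS, hx, hδ⟩, hq⟩ :=
    hS.elim_directed_cover W (fun q => (isClosed_hull _).isOpen_compl) hcover hdir
  exact ⟨x, hxS, hx, δ, hδ, fun P hP => memW.1 (hq hP)⟩

/-- A compact-open V around some P ⊇ J, avoiding the hull of I, yields x in the ideal of V with (x -
δ)₊ in no member of V. So (x - δ)₊ generates this ideal and absorbs x = (x - 0)₊; scaling with α = 0
gives a projection p ∈ I. Were p ∈ J ⊆ P, then (x - δ)₊ ∈ P. -/
theorem IsSelfAbsorbing.hasIdealProperty (hA : IsSelfAbsorbing A) (hB : HasCompactOpenBasis A) :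
    HasIdealProperty A := by
  intro I J hI hJ hIJ
  obtain ⟨a, haI, haJ⟩ := Set.not_subset.1 hIJ
  obtain ⟨P, hJP, haP⟩ := hJ.exists_prim haJ
  have hPI : P ∈ (hull (I : Set A))ᶜ := fun h => haP (h haI)
  obtain ⟨V, ⟨hVo, hVc⟩, hPV, hVI⟩ :=
    hB.exists_subset_of_mem_open hPI (isClosed_hull _).isOpen_compl
  obtain ⟨S, hS⟩ := isClosed_iff_hull.1 hVo.isClosed_compl
  have hVS : V = (hull S)ᶜ := by rw [← hS, compl_compl]
  rw [hVS] at hVc hPV hVI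
  have hSI : closedIdealSpan S ≤ I := by
    intro x hx
    by_contra hxI
    obtain ⟨Q, hQ, hxQ⟩ := hI.exists_prim hxI
    refine hxQ (closedIdealSpan_le Q.isClosedIdeal ?_ hx)
    by_contra hSQ
    exact hVI hSQ hQ
  obtain ⟨x, hxS, hx, δ, hδ, hxδ⟩ := exists_cut_notMem_of_isCompact hVc
  have hmem : closedIdealSpan S ≤ closedIdealSpan {cut x δ} := by
    intro y hy
    refine mem_closedIdealSpan_of_forall_prim fun Q hQ => ?_
    by_contra hyQ
    refine hxδ Q (fun hSQ => hyQ (closedIdealSpan_le Q.isClosedIdeal hSQ hy)) ?_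
    exact Set.singleton_subset_iff.1 hQ
  obtain ⟨p, hp, hpS, hpx⟩ := exists_projection_of_cut_mem_absorbedIdeal hx le_rfl hδ (by
    rw [cut_zero hx]
    exact closedIdealSpan_singleton_le (isClosedIdeal_absorbedIdeal _) (hA _ (cut_nonneg _ _))
      (hmem hxS)) (isClosedIdeal_closedIdealSpan S) hxS
  exact ⟨p, hp, hSI hpS, fun hpJ =>
    hxδ P hPV (closedIdealSpan_singleton_le P.isClosedIdeal (hJP hpJ) hpx)⟩

end PrimTopology

end CStarPI

/-! ### The equivalences. -/

theorem mainTheorem3 (A : Type u) [NonUnitalCStarAlgebra A] [PartialOrder A] [StarOrderedRing A] :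
    (TopologicalSpace.SeparableSpace A →
      List.TFAE
        [CStarPI.IsPurelyInfinite A ∧ CStarPI.HasCompactOpenBasis A,
         CStarPI.IsPurelyInfinite A ∧ CStarPI.HasIdealProperty A,
         CStarPI.HereditaryGeneratedByProperlyInfinite A,
         CStarPI.QuotientHereditaryContainsInfinite A]) ∧
    (CStarPI.IsPurelyInfinite A ∧ CStarPI.HasIdealProperty A →
      CStarPI.IsPurelyInfinite A ∧ CStarPI.HasCompactOpenBasis A) ∧
    (CStarPI.IsPurelyInfinite A ∧ CStarPI.HasIdealProperty A ↔
      CStarPI.HereditaryGeneratedByProperlyInfinite A) ∧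
    (CStarPI.HereditaryGeneratedByProperlyInfinite A ↔
      CStarPI.QuotientHereditaryContainsInfinite A) := by
  have h21 : CStarPI.IsPurelyInfinite A ∧ CStarPI.HasIdealProperty A →
      CStarPI.IsPurelyInfinite A ∧ CStarPI.HasCompactOpenBasis A :=
    fun h => ⟨h.1, h.2.hasCompactOpenBasis⟩
  have h12 : CStarPI.IsPurelyInfinite A ∧ CStarPI.HasCompactOpenBasis A →
      CStarPI.IsPurelyInfinite A ∧ CStarPI.HasIdealProperty A :=
    fun h => ⟨h.1, h.1.isSelfAbsorbing.hasIdealProperty h.2⟩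
  have h23 : CStarPI.IsPurelyInfinite A ∧ CStarPI.HasIdealProperty A ↔
      CStarPI.HereditaryGeneratedByProperlyInfinite A :=
    ⟨fun h => h.1.isSelfAbsorbing.hereditaryGeneratedByProperlyInfinite h.2,
      fun h => ⟨h.isSelfAbsorbing.isPurelyInfinite, h.hasIdealProperty⟩⟩
  have h24 : CStarPI.IsPurelyInfinite A ∧ CStarPI.HasIdealProperty A ↔
      CStarPI.QuotientHereditaryContainsInfinite A :=
    ⟨fun h => h.1.isSelfAbsorbing.quotientHereditaryContainsInfinite h.2,
      fun h => ⟨h.isSelfAbsorbing.isPurelyInfinite, h.hasIdealProperty⟩⟩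
  refine ⟨fun _ => ?_, h21, h23, h23.symm.trans h24⟩
  tfae_have 1 ↔ 2 := ⟨h12, h21⟩
  tfae_have 2 ↔ 3 := h23
  tfae_have 2 ↔ 4 := h24
  tfae_finish
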